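/- **Setting.** Let $R$ be an associative ring with $1$ and involution $a\mapsto\overline a$ which is finitely generated as a module over its centre $C(R)$; let $\lambda\in C(R)$ with $\lambda\overline\lambda=1$, and let $\Lambda$ be a $\lambda$-form parameter, i.e. an additive subgroup with $\{a-\lambda\overline a\}\subseteq\Lambda\subseteq\{a : a=-\lambda\overline a\}$ and $\overline x\Lambda x\subseteq\Lambda$ for all $x\in R$. Let $J\subseteq R$ be a two-sided ideal with $\overline J=J$. The involution is extended to $R[X]$ by $\overline X=X$; $\Lambda[X]$ and $J[X]$ are the polynomials with coefficients in $\Lambda$ and $J$. Put $C_\Lambda=\{c\in C(R): \overline c=c,\ c\Lambda\subseteq\Lambda\}$, a commutative subring of $R$. A quadratic module over $(R,\Lambda)$ is a right $R$-module $P$ with a sesquilinear form $f$ ($f(pa,qb)=\overline a f(p,q)b$), the Hermitian form $h(p,q)=f(p,q)+\lambda\overline{f(q,p)}$ and the quadratic form $p\mapsto f(p,p)+\Lambda\in R/\Lambda$; isometries are linear bijections preserving both. $\mathbb H(R^m)$ is $R^{2m}$ with $f(x,y)=\sum_{i\le m}\overline{x_i}\,y_{m+i}$. $GQ(P,\Lambda,J)$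 is the group of self-isometries of $P$ congruent to $\mathrm{Id}$ modulo $JP$. For $Q=P\perp\mathbb H(R)=\{(p,c,d)\}$ the elementary transvections are, for $q\in P$ and $a\in f(q,q)+\Lambda$, $$(p,c,d)\mapsto(p-qc,\;c,\;d+h(q,p)-ac),\qquad (p,c,d)\mapsto(p-q\overline\lambda d,\;c+h(q,p)-\overline\lambda a d,\;d).$$ They generate $ET(Q,\Lambda)$; $ET(Q,\Lambda,J)$ is the normal closure in $ET(Q,\Lambda)$ of those with $q\in JP$ and $a\in J$. $EQ(2m,R,\Lambda,J)$ is the group generated by the matrices $\eta(x)\,\eta'(a)\,\eta(x)^{-1}$ with $x\in R$, $a\in J$, where $(\eta,\eta')$ is one of the opposite pairs $(q\varepsilon_{ij},q\varepsilon_{ji})$, $(qr_{ij},ql_{ji})$, $(ql_{ij},qr_{ji})$ of elementary matrices of size $2m$: $q\varepsilon_{ij}(a)=I+ae_{ij}-\overline a e_{m+j,m+i}$ ($i\ne j$); $qr_{ij}(a)=I+ae_{i,m+j}-\overline\lambda\overline a e_{j,m+i}$ ($i\ne j$), $qr_{ii}(a)=I+ae_{i,m+i}$ ($\overline a\in\Lambda$);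 $ql_{ij}(a)=I+ae_{m+i,j}-\lambda\overline a e_{m+j,i}$ ($i\neq j$), $ql_{ii}(a)=I+ae_{m+i,i}$ ($a\in\Lambda$). **Proposition (relative dilation principle).** Let $P$ be a non-singular quadratic module over $(R,\Lambda)$, finitely generated and projective over $R$, and let $n\ge 3$. Let $s\in C_\Lambda$ be non-nilpotent, and let $R_s,P_s,\Lambda_s,J_s$ be the localizations at $\{1,s,s^2,\dots\}$. Assume that $P_s$ is free of rank $2n$ and, as a quadratic module over $(R_s,\Lambda_s)$, isometric to $\mathbb H(R_s^{n})$; fix such an isometry and use it to identify $Q_s=P_s\perp\mathbb H(R_s)$ with $\mathbb H(R_s^{n+1})$, where $Q=P\perp\mathbb H(R)$. Let $\sigma(X)\in GQ(Q[X],\Lambda[X],J[X])$ with $\sigma(0)=\mathrm{Id}$ be such that the localization $\sigma_s(X)$ lies in $EQ(2n+2,R_s[X],\Lambda_s[X],J_s[X])$. Then there is an $l>0$ such that for every $b\in s^l C_\Lambda$ (in particular for $b=s^l$) there is a $\widehat\sigma(X)\in ET(Q[X],\Lambda[X],J[X])$ with $\widehat\sigma(0)=\mathrm{Id}$ whose localization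 is $\widehat\sigma_s(X)=\sigma_s(bX)$. -/

import Mathlib

open Polynomial MulOpposite

noncomputable section

/-! ### Form rings -/

/-- `Λ` is a `lam`-form parameter on the ring with involution `R`. -/
structure IsFormParameter {R : Type*} [Ring R] [StarRing R] (lam : R) (Λ : AddSubgroup R) :
    Prop where
  min_le : ∀ a : R, a - lam * star a ∈ Λ
  le_max : ∀ a ∈ Λ, a = -(lam * star a)
  conj_mem : ∀ x : R, ∀ a ∈ Λ, star x * a * x ∈ Λ

/-- The subring of those central elements `c` of `R` which are fixed by the involution and satisfy
`c Λ ⊆ Λ`. Its elements are the ones at which the form ring `(R, Λ)` can be localized, and the ones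
that may be substituted in the form `X ↦ c X` into `(R[X], Λ[X])`. -/
def formCenter {R : Type*} [Ring R] [StarRing R] (Λ : AddSubgroup R) : Subring R where
  carrier := {c | c ∈ Subring.center R ∧ star c = c ∧ ∀ a ∈ Λ, c * a ∈ Λ}
  mul_mem' := by
    rintro c d ⟨hc, hc', hc''⟩ ⟨hd, hd', hd''⟩
    refine ⟨mul_mem hc hd, ?_, fun a ha => ?_⟩
    · rw [star_mul, hc', hd']
      exact Subring.mem_center_iff.1 hc d
    · rw [mul_assoc]
      exact hc'' _ (hd'' _ ha)
  one_mem' := ⟨one_mem _, star_one _, fun a ha => by simpa using ha⟩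
  add_mem' := by
    rintro c d ⟨hc, hc', hc''⟩ ⟨hd, hd', hd''⟩
    refine ⟨add_mem hc hd, by rw [star_add, hc', hd'], fun a ha => ?_⟩
    rw [add_mul]
    exact add_mem (hc'' _ ha) (hd'' _ ha)
  zero_mem' := ⟨zero_mem _, star_zero _, fun a _ => by simp⟩
  neg_mem' := by
    rintro c ⟨hc, hc', hc''⟩
    refine ⟨neg_mem hc, by rw [star_neg, hc'], fun a ha => ?_⟩
    rw [neg_mul]
    exact neg_mem (hc'' _ ha)

/-! ### Polynomials over a ring with involution -/

/-- The involution of `R[X]` which extends the one of `R` and fixes `X`. -/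
def polyStar {R : Type*} [Ring R] [StarRing R] (p : R[X]) : R[X] :=
  p.sum fun i a => monomial i (star a)

theorem coeff_polyStar {R : Type*} [Ring R] [StarRing R] (p : R[X]) (n : ℕ) :
    (polyStar p).coeff n = star (p.coeff n) := by
  unfold polyStar Polynomial.sum
  rw [finsetSum_coeff]
  simp only [coeff_monomial]
  rw [Finset.sum_ite_eq' p.support n fun i => star (p.coeff i)]
  split_ifs with h
  · rfl
  · rw [notMem_support_iff.1 h, star_zero]

instance polyStarRing {R : Type*} [Ring R] [StarRing R] : StarRing R[X] where
  star := polyStar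
  star_involutive p := by
    ext n
    simp [coeff_polyStar]
  star_mul p q := by
    ext n
    change (polyStar (p * q)).coeff n = (polyStar q * polyStar p).coeff n
    rw [coeff_polyStar, coeff_mul, coeff_mul, star_sum,
      ← Finset.Nat.sum_antidiagonal_swap]
    refine Finset.sum_congr rfl fun x _ => ?_
    simp [coeff_polyStar]
  star_add p q := by
    ext n
    change (polyStar (p + q)).coeff n = (polyStar p + polyStar q).coeff n
    simp [coeff_polyStar]

/-- `S[X]`: the polynomials all of whose coefficients lie in `S`. -/
def polySubgroup {R : Type*} [Ring R] (S : AddSubgroup R) : AddSubgroup R[X] where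
  carrier := {p | ∀ n, p.coeff n ∈ S}
  add_mem' hp hq n := by
    rw [coeff_add]
    exact add_mem (hp n) (hq n)
  zero_mem' n := by
    rw [coeff_zero]
    exact zero_mem _
  neg_mem' hp n := by
    rw [coeff_neg]
    exact neg_mem (hp n)

/-! ### The polynomial module `P[X]` of a right module `P`

Right `R`-modules are modules over `Rᵐᵒᵖ`; the product `p a` is `op a • p`. -/

/-- The underlying additive group of `P[X]`; the finitely supported function `x` stands for the
polynomial `∑ x i X ^ i`. -/
def PolyMod (P : Type*) [AddCommGroup P] : Type _ := ℕ →₀ P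

namespace PolyMod

instance {P : Type*} [AddCommGroup P] : AddCommGroup (PolyMod P) :=
  inferInstanceAs (AddCommGroup (ℕ →₀ P))

/-- The monomial `p X ^ i`, additive in `p`. -/
def single {P : Type*} [AddCommGroup P] (i : ℕ) : P →+ PolyMod P := Finsupp.singleAddHom i

/-- The coefficient of `X ^ i`. -/
def coeff {P : Type*} [AddCommGroup P] (x : PolyMod P) (i : ℕ) : P := (show ℕ →₀ P from x) i

/-- The additive map which takes `p X ^ i` to `g i p`. -/
def lift {P M : Type*} [AddCommGroup P] [AddCommMonoid M] (g : ℕ → P →+ M) : PolyMod P →+ M :=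
  Finsupp.liftAddHom g

theorem lift_single {P M : Type*} [AddCommGroup P] [AddCommMonoid M] (g : ℕ → P →+ M)
    (i : ℕ) (p : P) : lift g (single i p) = g i p :=
  Finsupp.liftAddHom_apply_single g i p

theorem hom_ext {P M : Type*} [AddCommGroup P] [AddCommMonoid M] {g g' : PolyMod P →+ M}
    (h : ∀ i p, g (single i p) = g' (single i p)) : g = g' :=
  Finsupp.addHom_ext h

/-- Right multiplication by the polynomial `∑ a j X ^ j`; it takes `p X ^ i` to
`∑ (p a j) X ^ (i + j)`. -/
def mulRight {R P : Type*} [Ring R] [AddCommGroup P] [Module Rᵐᵒᵖ P] (g : R[X]) :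
    PolyMod P →+ PolyMod P :=
  lift fun i => ∑ j ∈ g.support,
    (single (i + j)).comp (DistribSMul.toAddMonoidHom P (op (g.coeff j)))

theorem mulRight_single {R P : Type*} [Ring R] [AddCommGroup P] [Module Rᵐᵒᵖ P] (g : R[X])
    (i : ℕ) (p : P) :
    mulRight g (single i p) = g.sum fun j a => single (i + j) (op a • p) := by
  rw [mulRight, lift_single, AddMonoidHom.finsetSum_apply]
  rfl

theorem mulRight_monomial_single {R P : Type*} [Ring R] [AddCommGroup P] [Module Rᵐᵒᵖ P]
    (i j : ℕ) (a : R) (p : P) :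
    mulRight (monomial j a) (single i p) = single (i + j) (op a • p) := by
  rw [mulRight_single, sum_monomial_index]
  simp

theorem mulRight_add {R P : Type*} [Ring R] [AddCommGroup P] [Module Rᵐᵒᵖ P] (g g' : R[X]) :
    (mulRight (g + g') : PolyMod P →+ PolyMod P) = mulRight g + mulRight g' := by
  refine hom_ext fun i p => ?_
  rw [AddMonoidHom.add_apply, mulRight_single, mulRight_single, mulRight_single]
  exact sum_add_index g g' _ (fun j => by simp) fun j a b => by rw [op_add, add_smul, map_add]

theorem mulRight_mul {R P : Type*} [Ring R] [AddCommGroup P] [Module Rᵐᵒᵖ P] (g g' : R[X]) :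
    (mulRight (g * g') : PolyMod P →+ PolyMod P) = (mulRight g').comp (mulRight g) := by
  induction g using Polynomial.induction_on' with
  | add g₁ g₂ h₁ h₂ =>
    rw [add_mul, mulRight_add, h₁, h₂, mulRight_add, AddMonoidHom.comp_add]
  | monomial j a =>
    induction g' using Polynomial.induction_on' with
    | add g₁ g₂ h₁ h₂ =>
      rw [mul_add, mulRight_add, h₁, h₂, mulRight_add, AddMonoidHom.add_comp]
    | monomial k b =>
      refine hom_ext fun i p => ?_
      rw [monomial_mul_monomial, AddMonoidHom.comp_apply, mulRight_monomial_single,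
        mulRight_monomial_single, mulRight_monomial_single, op_mul, mul_smul, add_assoc]

/-- The right `R[X]`-module `P[X]`. -/
instance {R P : Type*} [Ring R] [AddCommGroup P] [Module Rᵐᵒᵖ P] :
    Module R[X]ᵐᵒᵖ (PolyMod P) where
  smul g x := mulRight (unop g) x
  one_smul x := by
    change mulRight (1 : R[X]) x = x
    have h : (mulRight (1 : R[X]) : PolyMod P →+ PolyMod P) = AddMonoidHom.id _ := by
      refine hom_ext fun i p => ?_
      rw [← monomial_zero_one, mulRight_monomial_single]
      simp
    rw [h, AddMonoidHom.id_apply]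
  mul_smul g g' x := by
    change mulRight (unop g' * unop g) x = mulRight (unop g) (mulRight (unop g') x)
    rw [mulRight_mul, AddMonoidHom.comp_apply]
  smul_zero g := map_zero (mulRight (unop g))
  smul_add g x y := map_add (mulRight (unop g)) x y
  add_smul g g' x := by
    change mulRight (unop g + unop g') x = mulRight (unop g) x + mulRight (unop g') x
    rw [mulRight_add, AddMonoidHom.add_apply]
  zero_smul x := by
    change mulRight (0 : R[X]) x = 0
    have h : (mulRight (0 : R[X]) : PolyMod P →+ PolyMod P) = 0 := by
      refine hom_ext fun i p => ?_
      rw [mulRight_single, sum_zero_index, AddMonoidHom.zero_apply]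
    rw [h, AddMonoidHom.zero_apply]

theorem smul_single {R P : Type*} [Ring R] [AddCommGroup P] [Module Rᵐᵒᵖ P]
    (i j : ℕ) (a : R) (p : P) :
    op (monomial j a) • single i p = single (i + j) (op a • p) :=
  mulRight_monomial_single i j a p

/-- The additive map `P[X] → P'[X]` which applies `g` to all coefficients. -/
def map {P P' : Type*} [AddCommGroup P] [AddCommGroup P'] (g : P →+ P') :
    PolyMod P →+ PolyMod P' :=
  lift fun i => (single i).comp g

/-- The polynomial in `R[X]` with coefficients `g (x i)`. -/
def toPoly {R P : Type*} [Ring R] [AddCommGroup P] (g : P →+ R) : PolyMod P →+ R[X] :=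
  lift fun i => (monomial i : R →ₗ[R] R[X]).toAddMonoidHom.comp g

/-- The substitution `X ↦ b X`, i.e. `∑ p i X ^ i ↦ ∑ (p i b ^ i) X ^ i`. -/
def subst {R P : Type*} [Ring R] [AddCommGroup P] [Module Rᵐᵒᵖ P] (b : R) :
    PolyMod P →+ PolyMod P :=
  lift fun i => (single i).comp (DistribSMul.toAddMonoidHom P (op (b ^ i)))

end PolyMod

/-! ### Quadratic modules

A quadratic module over the form ring `(R, Λ)` is a right `R`-module `P` with a sesquilinear
form `f`, which gives the `lam`-Hermitian form `herm lam f` and the quadratic form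
`p ↦ f p p + Λ`. -/

/-- Sesquilinear forms on a right `R`-module: `f (p a) (q b) = star a * f p q * b`. -/
structure SesquilinearForm (R P : Type*) [Ring R] [StarRing R] [AddCommGroup P] [Module Rᵐᵒᵖ P]
    where
  /-- The underlying function. -/
  toFun : P → P → R
  add_left : ∀ p p' q, toFun (p + p') q = toFun p q + toFun p' q
  add_right : ∀ p q q', toFun p (q + q') = toFun p q + toFun p q'
  smul_smul : ∀ (p q : P) (a b : R), toFun (op a • p) (op b • q) = star a * toFun p q * b

namespace SesquilinearForm

/-- The form as a biadditive map. -/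
def toBihom {R P : Type*} [Ring R] [StarRing R] [AddCommGroup P] [Module Rᵐᵒᵖ P]
    (f : SesquilinearForm R P) : P →+ P →+ R :=
  AddMonoidHom.mk' (fun p => AddMonoidHom.mk' (f.toFun p) (f.add_right p)) fun p p' =>
    AddMonoidHom.ext fun q => f.add_left p p' q

/-- The associated Hermitian form `h p q = f p q + lam * star (f q p)`. -/
def herm {R P : Type*} [Ring R] [StarRing R] [AddCommGroup P] [Module Rᵐᵒᵖ P]
    (lam : R) (f : SesquilinearForm R P) (p q : P) : R :=
  f.toFun p q + lam * star (f.toFun q p)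

/-- The Hermitian form is non-singular: `p ↦ h p ·` is a bijection from `P` to its dual. -/
def NonSingular {R P : Type*} [Ring R] [StarRing R] [AddCommGroup P] [Module Rᵐᵒᵖ P]
    (lam : R) (f : SesquilinearForm R P) : Prop :=
  ∀ g : P →ₗ[Rᵐᵒᵖ] R, ∃! p : P, ∀ x : P, g x = herm lam f p x

/-- An isometry of quadratic modules: a linear bijection which preserves the Hermitian forms
and the quadratic forms with values in `R / Λ`. -/
def IsIsometry {R P P' : Type*} [Ring R] [StarRing R] [AddCommGroup P] [Module Rᵐᵒᵖ P]
    [AddCommGroup P'] [Module Rᵐᵒᵖ P'] (lam : R) (Λ : AddSubgroup R)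
    (f : SesquilinearForm R P) (f' : SesquilinearForm R P') (e : P ≃ₗ[Rᵐᵒᵖ] P') : Prop :=
  (∀ u v, herm lam f' (e u) (e v) = herm lam f u v) ∧
    ∀ u, f'.toFun (e u) (e u) - f.toFun u u ∈ Λ

/-- The quadratic module `P ⊥ ℍ(R)`; an element is a triple `(p, a, b)`, and the form of
`ℍ(R)` is `((a, b), (a', b')) ↦ star a * b'`. -/
def perpHyperbolic {R P : Type*} [Ring R] [StarRing R] [AddCommGroup P] [Module Rᵐᵒᵖ P]
    (f : SesquilinearForm R P) : SesquilinearForm R (P × R × R) where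
  toFun x y := f.toFun x.1 y.1 + star x.2.1 * y.2.2
  add_left p p' q := by
    simp only [Prod.fst_add, Prod.snd_add, f.add_left, star_add, add_mul]
    abel
  add_right p q q' := by
    simp only [Prod.fst_add, Prod.snd_add, f.add_right, mul_add]
    abel
  smul_smul p q a b := by
    simp only [Prod.smul_fst, Prod.smul_snd, f.smul_smul, op_smul_eq_mul, star_mul, mul_add,
      add_mul, mul_assoc]

/-- The standard hyperbolic module `ℍ(R ^ m)`, on column vectors of length `2 m`. The index `i`
is `Sum.inl i` and `ρ i` is `Sum.inr i`; the matrix of the Hermitian form is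
`(0, 1; lam, 0)`. -/
def hyperbolic (R : Type*) [Ring R] [StarRing R] (m : ℕ) :
    SesquilinearForm R (Fin m ⊕ Fin m → R) where
  toFun x y := ∑ i, star (x (Sum.inl i)) * y (Sum.inr i)
  add_left p p' q := by
    simp only [Pi.add_apply, star_add, add_mul, Finset.sum_add_distrib]
  add_right p q q' := by
    simp only [Pi.add_apply, mul_add, Finset.sum_add_distrib]
  smul_smul p q a b := by
    simp only [Pi.smul_apply, op_smul_eq_mul, star_mul, Finset.mul_sum, Finset.sum_mul, mul_assoc]

/-- The extension of `f` to `P[X]`, as a biadditive map: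
`(p X ^ i, q X ^ j) ↦ f p q X ^ (i + j)`. -/
def polyBihom {R P : Type*} [Ring R] [StarRing R] [AddCommGroup P] [Module Rᵐᵒᵖ P]
    (f : SesquilinearForm R P) : PolyMod P →+ PolyMod P →+ R[X] :=
  PolyMod.lift fun i => AddMonoidHom.flip <| PolyMod.lift fun j => AddMonoidHom.flip <|
    (AddMonoidHom.compHom (monomial (i + j) : R →ₗ[R] R[X]).toAddMonoidHom).comp f.toBihom

theorem polyBihom_single {R P : Type*} [Ring R] [StarRing R] [AddCommGroup P] [Module Rᵐᵒᵖ P]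
    (f : SesquilinearForm R P) (i j : ℕ) (p q : P) :
    f.polyBihom (PolyMod.single i p) (PolyMod.single j q) = monomial (i + j) (f.toFun p q) := by
  rw [polyBihom, PolyMod.lift_single, AddMonoidHom.flip_apply, PolyMod.lift_single]
  rfl

theorem star_monomial {R : Type*} [Ring R] [StarRing R] (i : ℕ) (a : R) :
    star (monomial i a) = monomial i (star a) := by
  change polyStar (monomial i a) = _
  rw [polyStar, sum_monomial_index]
  simp

/-- The quadratic module `P[X]` over `(R[X], Λ[X])`. -/
def poly {R P : Type*} [Ring R] [StarRing R] [AddCommGroup P] [Module Rᵐᵒᵖ P]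
    (f : SesquilinearForm R P) : SesquilinearForm R[X] (PolyMod P) where
  toFun x y := f.polyBihom x y
  add_left p p' q := by rw [map_add, AddMonoidHom.add_apply]
  add_right p q q' := by rw [map_add]
  smul_smul p q a b := by
    induction a using Polynomial.induction_on' with
    | add a₁ a₂ h₁ h₂ =>
      rw [op_add, add_smul, map_add, AddMonoidHom.add_apply, h₁, h₂, star_add, add_mul, add_mul]
    | monomial k a =>
      induction b using Polynomial.induction_on' with
      | add b₁ b₂ h₁ h₂ => rw [op_add, add_smul, map_add, h₁, h₂, mul_add]
      | monomial l b =>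
        have key : (f.polyBihom.comp (PolyMod.mulRight (monomial k a))).flip.comp
              (PolyMod.mulRight (monomial l b)) =
            ((AddMonoidHom.compHom ((AddMonoidHom.mulRight (monomial l b)).comp
              (AddMonoidHom.mulLeft (star (monomial k a))))).comp f.polyBihom).flip := by
          refine PolyMod.hom_ext fun j q => PolyMod.hom_ext fun i p => ?_
          simp only [AddMonoidHom.comp_apply, AddMonoidHom.flip_apply,
            AddMonoidHom.compHom_apply_apply, AddMonoidHom.coe_mulRight, AddMonoidHom.coe_mulLeft,
            PolyMod.mulRight_monomial_single, polyBihom_single, f.smul_smul, star_monomial,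
            monomial_mul_monomial]
          rw [show i + k + (j + l) = k + (i + j) + l by omega]
        exact DFunLike.congr_fun (DFunLike.congr_fun key q) p

end SesquilinearForm

/-! ### The groups `GQ` and `ET` -/

/-- The submodule `J M` of a right module `M`. -/
def idealSMul {R : Type*} [Ring R] (J : AddSubgroup R) (M : Type*) [AddCommGroup M]
    [Module Rᵐᵒᵖ M] : Submodule Rᵐᵒᵖ M :=
  Submodule.span Rᵐᵒᵖ {y | ∃ x : M, ∃ a ∈ J, y = op a • x}

/-- The relative general quadratic group `GQ(P, Λ, J)`: the isometries of `P` which are congruent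
to the identity modulo `J P`. -/
def GQ {R P : Type*} [Ring R] [StarRing R] [AddCommGroup P] [Module Rᵐᵒᵖ P] (lam : R)
    (Λ J : AddSubgroup R) (f : SesquilinearForm R P) : Set (P ≃ₗ[Rᵐᵒᵖ] P) :=
  {σ | f.IsIsometry lam Λ f σ ∧ ∀ x, σ x - x ∈ idealSMul J P}

/-- The transvection
`x ↦ x + u h(v, x) - v (star lam * h(u, x)) - u (star lam * a * h(u, x))`. -/
def transvection {R P : Type*} [Ring R] [StarRing R] [AddCommGroup P] [Module Rᵐᵒᵖ P] (lam : R)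
    (f : SesquilinearForm R P) (u v : P) (a : R) (x : P) : P :=
  x + op (f.herm lam v x) • u - op (star lam * f.herm lam u x) • v
    - op (star lam * a * f.herm lam u x) • u

/-- `τ` is the elementary transvection of `Q = P ⊥ ℍ(R)` with parameters `q ∈ P` and `a ∈ R`, where
`f q q = a` modulo `Λ`: a transvection along one of the two basis vectors `u` of `ℍ(R)`.
For `u = (0, 0, 1)` it is `(p, c, d) ↦ (p - q c, c, d + h(q, p) - a c)`, and
for `u = (0, 1, 0)` it is
`(p, c, d) ↦ (p - q (star lam * d), c + h(q, p) - star lam * a * d, d)`. -/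
def IsElementaryTransvection {R P : Type*} [Ring R] [StarRing R] [AddCommGroup P]
    [Module Rᵐᵒᵖ P] (lam : R) (Λ : AddSubgroup R) (f : SesquilinearForm R P) (q : P) (a : R)
    (τ : (P × R × R) ≃ₗ[Rᵐᵒᵖ] (P × R × R)) : Prop :=
  f.toFun q q - a ∈ Λ ∧
    ((∀ x, τ x = transvection lam f.perpHyperbolic (0, 0, 1) (q, 0, 0) a x) ∨
      ∀ x, τ x = transvection lam f.perpHyperbolic (0, 1, 0) (q, 0, 0) a x)

/-- The group `ET(Q, Λ)` generated by the elementary transvections of `Q = P ⊥ ℍ(R)`. -/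
def ET {R P : Type*} [Ring R] [StarRing R] [AddCommGroup P] [Module Rᵐᵒᵖ P] (lam : R)
    (Λ : AddSubgroup R) (f : SesquilinearForm R P) :
    Subgroup ((P × R × R) ≃ₗ[Rᵐᵒᵖ] (P × R × R)) :=
  Subgroup.closure {τ | ∃ q a, IsElementaryTransvection lam Λ f q a τ}

/-- The group `ET(JQ)` generated by the elementary transvections relative to `J`, i.e. those with
`q ∈ J P` and `a ∈ J`. -/
def ETIdeal {R P : Type*} [Ring R] [StarRing R] [AddCommGroup P] [Module Rᵐᵒᵖ P] (lam : R)
    (Λ J : AddSubgroup R) (f : SesquilinearForm R P) :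
    Subgroup ((P × R × R) ≃ₗ[Rᵐᵒᵖ] (P × R × R)) :=
  Subgroup.closure {τ | ∃ q ∈ idealSMul J P, ∃ a ∈ J, IsElementaryTransvection lam Λ f q a τ}

/-- The relative group `ET(Q, Λ, J)`: the normal closure of `ET(JQ)` in `ET(Q, Λ)`. -/
def ETRel {R P : Type*} [Ring R] [StarRing R] [AddCommGroup P] [Module Rᵐᵒᵖ P] (lam : R)
    (Λ J : AddSubgroup R) (f : SesquilinearForm R P) :
    Subgroup ((P × R × R) ≃ₗ[Rᵐᵒᵖ] (P × R × R)) :=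
  Subgroup.closure {τ | ∃ g ∈ ET lam Λ f, ∃ t ∈ ETIdeal lam Λ J f, τ = g * t * g⁻¹}

/-! ### The elementary quadratic group -/

/-- The types of elementary generators `qε i j`, `qr i j`, `ql i j`. -/
inductive EQRoot (m : ℕ)
  | eps (i j : Fin m)
  | r (i j : Fin m)
  | l (i j : Fin m)

namespace EQRoot

/-- The opposite type: the two positions in the matrix are interchanged. -/
def opp {m : ℕ} : EQRoot m → EQRoot m
  | eps i j => eps j i
  | r i j => l j i
  | l i j => r j i

/-- The elementary matrices of size `2 m`; they preserve the standard hyperbolic form. -/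
def mat {R : Type*} [Ring R] [StarRing R] (lam : R) {m : ℕ} :
    EQRoot m → R → Matrix (Fin m ⊕ Fin m) (Fin m ⊕ Fin m) R
  | eps i j, a =>
      1 + Matrix.single (Sum.inl i) (Sum.inl j) a - Matrix.single (Sum.inr j) (Sum.inr i) (star a)
  | r i j, a =>
      if i = j then 1 + Matrix.single (Sum.inl i) (Sum.inr i) a
      else 1 + Matrix.single (Sum.inl i) (Sum.inr j) a
        - Matrix.single (Sum.inl j) (Sum.inr i) (star lam * star a)
  | l i j, a =>
      if i = j then 1 + Matrix.single (Sum.inr i) (Sum.inl i) a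
      else 1 + Matrix.single (Sum.inr i) (Sum.inl j) a
        - Matrix.single (Sum.inr j) (Sum.inl i) (lam * star a)

/-- The parameters which are allowed for each type. -/
def Allowed {R : Type*} [Ring R] [StarRing R] (Λ : AddSubgroup R) {m : ℕ} : EQRoot m → R → Prop
  | eps i j, _ => i ≠ j
  | r i j, a => i = j → star a ∈ Λ
  | l i j, a => i = j → a ∈ Λ

end EQRoot

/-- The relative elementary quadratic group `EQ(2 m, R, Λ, J)`, generated by the matrices
`η x * η' a * (η x)⁻¹` with `η`, `η'` of opposite types, `x ∈ R` and `a ∈ J`. -/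
def EQRel {R : Type*} [Ring R] [StarRing R] (lam : R) (Λ J : AddSubgroup R) (m : ℕ) :
    Subgroup (Matrix (Fin m ⊕ Fin m) (Fin m ⊕ Fin m) R)ˣ :=
  Subgroup.closure {g | ∃ (η : EQRoot m) (x a : R)
    (u v : (Matrix (Fin m ⊕ Fin m) (Fin m ⊕ Fin m) R)ˣ),
    η.Allowed Λ x ∧ η.opp.Allowed Λ a ∧ a ∈ J ∧
      (u : Matrix (Fin m ⊕ Fin m) (Fin m ⊕ Fin m) R) = η.mat lam x ∧
      (v : Matrix (Fin m ⊕ Fin m) (Fin m ⊕ Fin m) R) = η.opp.mat lam a ∧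
      g = u * v * u⁻¹}

/-! ### Localization at the powers of a central element -/

/-- `φ : R → R_s` is the localization of the ring with involution `R` at the powers of the central
element `s`. -/
structure IsRingLocalization {R Rs : Type*} [Ring R] [StarRing R] [Ring Rs] [StarRing Rs] (s : R)
    (φ : R →+* Rs) : Prop where
  map_star : ∀ r, φ (star r) = star (φ r)
  isUnit : IsUnit (φ s)
  surj : ∀ y, ∃ (r : R) (k : ℕ), y * φ s ^ k = φ r
  exists_of_eq_zero : ∀ r, φ r = 0 → ∃ k : ℕ, r * s ^ k = 0

/-- `ι : P → P_s` is the localization of the right `R`-module `P` at the powers of `s`. -/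
structure IsModuleLocalization {R Rs P Ps : Type*} [Ring R] [Ring Rs] (s : R) (φ : R →+* Rs)
    [AddCommGroup P] [Module Rᵐᵒᵖ P] [AddCommGroup Ps] [Module Rsᵐᵒᵖ Ps] (ι : P →+ Ps) :
    Prop where
  map_smul : ∀ (a : R) (p : P), ι (op a • p) = op (φ a) • ι p
  surj : ∀ y, ∃ (p : P) (k : ℕ), op (φ s ^ k) • y = ι p
  exists_of_eq_zero : ∀ p, ι p = 0 → ∃ k : ℕ, op (s ^ k) • p = 0

/-- `S_s`: the additive subgroup of `R_s` of the fractions `a / s ^ k` with `a ∈ S`. -/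
def locSubgroup {R Rs : Type*} [Ring R] [Ring Rs] (s : R) (φ : R →+* Rs) (S : AddSubgroup R) :
    AddSubgroup Rs :=
  AddSubgroup.closure {y | ∃ a ∈ S, ∃ k : ℕ, y * φ s ^ k = φ a}

/-! ### Maps on `Q[X] = P[X] ⊥ ℍ(R[X])` -/

/-- The inclusion of `Q` into `Q[X]` as constant polynomials. -/
def constQ {R P : Type*} [Ring R] [AddCommGroup P] (x : P × R × R) : PolyMod P × R[X] × R[X] :=
  (PolyMod.single 0 x.1, C x.2.1, C x.2.2)

/-- The evaluation `Q[X] → Q` at `X = 0`. -/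
def evalZeroQ {R P : Type*} [Ring R] [AddCommGroup P] (x : PolyMod P × R[X] × R[X]) : P × R × R :=
  (x.1.coeff 0, x.2.1.coeff 0, x.2.2.coeff 0)

/-- The substitution `X ↦ b X` on `Q[X]`, for a central element `b`. -/
def substQ {R P : Type*} [Ring R] [AddCommGroup P] [Module Rᵐᵒᵖ P] (b : R)
    (x : PolyMod P × R[X] × R[X]) : PolyMod P × R[X] × R[X] :=
  (PolyMod.subst b x.1, x.2.1.comp (C b * X), x.2.2.comp (C b * X))

/-- The localization map `Q[X] → Q_s[X]`. -/
def locQ {R Rs P Ps : Type*} [Ring R] [Ring Rs] [AddCommGroup P] [AddCommGroup Ps] (φ : R →+* Rs)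
    (ι : P →+ Ps) (x : PolyMod P × R[X] × R[X]) : PolyMod Ps × Rs[X] × Rs[X] :=
  (PolyMod.map ι x.1, x.2.1.map φ, x.2.2.map φ)

/-- An isomorphism `θ : P ≃ R ^ (2 n)` extends to coordinates `Q[X] ≃ R[X] ^ (2 n + 2)`; the
coordinates with index `0` and `ρ 0` are those of `ℍ(R[X])`. -/
def coordQ {R P : Type*} [Ring R] [AddCommGroup P] [Module Rᵐᵒᵖ P] {n : ℕ}
    (θ : P ≃ₗ[Rᵐᵒᵖ] (Fin n ⊕ Fin n → R)) (x : PolyMod P × R[X] × R[X]) :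
    Fin (n + 1) ⊕ Fin (n + 1) → R[X] :=
  Sum.elim
    (Fin.cons x.2.1 fun i =>
      PolyMod.toPoly ((Pi.evalAddMonoidHom _ (Sum.inl i)).comp θ.toAddEquiv.toAddMonoidHom) x.1)
    (Fin.cons x.2.2 fun i =>
      PolyMod.toPoly ((Pi.evalAddMonoidHom _ (Sum.inr i)).comp θ.toAddEquiv.toAddMonoidHom) x.1)

end

/-! Write `M(X)` for the matrix of the localized automorphism. The proof is a continuity argument in
an `s`-adic topology. Filter the localized ring by levels `p : ℤ`, where level `p` consists of the
fractions `φ r * s ^ p`, and let `rootGroup` at level `p` be generated by the elementary matrices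
with parameters of that level. Three facts are needed.

Conjugation is continuous. For a fixed elementary `g` and every target level `r` there is a level
`q` with `g * rootGroup q * g⁻¹ ⊆ rootGroup r` (`exists_conj_mem`). For a generator conjugated by a
root matrix, Chevalley's commutator formulas suffice unless the two roots are opposite. In that case
a third hyperbolic index, available once the size is at least three hyperbolic planes, writes the
generator in terms of root matrices at non-opposite roots, at the cost of tripling the level.

Substitution is close to evaluation. For `b = s ^ l * c` the difference `p(bX) - p(0)` is `s ^ l`
times a polynomial of the same kind, so `X ↦ bX` tends to `X ↦ 0` uniformly on each level. By
continuity of conjugation, `g(bX) * g(0)⁻¹` is as deep as desired once `l` is large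
(`exists_dilation`).

Deep matrices lift. Some `s ^ N` times each hyperbolic basis vector of `P_s` comes from a `p` in `P`
with `f p p ∈ Λ` (`exists_basis_lift`). Hence root matrices of level `N` in a row of the extra plane
`ℍ(R)` are localizations of elementary transvections. Commutators then give all root matrices of
level `3 N` (`rootGroup_le_of_plane`, `exists_rootGroup_le_liftPairs`).

The ideal `J` is handled by doubling the ring. Everything is done over `Rs[X] × Rs[X]`, with levels
made of pairs whose numerators are congruent modulo `J`. An element `M` of the relative group
becomes the element `(1, M)` of the absolute elementary group of the double, since `η(x) η'(a)
η(x)⁻¹` is the second component of `(η(x), η(x)) (1, η'(a)) (η(x), η(x))⁻¹`. A deep pair lifts to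
`(τ, τ')` with `τ⁻¹ * τ'` in the relative transvection group, and for `(1, M(bX))` the element `τ⁻¹
* τ'` has matrix `M(bX)`.

Since `M(0) = 1`, this gives a relative lift `ρ` of `M(bX)`. As `s` may be a zero divisor, `ρ(0)`
need not be the identity, although it localizes to it on constants. The answer is `ρ * ρ(0)⁻¹`. -/

open scoped commutatorElement

noncomputable section

/-! ### Root matrices of the hyperbolic unitary group -/

/-- The factor of the Hermitian form at the index `i`: `h(e i, e (i.swap)) = idxSign lam i`. -/
def idxSign {B : Type*} [Ring B] (lam : B) {m : ℕ} : Fin m ⊕ Fin m → B :=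
  Sum.elim (fun _ => 1) fun _ => lam

/-- The central factor `c i j` occurring in the root matrix at `(i, j)`. -/
def idxCoeff {B : Type*} [Ring B] [StarRing B] (lam : B) {m : ℕ} (i j : Fin m ⊕ Fin m) : B :=
  idxSign lam i * star (idxSign lam j)

/-- A central element of norm one. -/
structure IsCentralUnitary {B : Type*} [Ring B] [StarRing B] (lam : B) : Prop where
  comm : ∀ x, lam * x = x * lam
  mul_star : lam * star lam = 1

namespace IsCentralUnitary

variable {B : Type*} [Ring B] [StarRing B] {lam : B} (H : IsCentralUnitary lam) {m : ℕ}
  (i j k : Fin m ⊕ Fin m)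

include H

theorem star_mul : star lam * lam = 1 := by rw [← H.comm, H.mul_star]

theorem star_comm (x : B) : star lam * x = x * star lam := by
  have := congrArg star (H.comm (star x))
  simpa using this.symm

theorem sign_comm (x : B) : idxSign lam i * x = x * idxSign lam i := by
  cases i <;> simp [idxSign, H.comm]

theorem sign_star_comm (x : B) : star (idxSign lam i) * x = x * star (idxSign lam i) := by
  cases i <;> simp [idxSign, H.star_comm]

theorem sign_mul_star : idxSign lam i * star (idxSign lam i) = 1 := by
  cases i <;> simp [idxSign, H.mul_star]

theorem star_mul_sign : star (idxSign lam i) * idxSign lam i = 1 := by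
  rw [← H.sign_comm, H.sign_mul_star]

theorem lam_mul_star_sign : lam * star (idxSign lam i) = idxSign lam i.swap := by
  cases i <;> simp [idxSign, H.mul_star]

theorem star_lam_mul_sign : star lam * idxSign lam i = star (idxSign lam i.swap) := by
  cases i <;> simp [idxSign, H.star_mul]

theorem coeff_comm (x : B) : idxCoeff lam i j * x = x * idxCoeff lam i j := by
  rw [idxCoeff, mul_assoc, H.sign_star_comm, ← mul_assoc, H.sign_comm, mul_assoc]

omit H in
theorem star_coeff : star (idxCoeff lam i j) = idxCoeff lam j i := by
  simp [idxCoeff]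

theorem coeff_self : idxCoeff lam i i = 1 := H.sign_mul_star i

theorem coeff_mul_coeff : idxCoeff lam i j * idxCoeff lam j k = idxCoeff lam i k := by
  simp only [idxCoeff]
  rw [mul_assoc, ← mul_assoc (star _), H.star_mul_sign, one_mul]

theorem coeff_swap : idxCoeff lam j.swap i.swap = idxCoeff lam i j := by
  simp only [idxCoeff]
  rw [← H.lam_mul_star_sign j, ← H.star_lam_mul_sign i, mul_assoc, H.sign_star_comm,
    mul_assoc (star lam), ← mul_assoc lam, H.mul_star, one_mul]

end IsCentralUnitary

/-- The nilpotent part of a root matrix. -/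
def rootNil {B : Type*} [Ring B] [StarRing B] (lam : B) {m : ℕ} (i j : Fin m ⊕ Fin m) (a : B) :
    Matrix (Fin m ⊕ Fin m) (Fin m ⊕ Fin m) B :=
  Matrix.single i j a -
    if j = i.swap then 0 else Matrix.single j.swap i.swap (idxCoeff lam i j * star a)

theorem swap_ne_self {m : ℕ} (i : Fin m ⊕ Fin m) : i.swap ≠ i := by cases i <;> simp

theorem eq_swap_comm {m : ℕ} {i j : Fin m ⊕ Fin m} : i = j.swap ↔ j = i.swap :=
  ⟨fun h => by rw [h, Sum.swap_swap], fun h => by rw [h, Sum.swap_swap]⟩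

theorem swap_inj {m : ℕ} {i j : Fin m ⊕ Fin m} : i.swap = j.swap ↔ i = j :=
  ⟨fun h => by rw [← Sum.swap_swap i, h, Sum.swap_swap], fun h => by rw [h]⟩

/-! ### Products and Chevalley commutator formulas for root matrices -/

section
variable {B : Type*} [Ring B] [StarRing B] (lam : B) {m : ℕ} {i j h k : Fin m ⊕ Fin m}

/-- The first factor has entries only in the columns `j` and `i.swap`, the second only in the rows
`h` and `k.swap`. The four hypotheses say that no column meets a row. -/
theorem rootNil_mul_eq_zero (h₁ : j ≠ h) (h₂ : k ≠ i) (h₃ : h ≠ i.swap) (h₄ : k ≠ j.swap)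
    (a b : B) : rootNil lam i j a * rootNil lam h k b = 0 := by
  have h₅ : j ≠ k.swap := fun e => h₄ (eq_swap_comm.1 e)
  have h₆ : i.swap ≠ h := fun e => h₃ e.symm
  have h₇ : i.swap ≠ k.swap := fun e => h₂ (swap_inj.1 e).symm
  unfold rootNil
  split_ifs <;> simp [mul_sub, sub_mul, h₁, h₅, h₆, h₇]

theorem rootNil_mul_self (hij : i ≠ j) (a b : B) : rootNil lam i j a * rootNil lam i j b = 0 := by
  by_cases hl : j = i.swap
  · subst hl
    simp [rootNil, swap_ne_self]
  · have h₁ : j ≠ j.swap := fun e => swap_ne_self j e.symm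
    simp [rootNil, hl, mul_sub, sub_mul, hij.symm, swap_ne_self, h₁,
      swap_inj, hij]

theorem rootNil_add (a b : B) :
    rootNil lam i j (a + b) = rootNil lam i j a + rootNil lam i j b := by
  unfold rootNil
  split_ifs
  · simp [Matrix.single_add]
  · simp only [Matrix.single_add, star_add, mul_add]
    abel

theorem rootNil_zero : rootNil lam i j (0 : B) = 0 := by
  unfold rootNil
  split_ifs <;> simp

/-- The root matrix `1 + a e_{ij} - c_{ij} a* e_{-j,-i}` (and `1 + a e_{i,-i}` for `j = -i`) as a
unit. -/
def rootUnit (i j : Fin m ⊕ Fin m) (hij : i ≠ j) (a : B) :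
    (Matrix (Fin m ⊕ Fin m) (Fin m ⊕ Fin m) B)ˣ where
  val := 1 + rootNil lam i j a
  inv := 1 + rootNil lam i j (-a)
  val_inv := by
    rw [mul_add, add_mul, add_mul, rootNil_mul_self lam hij, one_mul, mul_one, one_mul, add_zero,
      add_assoc, ← rootNil_add, add_neg_cancel, rootNil_zero, add_zero]
  inv_val := by
    rw [mul_add, add_mul, add_mul, rootNil_mul_self lam hij, one_mul, mul_one, one_mul, add_zero,
      add_assoc, ← rootNil_add, neg_add_cancel, rootNil_zero, add_zero]

theorem rootUnit_add (hij : i ≠ j) (a b : B) :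
    rootUnit lam i j hij (a + b) = rootUnit lam i j hij a * rootUnit lam i j hij b := by
  ext1
  simp only [rootUnit, Units.val_mul]
  rw [mul_add, add_mul, add_mul, rootNil_mul_self lam hij, rootNil_add]
  simp [add_assoc]

theorem rootUnit_zero (hij : i ≠ j) : rootUnit lam i j hij (0 : B) = 1 := by
  ext1
  simp [rootUnit, rootNil_zero]

theorem rootUnit_neg (hij : i ≠ j) (a : B) :
    rootUnit lam i j hij (-a) = (rootUnit lam i j hij a)⁻¹ :=
  eq_inv_of_mul_eq_one_left (by rw [← rootUnit_add, neg_add_cancel, rootUnit_zero])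

theorem rootUnit_commutator_eq_one (hij : i ≠ j) (hhk : h ≠ k) (h₁ : h ≠ j) (h₂ : k ≠ i)
    (h₃ : h ≠ i.swap) (h₄ : k ≠ j.swap) (a b : B) :
    ⁅rootUnit lam i j hij a, rootUnit lam h k hhk b⁆ = 1 := by
  rw [commutatorElement_eq_one_iff_mul_comm]
  ext1
  simp only [rootUnit, Units.val_mul]
  simp only [mul_add, add_mul]
  rw [rootNil_mul_eq_zero lam h₁.symm h₂ h₃ h₄,
    rootNil_mul_eq_zero lam h₂ h₁.symm (fun e => h₃ (eq_swap_comm.1 e))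
      (fun e => h₄ (eq_swap_comm.1 e))]
  simp only [mul_one, one_mul, add_zero]
  abel

variable {lam} (H : IsCentralUnitary lam)
include H

/-- The two entries of a short root matrix exchange roles, so `(i, j)` and `(j.swap, i.swap)` name
the same root. This is what allows case distinctions to be made up to this symmetry. It works
because the factor `idxCoeff` is invariant under the exchange and inverts to its own adjoint. -/
theorem rootUnit_swap (hij : i ≠ j) (hs : j ≠ i.swap) (a : B) :
    rootUnit lam i j hij a = rootUnit lam j.swap i.swap (fun e => hij (swap_inj.1 e).symm)
      (-(idxCoeff lam i j * star a)) := by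
  ext1
  simp only [rootUnit, rootNil, hs, if_false, Sum.swap_swap]
  rw [if_neg (fun e => hs e.symm), H.coeff_swap, star_neg,
    StarMul.star_mul, star_star, IsCentralUnitary.star_coeff, mul_neg, H.coeff_comm i j (a * _),
    mul_assoc a,
    H.coeff_mul_coeff, H.coeff_self, mul_one, ← Matrix.single_neg, ← Matrix.single_neg]
  abel

/-- The Hermitian structure forces the second entry to be `a * b` transported by the involution; the
cocycle rule `coeff_mul_coeff` is exactly the compatibility required. -/
theorem rootUnit_commutator_short (hij : i ≠ j) (hjk : j ≠ k) (hs : j ≠ i.swap)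
    (hs' : k ≠ j.swap) (hik : i ≠ k) (hs'' : k ≠ i.swap) (a b : B) :
    ⁅rootUnit lam i j hij a, rootUnit lam j k hjk b⁆ = rootUnit lam i k hik (a * b) := by
  rw [commutatorElement_def, mul_inv_eq_iff_eq_mul, mul_inv_eq_iff_eq_mul]
  ext1
  have e₂ : i.swap ≠ j := fun e => hs e.symm
  have e₄ : j ≠ k.swap := fun e => hs' (eq_swap_comm.1 e)
  have e₆ : i ≠ j.swap := fun e => hs (eq_swap_comm.1 e)
  have e₈ : k ≠ k.swap := fun e => swap_ne_self k e.symm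
  have e₉ : i.swap ≠ i := swap_ne_self i
  have e₁₀ : j.swap ≠ i := fun e => e₆ e.symm
  have key : idxCoeff lam j k * star b * (idxCoeff lam i j * star a) =
      idxCoeff lam i k * star (a * b) := by
    rw [StarMul.star_mul, mul_assoc, ← mul_assoc (star b), ← H.coeff_comm, mul_assoc, ← mul_assoc,
      H.coeff_comm j k, H.coeff_mul_coeff]
  simp [rootUnit, rootNil, hs, hs', hs'', mul_add, add_mul, mul_sub, sub_mul, hij, hjk.symm, hik,
    hik.symm, swap_inj, e₂, e₄, e₈, e₉, e₁₀]
  rw [← mul_assoc] at key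
  simp only [← mul_assoc, StarMul.star_mul] at key ⊢
  rw [key]
  abel

/-- Here the two mirror entries of the commutator fall on the same position `(i, i.swap)` and add
up, which is why the parameter is a trace element `x - c * star x`. Such elements lie in every form
parameter. -/
theorem rootUnit_commutator_long (hij : i ≠ j) (hjk : j ≠ i.swap) (a b : B) :
    ⁅rootUnit lam i j hij a, rootUnit lam j i.swap hjk b⁆ =
      rootUnit lam i i.swap (swap_ne_self i).symm
        (a * b - idxCoeff lam i i.swap * star (a * b)) := by
  rw [commutatorElement_def, mul_inv_eq_iff_eq_mul, mul_inv_eq_iff_eq_mul]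
  ext1
  have e₂ : i.swap ≠ j := fun e => hjk e.symm
  have e₆ : i ≠ j.swap := fun e => hjk (eq_swap_comm.1 e)
  have e₉ : i.swap ≠ i := swap_ne_self i
  have e₁₀ : j.swap ≠ i := fun e => e₆ e.symm
  have key : idxCoeff lam j i.swap * star b * (idxCoeff lam i j * star a) =
      idxCoeff lam i i.swap * star (a * b) := by
    rw [StarMul.star_mul, mul_assoc, ← mul_assoc (star b), ← H.coeff_comm, mul_assoc, ← mul_assoc,
      H.coeff_comm j i.swap, H.coeff_mul_coeff]
  simp [rootUnit, rootNil, hjk, mul_add, add_mul, mul_sub, sub_mul, hij, hij.symm, swap_inj, e₂,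
    e₉, e₁₀]
  simp only [← mul_assoc, StarMul.star_mul] at key ⊢
  rw [key, sub_eq_add_neg (a * b), Matrix.single_add, Matrix.single_neg]
  abel

/-- Besides the bilinear term there is a quadratic term in `b` at the long root `(j.swap, j)`. The
hypothesis `ha` is the antisymmetry of form parameters; it makes the entry produced at
`(i.swap.swap, j)` match its mirror image, so that the bilinear term is itself a root matrix. -/
theorem rootUnit_commutator_long_short (hij : i.swap ≠ j) (hs : j ≠ i) (a b : B)
    (ha : star a = -(idxCoeff lam i.swap i * a)) :
    ⁅rootUnit lam i i.swap (swap_ne_self i).symm a, rootUnit lam i.swap j hij b⁆ =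
      rootUnit lam i j hs.symm (a * b) *
        rootUnit lam j.swap j (swap_ne_self j) (-(idxCoeff lam i.swap j * (star b * a * b))) := by
  rw [commutatorElement_def, mul_inv_eq_iff_eq_mul, mul_inv_eq_iff_eq_mul]
  ext1
  have e₂ : j.swap ≠ i := fun e => hij (by rw [← e, Sum.swap_swap])
  have e₃ : j ≠ j.swap := fun e => swap_ne_self j e.symm
  have key : idxCoeff lam i j * star (a * b) = -(idxCoeff lam i.swap j * star b * a) := by
    rw [StarMul.star_mul, ha, mul_neg, mul_neg, ← mul_assoc (star b), ← H.coeff_comm,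
      ← H.coeff_mul_coeff i.swap i j, H.coeff_comm i.swap i (idxCoeff lam i j)]
    simp only [mul_assoc]
  simp [rootUnit, rootNil, hij.symm, hs, hs.symm, mul_add, add_mul, mul_sub, sub_mul, swap_inj,
    swap_ne_self]
  rw [← StarMul.star_mul, key]
  simp [← Matrix.single_neg, mul_assoc, e₃]
  abel
end

/-! ### Elementary groups of a filtered form ring -/

/-- A descending filtration `K` of (a part of) a ring with involution, together with a filtration
`L` of a form parameter. -/
structure IsFormFiltration {B : Type*} [Ring B] [StarRing B] (lam : B) (K L : ℤ → AddSubgroup B) :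
    Prop where
  unitary : IsCentralUnitary lam
  antitone_ring : Antitone K
  antitone_form : Antitone L
  mul_mem_ring : ∀ {p q a b}, a ∈ K p → b ∈ K q → a * b ∈ K (p + q)
  star_mem : ∀ {p a}, a ∈ K p → star a ∈ K p
  one_mem_ring : 1 ∈ K 0
  lam_mem : lam ∈ K 0
  form_le : ∀ p, L p ≤ K p
  form_anti : ∀ {p a}, a ∈ L p → a = -(lam * star a)
  conj_mem : ∀ {p q x a}, x ∈ K p → a ∈ L q → star x * a * x ∈ L (2 * p + q)
  sub_mem : ∀ {p a}, a ∈ K p → a - lam * star a ∈ L p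
  exists_mul : ∀ {p q a}, a ∈ K (p + q) → ∃ b ∈ K p, ∃ c ∈ K q, a = b * c
  exists_conj : ∀ {p q a}, a ∈ L (2 * p + q) → ∃ b ∈ L q, ∃ x ∈ K p, a = star x * b * x

/-- The parameters of level `p` of the root `(i, j)`. -/
def rootParam {B : Type*} [Ring B] (lam : B) (K L : ℤ → AddSubgroup B) {m : ℕ}
    (i j : Fin m ⊕ Fin m) (p : ℤ) : Set B :=
  {a | if j = i.swap then idxSign lam j * a ∈ L p else a ∈ K p}

/-- The group generated by all root matrices with parameters of level `p`. -/
def rootGroup {B : Type*} [Ring B] [StarRing B] (lam : B) (K L : ℤ → AddSubgroup B) (m : ℕ)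
    (p : ℤ) : Subgroup (Matrix (Fin m ⊕ Fin m) (Fin m ⊕ Fin m) B)ˣ :=
  Subgroup.closure {g | ∃ i j, ∃ hij : i ≠ j, ∃ a ∈ rootParam lam K L i j p,
    g = rootUnit lam i j hij a}

/-- The group generated by all root matrices with parameters of some level. -/
def rootGroupTop {B : Type*} [Ring B] [StarRing B] (lam : B) (K L : ℤ → AddSubgroup B) (m : ℕ) :
    Subgroup (Matrix (Fin m ⊕ Fin m) (Fin m ⊕ Fin m) B)ˣ :=
  Subgroup.closure {g | ∃ i j, ∃ hij : i ≠ j, ∃ p, ∃ a ∈ rootParam lam K L i j p,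
    g = rootUnit lam i j hij a}

/-! ### Commutators and levels; continuity of conjugation -/

namespace IsFormFiltration

variable {B : Type*} [Ring B] [StarRing B] {lam : B} {K L : ℤ → AddSubgroup B}
  (F : IsFormFiltration lam K L) {m : ℕ} {i j h k : Fin m ⊕ Fin m} {p q r : ℤ} {a b : B}
include F

theorem sign_mem (i : Fin m ⊕ Fin m) : idxSign lam i ∈ K 0 := by
  cases i
  · exact F.one_mem_ring
  · exact F.lam_mem

theorem sign_mul_mem (i : Fin m ⊕ Fin m) (ha : a ∈ K p) : idxSign lam i * a ∈ K p := by
  simpa using F.mul_mem_ring (F.sign_mem i) ha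

theorem sign_star_mul_mem (i : Fin m ⊕ Fin m) (ha : a ∈ K p) :
    star (idxSign lam i) * a ∈ K p := by
  simpa using F.mul_mem_ring (F.star_mem (F.sign_mem i)) ha

theorem coeff_mul_mem (i j : Fin m ⊕ Fin m) (ha : a ∈ K p) : idxCoeff lam i j * a ∈ K p := by
  rw [idxCoeff, mul_assoc]
  exact F.sign_mul_mem i (F.sign_star_mul_mem j ha)

theorem param_mono (hpq : q ≤ p) (ha : a ∈ rootParam lam K L i j p) :
    a ∈ rootParam lam K L i j q := by
  unfold rootParam at ha ⊢
  split_ifs at ha ⊢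
  · exact F.antitone_form hpq ha
  · exact F.antitone_ring hpq ha

theorem param_mem_ring (ha : a ∈ rootParam lam K L i j p) : a ∈ K p := by
  unfold rootParam at ha
  split_ifs at ha
  · have := F.sign_star_mul_mem j (F.form_le p ha)
    rwa [← mul_assoc, F.unitary.star_mul_sign, one_mul] at this
  · exact ha

omit [StarRing B] F in
theorem param_short (hs : j ≠ i.swap) : a ∈ rootParam lam K L i j p ↔ a ∈ K p := by
  simp [rootParam, hs]

omit [StarRing B] F in
theorem param_long : a ∈ rootParam lam K L i i.swap p ↔ idxSign lam i.swap * a ∈ L p := by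
  simp [rootParam]

omit [StarRing B] F in
theorem param_neg (ha : a ∈ rootParam lam K L i j p) : -a ∈ rootParam lam K L i j p := by
  unfold rootParam at ha ⊢
  split_ifs at ha ⊢
  · simpa using ha
  · simpa using ha

omit F in
theorem rootUnit_mem (hij : i ≠ j) (ha : a ∈ rootParam lam K L i j p) :
    rootUnit lam i j hij a ∈ rootGroup lam K L m p :=
  Subgroup.subset_closure ⟨i, j, hij, a, ha, rfl⟩

theorem rootGroup_mono (hpq : q ≤ p) : rootGroup lam K L m p ≤ rootGroup lam K L m q := by
  refine Subgroup.closure_mono ?_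
  rintro g ⟨i, j, hij, a, ha, rfl⟩
  exact ⟨i, j, hij, a, F.param_mono hpq ha, rfl⟩

theorem param_swap (hs : j ≠ i.swap) (ha : a ∈ K p) :
    -(idxCoeff lam i j * star a) ∈ rootParam lam K L j.swap i.swap p := by
  rw [param_short (by rw [Sum.swap_swap]; exact fun e => hs e.symm)]
  exact neg_mem (F.coeff_mul_mem _ _ (F.star_mem ha))

/-- This translates the antisymmetry of `L` into the normalization of long root parameters, where
the factor `idxSign` has been moved to one side. It supplies the hypothesis of
`rootUnit_commutator_long_short`. -/
theorem param_long_star (ha : a ∈ rootParam lam K L i i.swap p) :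
    star a = -(idxCoeff lam i.swap i * a) := by
  rw [param_long] at ha
  have e := congrArg (star (idxSign lam i) * ·) (F.form_anti ha)
  simp only [star_mul, mul_neg] at e
  rw [← F.unitary.sign_star_comm i.swap, ← mul_assoc lam, F.unitary.lam_mul_star_sign,
    Sum.swap_swap, ← mul_assoc _ _ (star a), F.unitary.star_mul_sign, one_mul, ← mul_assoc,
    F.unitary.sign_star_comm] at e
  rw [idxCoeff, e, neg_neg]

theorem sub_param_long (ha : a ∈ K p) :
    a - idxCoeff lam i i.swap * star a ∈ rootParam lam K L i i.swap p := by
  rw [param_long]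
  have h := F.sub_mem (F.sign_mul_mem i.swap ha)
  convert h using 1
  rw [mul_sub, star_mul, ← F.unitary.sign_star_comm, ← mul_assoc lam, F.unitary.lam_mul_star_sign,
    Sum.swap_swap, F.unitary.sign_comm i.swap (idxCoeff _ _ _ * _), F.unitary.coeff_comm, mul_assoc,
    idxCoeff,
    mul_assoc (idxSign lam i), F.unitary.star_mul_sign, mul_one, F.unitary.sign_comm i (star a)]

theorem conj_param_long {x : B} (hx : x ∈ K p) (ha : a ∈ rootParam lam K L i i.swap q)
    (j : Fin m ⊕ Fin m) :
    -(idxCoeff lam i.swap j * (star x * a * x)) ∈ rootParam lam K L j.swap j (2 * p + q) := by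
  have e : j = j.swap.swap := (Sum.swap_swap j).symm
  rw [param_long] at ha
  rw [rootParam, Set.mem_ofPred_eq, if_pos e, mul_neg]
  refine neg_mem ?_
  have h := F.conj_mem hx ha
  convert h using 1
  rw [← mul_assoc, idxCoeff, F.unitary.sign_comm i.swap (star _), ← mul_assoc (idxSign lam j),
    F.unitary.sign_mul_star, one_mul]
  simp only [← mul_assoc]
  rw [F.unitary.sign_comm i.swap (star x)]

/-- Membership of a commutator of two root matrices for short roots `(i, j)`, `(j, k)`. -/
theorem commutator_mem_of_adjacent (hij : i ≠ j) (hjk : j ≠ k) (hs : j ≠ i.swap)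
    (hs' : k ≠ j.swap) (hki : k ≠ i) (ha : a ∈ K p) (hb : b ∈ K q) :
    ⁅rootUnit lam i j hij a, rootUnit lam j k hjk b⁆ ∈ rootGroup lam K L m (p + q) := by
  by_cases hl : k = i.swap
  · subst hl
    rw [rootUnit_commutator_long F.unitary]
    exact rootUnit_mem _ (F.sub_param_long (F.mul_mem_ring ha hb))
  · rw [rootUnit_commutator_short F.unitary hij hjk hs hs' hki.symm hl]
    exact rootUnit_mem _ ((param_short hl).2 (F.mul_mem_ring ha hb))

/-- The commutator formula for two short roots which are not opposite, i.e. not `(i, j)` and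
`(j, i)` up to the symmetry `(i, j) ↦ (j.swap, i.swap)`. -/
theorem commutator_mem_short (hij : i ≠ j) (hhk : h ≠ k) (hs : j ≠ i.swap) (hs' : k ≠ h.swap)
    (ho : ¬ (h = j ∧ k = i)) (ho' : ¬ (h = i.swap ∧ k = j.swap)) (ha : a ∈ K p) (hb : b ∈ K q) :
    ⁅rootUnit lam i j hij a, rootUnit lam h k hhk b⁆ ∈ rootGroup lam K L m (p + q) := by
  by_cases h₁ : h = j
  · subst h₁
    exact F.commutator_mem_of_adjacent hij hhk hs hs' (fun e => ho ⟨rfl, e⟩) ha hb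
  by_cases h₂ : k = i
  · subst h₂
    rw [← inv_mem_iff, commutatorElement_inv, add_comm]
    exact F.commutator_mem_of_adjacent hhk hij hs' hs (fun e => h₁ e.symm) hb ha
  -- The roots are not adjacent as written, so the second one is rewritten as `(k.swap, h.swap)`.
  -- Either it is adjacent to `(i, j)` in this form, or the two matrices commute.
  rw [rootUnit_swap F.unitary hhk hs' b]
  have hb' := F.coeff_mul_mem h k (F.star_mem hb)
  by_cases h₃ : h = i.swap
  · have h₄ : i = h.swap := eq_swap_comm.1 h₃
    subst h₄
    rw [← inv_mem_iff, commutatorElement_inv, add_comm]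
    refine F.commutator_mem_of_adjacent _ hij ?_ hs ?_ (neg_mem hb') ha
    · simpa using fun e => hs' e.symm
    · exact fun e => ho' ⟨(Sum.swap_swap h).symm, eq_swap_comm.1 e⟩
  by_cases h₄ : k = j.swap
  · have h₄ : j = k.swap := eq_swap_comm.1 h₄
    subst h₄
    refine F.commutator_mem_of_adjacent hij _ hs ?_ ?_ ha (neg_mem hb')
    · simpa using fun e => hs' e.symm
    · exact fun e => h₃ (eq_swap_comm.1 e.symm)
  rw [rootUnit_commutator_eq_one]
  · exact one_mem _
  · exact fun e => h₄ (eq_swap_comm.1 e.symm)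
  · exact fun e => h₃ (eq_swap_comm.1 e.symm)
  · exact fun e => h₂ (swap_inj.1 e)
  · exact fun e => h₁ (swap_inj.1 e)

/-- The commutator has a bilinear term of level `p + q` and a term quadratic in `b` of level `2 * q
+ p`, hence the two bounds on `r`. -/
theorem commutator_mem_long_short (hij : i ≠ i.swap) (hhk : h ≠ k) (hs' : k ≠ h.swap)
    (ha : a ∈ rootParam lam K L i i.swap p) (hb : b ∈ K q) (h₁ : r ≤ p + q)
    (h₂ : r ≤ 2 * q + p) :
    ⁅rootUnit lam i i.swap hij a, rootUnit lam h k hhk b⁆ ∈ rootGroup lam K L m r := by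
  have key : ∀ (k) (b) (hk : i.swap ≠ k), k ≠ i → b ∈ K q →
      ⁅rootUnit lam i i.swap hij a, rootUnit lam i.swap k hk b⁆ ∈ rootGroup lam K L m r := by
    intro k b hk hki hb
    rw [rootUnit_commutator_long_short F.unitary hk hki a b (F.param_long_star ha)]
    refine mul_mem (F.rootGroup_mono h₁ (rootUnit_mem _ ?_))
      (F.rootGroup_mono h₂ (rootUnit_mem _ (F.conj_param_long hb ha k)))
    exact (param_short hk.symm).2 (F.mul_mem_ring (F.param_mem_ring ha) hb)
  by_cases h₃ : h = i.swap
  · subst h₃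
    exact key k b hhk (by simpa using hs') hb
  by_cases h₄ : k = i
  · subst h₄
    rw [rootUnit_swap F.unitary hhk hs' b]
    exact key _ _ _ (fun e => hs' e.symm) (neg_mem (F.coeff_mul_mem h k (F.star_mem hb)))
  rw [rootUnit_commutator_eq_one lam hij hhk h₃ h₄ h₃ (by simpa using h₄)]
  exact one_mem _

/-- The commutator of root matrices at roots which are not opposite. -/
theorem commutator_mem (hij : i ≠ j) (hhk : h ≠ k) (ho : ¬ (h = j ∧ k = i))
    (ho' : ¬ (h = i.swap ∧ k = j.swap)) (ha : a ∈ rootParam lam K L i j p)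
    (hb : b ∈ rootParam lam K L h k q) (h₁ : r ≤ p + q) (h₂ : r ≤ 2 * p + q)
    (h₃ : r ≤ p + 2 * q) :
    ⁅rootUnit lam i j hij a, rootUnit lam h k hhk b⁆ ∈ rootGroup lam K L m r := by
  by_cases hs : j = i.swap
  · subst hs
    by_cases hs' : k = h.swap
    · subst hs'
      have e₁ : h ≠ i.swap := fun e => ho ⟨e, (eq_swap_comm.1 e).symm⟩
      have e₂ : h.swap ≠ i := fun e => e₁ (eq_swap_comm.1 e.symm)
      rw [rootUnit_commutator_eq_one lam hij hhk e₁ e₂ e₁ (by simpa using e₂)]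
      exact one_mem _
    · exact F.commutator_mem_long_short hij hhk hs' ha (F.param_mem_ring hb) h₁ (by omega)
  · by_cases hs' : k = h.swap
    · subst hs'
      rw [← inv_mem_iff, commutatorElement_inv]
      exact F.commutator_mem_long_short hhk hij hs hb (F.param_mem_ring ha) (by omega) (by omega)
    · exact F.rootGroup_mono h₁ (F.commutator_mem_short hij hhk hs hs' ho ho'
        (F.param_mem_ring ha) (F.param_mem_ring hb))

/-- The conjugate is the commutator times the matrix itself. With `p ≤ 0 ≤ r`, the level `q ≥ r - 2
* p` makes all of `p + q`, `2 * p + q` and `p + 2 * q` at least `r`; the worst case is the term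
quadratic in the fixed parameter `a`. -/
theorem conj_mem_of_not_opposite (hij : i ≠ j) (hhk : h ≠ k) (ho : ¬ (h = j ∧ k = i))
    (ho' : ¬ (h = i.swap ∧ k = j.swap)) (ha : a ∈ rootParam lam K L i j p) (hp : p ≤ 0)
    (hr : 0 ≤ r) (hq : r - 2 * p ≤ q) (hb : b ∈ rootParam lam K L h k q) :
    rootUnit lam i j hij a * rootUnit lam h k hhk b * (rootUnit lam i j hij a)⁻¹ ∈
      rootGroup lam K L m r := by
  have e := F.commutator_mem (r := r) hij hhk ho ho' ha hb (by omega) (by omega) (by omega)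
  have := mul_mem e (F.rootGroup_mono (by omega : r ≤ q) (rootUnit_mem hhk hb))
  rwa [commutatorElement_def, inv_mul_cancel_right] at this

omit F in
-- Two indices use at most two of the `m` hyperbolic planes. This is the only place where the rank
-- condition enters.
theorem exists_index_ne (hm : 3 ≤ m) (i j : Fin m ⊕ Fin m) :
    ∃ l : Fin m ⊕ Fin m, l ≠ i ∧ l ≠ i.swap ∧ l ≠ j ∧ l ≠ j.swap := by
  let c : Fin m ⊕ Fin m → Fin m := Sum.elim id id
  obtain ⟨x, hx⟩ : ∃ x : Fin m, x ∉ ({c i, c j} : Finset (Fin m)) := by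
    by_contra! hx
    have h₁ := Finset.card_le_two (a := c i) (b := c j)
    rw [Finset.eq_univ_iff_forall.2 hx, Finset.card_univ, Fintype.card_fin] at h₁
    omega
  refine ⟨Sum.inl x, ?_⟩
  simp only [Finset.mem_insert, Finset.mem_singleton, not_or] at hx
  obtain ⟨h₁, h₂⟩ := hx
  rcases i with i | i <;> rcases j with j | j <;> simp_all [c]

/-- The parameter is factored as a product of elements of levels `p` and `q`, and the commutator
formula is read backwards through the auxiliary index `l`. -/
theorem exists_commutator_short {l : Fin m ⊕ Fin m} (hij : i ≠ j) (hs : j ≠ i.swap) (hil : i ≠ l)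
    (hlj : l ≠ j) (h₁ : l ≠ i.swap) (h₂ : l.swap ≠ j) (hb : b ∈ K (p + q)) :
    ∃ c ∈ rootParam lam K L i l p, ∃ d ∈ rootParam lam K L l j q,
      rootUnit lam i j hij b = ⁅rootUnit lam i l hil c, rootUnit lam l j hlj d⁆ := by
  obtain ⟨c, hc, d, hd, rfl⟩ := F.exists_mul hb
  refine ⟨c, (param_short h₁).2 hc, d, (param_short h₂.symm).2 hd, ?_⟩
  rw [rootUnit_commutator_short F.unitary hil hlj h₁ h₂.symm hij hs]

/-- A long root matrix appears as the quadratic term in the commutator of the long root `(l,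
l.swap)` with the short root `(l.swap, i)`. The bilinear term, at the short root `(l, i)`, is
cancelled by the extra factor. -/
theorem exists_commutator_long {l : Fin m ⊕ Fin m} (hij : i.swap ≠ i) (hli : l ≠ i)
    (hli' : l.swap ≠ i) (hb : b ∈ rootParam lam K L i.swap i (2 * p + q)) :
    ∃ c ∈ rootParam lam K L l l.swap q, ∃ d ∈ rootParam lam K L l.swap i p,
      ∃ e ∈ rootParam lam K L l i (p + q),
      rootUnit lam i.swap i hij b = (rootUnit lam l i hli e)⁻¹ *
        ⁅rootUnit lam l l.swap (swap_ne_self l).symm c, rootUnit lam l.swap i hli' d⁆ := by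
  rw [rootParam, Set.mem_ofPred_eq, if_pos (Sum.swap_swap i).symm] at hb
  obtain ⟨c, hc, x, hx, e⟩ := F.exists_conj hb
  have hc' : -(star (idxSign lam l.swap) * c) ∈ rootParam lam K L l l.swap q := by
    rw [param_long, mul_neg, ← mul_assoc, F.unitary.sign_mul_star, one_mul]
    exact neg_mem hc
  refine ⟨_, hc', x, (param_short ?_).2 hx, _, (param_short ?_).2
    (add_comm q p ▸ F.mul_mem_ring (F.param_mem_ring hc') hx), ?_⟩
  · simpa using hli.symm
  · exact hli'.symm
  rw [rootUnit_commutator_long_short F.unitary hli' hli.symm _ _ (F.param_long_star hc'),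
    inv_mul_cancel_left]
  congr 1
  have e₁ : star x * (star (idxSign lam l.swap) * c) * x =
      star (idxSign lam l.swap) * (idxSign lam i * b) := by
    rw [e, ← mul_assoc (star x), ← F.unitary.sign_star_comm]
    simp only [mul_assoc]
  rw [mul_neg, neg_mul, mul_neg, neg_neg, e₁, idxCoeff, F.unitary.sign_comm l.swap (star _),
    mul_assoc, ← mul_assoc (idxSign lam l.swap), F.unitary.sign_mul_star, one_mul, ← mul_assoc,
    F.unitary.star_mul_sign, one_mul]

/-- Only the root opposite to `(i, j)` is a problem, since there is no commutator formula for it. It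
is decomposed through an index `l` outside the planes of `i` and `j`, and each factor is then
non-opposite to `(i, j)`. The factor `3` pays for the decomposition of a long root. -/
theorem conj_rootUnit_mem (hm : 3 ≤ m) (hij : i ≠ j) (ha : a ∈ rootParam lam K L i j p)
    (hp : p ≤ 0) (hr : 0 ≤ r) (hhk : h ≠ k) (hb : b ∈ rootParam lam K L h k (3 * (r - 2 * p))) :
    rootUnit lam i j hij a * rootUnit lam h k hhk b * (rootUnit lam i j hij a)⁻¹ ∈
      rootGroup lam K L m r := by
  set g := rootUnit lam i j hij a
  set q := r - 2 * p with hq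
  have hc : ∀ {h k : Fin m ⊕ Fin m} {b : B} {q' : ℤ} (hhk : h ≠ k), ¬ (h = j ∧ k = i) →
      ¬ (h = i.swap ∧ k = j.swap) → q ≤ q' → b ∈ rootParam lam K L h k q' →
      rootUnit lam h k hhk b ∈ (rootGroup lam K L m r).comap (MulAut.conj g).toMonoidHom :=
    fun hhk ho ho' hq' hb => F.conj_mem_of_not_opposite hij hhk ho ho' ha hp hr hq' hb
  change rootUnit lam h k hhk b ∈ (rootGroup lam K L m r).comap (MulAut.conj g).toMonoidHom
  -- From here on only two things matter: `G` is a subgroup, hence closed under commutators, and by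
  -- `hc` it contains the non-opposite root matrices of level at least `q`.
  generalize (rootGroup lam K L m r).comap (MulAut.conj g).toMonoidHom = G at hc ⊢
  by_cases hop : (h = j ∧ k = i) ∨ (h = i.swap ∧ k = j.swap)
  swap
  · rw [not_or] at hop
    exact hc hhk hop.1 hop.2 (by omega) hb
  obtain ⟨l, h₁, h₂, h₃, h₄⟩ := exists_index_ne hm i j
  have h₅ : l.swap ≠ i := fun e => h₂ (eq_swap_comm.1 e.symm)
  have h₆ : l.swap ≠ j := fun e => h₄ (eq_swap_comm.1 e.symm)
  have hl : l ≠ l.swap := (swap_ne_self l).symm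
  have hcomm : ∀ {x y}, x ∈ G → y ∈ G → ⁅x, y⁆ ∈ G := fun {x y} hx hy => by
    rw [commutatorElement_def]
    exact mul_mem (mul_mem (mul_mem hx hy) (inv_mem hx)) (inv_mem hy)
  by_cases hs : j = i.swap
  · subst hs
    have hh : h = i.swap ∧ k = i := by simpa using hop
    obtain ⟨rfl, rfl⟩ := hh
    -- The split `3 * q = 2 * q + q` puts both commutator factors at level `q` and the correcting
    -- factor at level `2 * q`, all at least `q` because `q ≥ 0`.
    rw [show 3 * q = 2 * q + q by ring] at hb
    obtain ⟨c, hc', d, hd, e, he, hx⟩ := F.exists_commutator_long hhk h₁ h₅ hb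
    rw [hx]
    refine mul_mem (inv_mem (hc h₁ ?_ ?_ (by omega) he))
      (hcomm (hc _ ?_ ?_ le_rfl hc') (hc _ ?_ ?_ le_rfl hd))
    · exact fun e => h₂ e.1
    · exact fun e => h₂ e.1
    · exact fun e => h₂ e.1
    · exact fun e => h₂ e.1
    · exact fun e => h₁ (swap_inj.1 e.1)
    · exact fun e => h₁ (swap_inj.1 e.1)
  · have key : ∀ {b}, b ∈ K (q + q) → rootUnit lam j i hij.symm b ∈ G := by
      intro b hb
      obtain ⟨c, hc', d, hd, hx⟩ := F.exists_commutator_short hij.symm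
        (fun e => hs (eq_swap_comm.1 e)) h₃.symm h₁ h₄ h₅ hb
      rw [hx]
      refine hcomm (hc _ ?_ ?_ le_rfl hc') (hc _ ?_ ?_ le_rfl hd)
      all_goals exact fun e => by simp_all
    have hb' : b ∈ K (q + q) := F.antitone_ring (by omega) (F.param_mem_ring hb)
    rcases hop with ⟨rfl, rfl⟩ | ⟨rfl, rfl⟩
    · exact key hb'
    · rw [rootUnit_swap F.unitary hhk
        (by rw [Sum.swap_swap]; exact fun e => hs (eq_swap_comm.1 e.symm))]
      have := key (neg_mem (F.coeff_mul_mem i.swap j.swap (F.star_mem hb')))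
      simpa only [Sum.swap_swap] using this

/-- Conjugation by the elementary group is continuous for the filtration by the groups
`rootGroup`. -/
theorem exists_conj_mem (hm : 3 ≤ m) {g : (Matrix (Fin m ⊕ Fin m) (Fin m ⊕ Fin m) B)ˣ}
    (hg : g ∈ rootGroupTop lam K L m) : ∀ r : ℤ, 0 ≤ r → ∃ q : ℤ, 0 ≤ q ∧
      ∀ x ∈ rootGroup lam K L m q, g * x * g⁻¹ ∈ rootGroup lam K L m r := by
  have hgen : ∀ g ∈ {g | ∃ i j, ∃ hij : i ≠ j, ∃ p, ∃ a ∈ rootParam lam K L i j p,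
      g = rootUnit lam i j hij a}, ∀ r : ℤ, 0 ≤ r → ∃ q : ℤ, 0 ≤ q ∧
      ∀ x ∈ rootGroup lam K L m q, g * x * g⁻¹ ∈ rootGroup lam K L m r := by
    rintro g ⟨i, j, hij, p, a, ha, rfl⟩ r hr
    -- The estimate requires a non-positive level for the conjugating parameter. Since the
    -- filtration descends, a parameter of positive level also has level `0`.
    have hp : min p 0 ≤ 0 := min_le_right _ _
    refine ⟨3 * (r - 2 * min p 0), by omega, fun x hx => ?_⟩
    have : rootGroup lam K L m (3 * (r - 2 * min p 0)) ≤
        (rootGroup lam K L m r).comap (MulAut.conj (rootUnit lam i j hij a)).toMonoidHom := by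
      refine (Subgroup.closure_le _).2 ?_
      rintro y ⟨h, k, hhk, b, hb, rfl⟩
      exact F.conj_rootUnit_mem hm hij (F.param_mono (min_le_left _ _) ha) hp hr hhk hb
    exact this hx
  refine Subgroup.closure_induction'' hgen ?_ ?_ ?_ hg
  · rintro g ⟨i, j, hij, p, a, ha, rfl⟩
    exact hgen _ ⟨i, j, hij, p, -a, param_neg ha, (rootUnit_neg lam hij a).symm⟩
  · exact fun r hr => ⟨r, hr, fun x hx => by simpa using hx⟩
  · intro x y _ _ hx hy r hr
    obtain ⟨q, hq, hx⟩ := hx r hr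
    obtain ⟨q', hq', hy⟩ := hy q hq
    refine ⟨q', hq', fun z hz => ?_⟩
    have := hx _ (hy z hz)
    simpa only [mul_inv_rev, mul_assoc] using this

end IsFormFiltration

/-- The action of a ring homomorphism on invertible matrices. -/
def mapGL {B B' : Type*} [Ring B] [Ring B'] {m : ℕ} (f : B →+* B') :
    (Matrix (Fin m ⊕ Fin m) (Fin m ⊕ Fin m) B)ˣ →* (Matrix (Fin m ⊕ Fin m) (Fin m ⊕ Fin m) B')ˣ :=
  Units.map (f.mapMatrix : Matrix (Fin m ⊕ Fin m) (Fin m ⊕ Fin m) B →+*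
    Matrix (Fin m ⊕ Fin m) (Fin m ⊕ Fin m) B').toMonoidHom

theorem map_idxSign {B B' : Type*} [Ring B] [Ring B'] {m : ℕ} (f : B →+* B') (lam : B)
    (i : Fin m ⊕ Fin m) : f (idxSign lam i) = idxSign (f lam) i := by
  cases i <;> simp [idxSign]

theorem mapGL_rootUnit {B B' : Type*} [Ring B] [StarRing B] [Ring B'] [StarRing B'] {m : ℕ}
    (f : B →+* B') (hf : ∀ x, f (star x) = star (f x)) (lam : B) {i j : Fin m ⊕ Fin m}
    (hij : i ≠ j) (a : B) :
    mapGL f (rootUnit lam i j hij a) = rootUnit (f lam) i j hij (f a) := by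
  ext1
  change (1 + rootNil lam i j a).map f = 1 + rootNil (f lam) i j (f a)
  rw [Matrix.map_add f (map_add f), Matrix.map_one f (map_zero f) (map_one f)]
  congr 1
  unfold rootNil
  rw [Matrix.map_sub f (map_sub f), Matrix.map_single]
  congr 1
  split_ifs
  · exact Matrix.map_zero f (map_zero f)
  · rw [Matrix.map_single, map_mul, hf, idxCoeff, idxCoeff, map_mul, hf, map_idxSign, map_idxSign]

/-! ### Generation from one hyperbolic plane, and the dilation argument -/

namespace IsFormFiltration

variable {B : Type*} [Ring B] [StarRing B] {lam : B} {K L : ℤ → AddSubgroup B}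
  (F : IsFormFiltration lam K L) {m : ℕ}
include F

/-- The root matrices which involve a fixed hyperbolic plane generate all others, at the cost of
passing to a deeper level. -/
theorem rootGroup_le_of_plane {G : Subgroup (Matrix (Fin m ⊕ Fin m) (Fin m ⊕ Fin m) B)ˣ}
    (z : Fin m ⊕ Fin m) {r : ℤ} (hr : 0 ≤ r)
    (h₁ : ∀ (j) (hj : z ≠ j), ∀ a ∈ rootParam lam K L z j r, rootUnit lam z j hj a ∈ G)
    (h₂ : ∀ (j) (hj : z.swap ≠ j), ∀ a ∈ rootParam lam K L z.swap j r,
      rootUnit lam z.swap j hj a ∈ G) :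
    rootGroup lam K L m (3 * r) ≤ G := by
  have left : ∀ {i j a p} (hij : i ≠ j), i = z ∨ i = z.swap → r ≤ p →
      a ∈ rootParam lam K L i j p → rootUnit lam i j hij a ∈ G := by
    rintro i j a p hij (rfl | rfl) hp ha
    · exact h₁ j hij a (F.param_mono hp ha)
    · exact h₂ j hij a (F.param_mono hp ha)
  -- For a short root, `rootUnit_swap` turns a column index in the plane into a row index in the
  -- plane. For a long root both indices lie in the plane already.
  have right : ∀ {i j a p} (hij : i ≠ j), j = z ∨ j = z.swap → r ≤ p →
      a ∈ rootParam lam K L i j p → rootUnit lam i j hij a ∈ G := by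
    intro i j a p hij hj hp ha
    by_cases hs : j = i.swap
    · refine left hij ?_ hp ha
      rcases hj with rfl | rfl
      · exact Or.inr (eq_swap_comm.1 hs)
      · exact Or.inl (swap_inj.1 hs).symm
    · rw [rootUnit_swap F.unitary hij hs]
      refine left _ ?_ hp (F.param_swap hs (F.param_mem_ring ha))
      rcases hj with rfl | rfl
      · exact Or.inr rfl
      · exact Or.inl (Sum.swap_swap z)
  refine (Subgroup.closure_le _).2 ?_
  rintro g ⟨i, j, hij, a, ha, rfl⟩
  by_cases hi : i = z ∨ i = z.swap
  · exact left hij hi (by omega) ha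
  by_cases hj : j = z ∨ j = z.swap
  · exact right hij hj (by omega) ha
  rw [not_or] at hi hj
  have hcomm : ∀ {x y}, x ∈ G → y ∈ G → ⁅x, y⁆ ∈ G := fun {x y} hx hy => by
    rw [commutatorElement_def]
    exact mul_mem (mul_mem (mul_mem hx hy) (inv_mem hx)) (inv_mem hy)
  by_cases hs : j = i.swap
  · have hs' := eq_swap_comm.1 hs
    subst hs'
    rw [show 3 * r = 2 * r + r by ring] at ha
    obtain ⟨c, hc, d, hd, e, he, hx⟩ := F.exists_commutator_long hij (Ne.symm hj.1)
      (fun e => hj.2 e.symm) ha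
    change rootUnit lam _ _ hij a ∈ G
    rw [hx]
    exact mul_mem (inv_mem (left _ (Or.inl rfl) (by omega) he))
      (hcomm (left _ (Or.inl rfl) le_rfl hc) (left _ (Or.inr rfl) le_rfl hd))
  · obtain ⟨c, hc, d, hd, hx⟩ :=
      F.exists_commutator_short (p := r) (q := r) hij hs hi.1 (Ne.symm hj.1)
      (fun e => hi.2 (eq_swap_comm.1 e)) (fun e => hj.2 e.symm)
      (F.antitone_ring (by omega) (F.param_mem_ring ha))
    change rootUnit lam _ _ hij a ∈ G
    rw [hx]
    exact hcomm (right _ (Or.inl rfl) le_rfl hc) (left _ (Or.inl rfl) le_rfl hd)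

/-- The dilation principle for root groups: if the ring homomorphisms `D b` tend to `e` uniformly on
every step of the filtration, then `D b g` tends to `e g` for every elementary matrix `g`. -/
theorem exists_dilation (hm : 3 ≤ m) {β : Type*} (D : β → B →+* B) (e : B →+* B) (T : ℕ → Set β)
    (hT : Antitone T) (hD_star : ∀ b x, D b (star x) = star (D b x)) (hD_lam : ∀ b, D b lam = lam)
    (he_star : ∀ x, e (star x) = star (e x)) (he_lam : e lam = lam)
    (heK : ∀ p, ∀ a ∈ K p, e a ∈ K p) (heL : ∀ p, ∀ a ∈ L p, e a ∈ L p)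
    (hK : ∀ p q : ℤ, ∃ l, ∀ b ∈ T l, ∀ a ∈ K p, D b a - e a ∈ K q)
    (hL : ∀ p q : ℤ, ∃ l, ∀ b ∈ T l, ∀ a ∈ L p, D b a - e a ∈ L q)
    {g : (Matrix (Fin m ⊕ Fin m) (Fin m ⊕ Fin m) B)ˣ} (hg : g ∈ rootGroupTop lam K L m) :
    ∀ r : ℤ, 0 ≤ r → ∃ l, ∀ b ∈ T l, mapGL (D b) g * (mapGL e g)⁻¹ ∈ rootGroup lam K L m r := by
  -- Continuity of conjugation will be applied to the limits `e x`, so these must again be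
  -- elementary.
  have htop : ∀ g ∈ rootGroupTop lam K L m, mapGL e g ∈ rootGroupTop lam K L m := by
    intro g hg
    have : rootGroupTop lam K L m ≤ (rootGroupTop lam K L m).comap (mapGL e) := by
      refine (Subgroup.closure_le _).2 ?_
      rintro g ⟨i, j, hij, p, a, ha, rfl⟩
      refine Subgroup.subset_closure ⟨i, j, hij, p, e a, ?_, ?_⟩
      · unfold rootParam at ha ⊢
        split_ifs at ha ⊢
        · have := heL p _ ha
          rwa [map_mul, map_idxSign, he_lam] at this
        · exact heK p _ ha
      · rw [mapGL_rootUnit e he_star, he_lam]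
    exact this hg
  induction hg using Subgroup.closure_induction with
  | mem g hg =>
    obtain ⟨i, j, hij, p, a, ha, rfl⟩ := hg
    intro r _
    have key : ∃ l, ∀ b ∈ T l, D b a - e a ∈ rootParam lam K L i j r := by
      by_cases hs : j = i.swap
      · subst hs
        obtain ⟨l, hl⟩ := hL p r
        refine ⟨l, fun b hb => ?_⟩
        have := hl b hb _ (param_long.1 ha)
        rw [map_mul, map_mul, map_idxSign, map_idxSign, hD_lam, he_lam, ← mul_sub] at this
        exact param_long.2 this
      · obtain ⟨l, hl⟩ := hK p r
        exact ⟨l, fun b hb => (param_short hs).2 (hl b hb _ ((param_short hs).1 ha))⟩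
    obtain ⟨l, hl⟩ := key
    refine ⟨l, fun b hb => ?_⟩
    rw [mapGL_rootUnit e he_star, mapGL_rootUnit (D b) (hD_star b), he_lam, hD_lam, ← rootUnit_neg,
      ← rootUnit_add, ← sub_eq_add_neg]
    exact rootUnit_mem hij (hl b hb)
  | one => exact fun r _ => ⟨0, fun b _ => by simp⟩
  | mul x y hx hy ihx ihy =>
    intro r hr
    -- With `δ x = D x * (e x)⁻¹` one has `δ (x y) = δ x * (e x * δ y * (e x)⁻¹)`. The conjugating
    -- element `e x` does not depend on `b`, so a single level `q` for `δ y` serves all `b`.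
    obtain ⟨q, hq, hc⟩ := F.exists_conj_mem hm (htop x hx) r hr
    obtain ⟨l, hl⟩ := ihx r hr
    obtain ⟨l', hl'⟩ := ihy q hq
    refine ⟨max l l', fun b hb => ?_⟩
    have := mul_mem (hl b (hT (le_max_left _ _) hb)) (hc _ (hl' b (hT (le_max_right _ _) hb)))
    convert this using 1
    simp only [map_mul]
    group
  | inv x hx ihx =>
    intro r hr
    -- Similarly `δ (x⁻¹) = (e x)⁻¹ * (δ x)⁻¹ * e x`.
    obtain ⟨q, hq, hc⟩ := F.exists_conj_mem hm (inv_mem (htop x hx)) r hr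
    obtain ⟨l, hl⟩ := ihx q hq
    refine ⟨l, fun b hb => ?_⟩
    have := hc _ (inv_mem (hl b hb))
    convert this using 1
    simp only [map_inv]
    group

end IsFormFiltration

/-! ### The double of a form ring along an ideal, and its localization -/

/-- A homomorphism `ψ` from a form ring `(A, Λ)` with involution ideal `J` to a ring in which
the element `s` becomes the central unit `u`. -/
structure IsFormInverting {A S : Type*} [Ring A] [StarRing A] [Ring S] [StarRing S] (lam : A)
    (Λ J : AddSubgroup A) (ψ : A →+* S) (s : A) (u : Sˣ) : Prop where
  form : IsFormParameter lam Λ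
  unitary : IsCentralUnitary (ψ lam)
  map_star : ∀ a, ψ (star a) = star (ψ a)
  mul_mem_left : ∀ r, ∀ a ∈ J, r * a ∈ J
  mul_mem_right : ∀ r, ∀ a ∈ J, a * r ∈ J
  star_mem : ∀ a ∈ J, star a ∈ J
  mul_mem_form : ∀ a ∈ Λ, s * a ∈ Λ
  map_eq : ψ s = u
  comm : ∀ x : S, u * x = x * u
  star_eq : star (u : S) = u

/-- The pairs of elements of `T` which are congruent modulo `J`. -/
def congrPairs {A : Type*} [Ring A] (T J : AddSubgroup A) : AddSubgroup (A × A) where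
  carrier := {r | r.1 ∈ T ∧ r.2 ∈ T ∧ r.1 - r.2 ∈ J}
  add_mem' := by
    rintro a b ⟨h₁, h₂, h₃⟩ ⟨h₁', h₂', h₃'⟩
    refine ⟨add_mem h₁ h₁', add_mem h₂ h₂', ?_⟩
    have := add_mem h₃ h₃'
    rwa [sub_add_sub_comm] at this
  zero_mem' := ⟨zero_mem _, zero_mem _, by simp⟩
  neg_mem' := by
    rintro a ⟨h₁, h₂, h₃⟩
    refine ⟨neg_mem h₁, neg_mem h₂, ?_⟩
    have := neg_mem h₃
    rwa [neg_sub'] at this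

/-- The pairs `(ψ r u ^ p, ψ r' u ^ p)` with `r, r' ∈ T` congruent modulo `J`. -/
def pairFiltration {A S : Type*} [Ring A] [Ring S] (T J : AddSubgroup A) (ψ : A →+* S) (u : Sˣ)
    (p : ℤ) : AddSubgroup (S × S) :=
  (congrPairs T J).map
    ((AddMonoidHom.mulRight (((u ^ p : Sˣ) : S), ((u ^ p : Sˣ) : S))).comp
      (ψ.prodMap ψ).toAddMonoidHom)

theorem mem_pairFiltration {A S : Type*} [Ring A] [Ring S] {T J : AddSubgroup A} {ψ : A →+* S}
    {u : Sˣ} {p : ℤ} {x : S × S} : x ∈ pairFiltration T J ψ u p ↔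
      ∃ r r', r ∈ T ∧ r' ∈ T ∧ r - r' ∈ J ∧
        x = (ψ r * ((u ^ p : Sˣ) : S), ψ r' * ((u ^ p : Sˣ) : S)) := by
  constructor
  · rintro ⟨⟨r, r'⟩, ⟨h₁, h₂, h₃⟩, rfl⟩
    exact ⟨r, r', h₁, h₂, h₃, rfl⟩
  · rintro ⟨r, r', h₁, h₂, h₃, rfl⟩
    exact ⟨⟨r, r'⟩, ⟨h₁, h₂, h₃⟩, rfl⟩

namespace IsFormInverting

variable {A S : Type*} [Ring A] [StarRing A] [Ring S] [StarRing S] {lam : A}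
    {Λ J : AddSubgroup A} {ψ : A →+* S} {s : A} {u : Sˣ} (F : IsFormInverting lam Λ J ψ s u)
include F

theorem zpow_comm (p : ℤ) (x : S) : ((u ^ p : Sˣ) : S) * x = x * ((u ^ p : Sˣ) : S) := by
  have h : Commute x (u : S) := (F.comm x).symm
  exact (h.units_zpow_right p).eq.symm

theorem star_zpow (p : ℤ) : star ((u ^ p : Sˣ) : S) = ((u ^ p : Sˣ) : S) := by
  have h : star u = u := Units.ext (by simpa using F.star_eq)
  rw [← Units.coe_star, _root_.star_zpow, h]

theorem map_pow (k : ℕ) (p : ℤ) (r : A) :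
    ψ (s ^ k * r) * ((u ^ p : Sˣ) : S) = ψ r * ((u ^ (p + k) : Sˣ) : S) := by
  rw [map_mul, _root_.map_pow, F.map_eq, add_comm, zpow_add, zpow_natCast, Units.val_mul,
    Units.val_pow_eq_pow_val, ← mul_assoc]
  have h : Commute (ψ r) (u : S) := (F.comm _).symm
  rw [(h.pow_right k).eq]

theorem pow_mul_mem (k : ℕ) {a : A} (ha : a ∈ Λ) : s ^ k * a ∈ Λ := by
  induction k with
  | zero => simpa using ha
  | succ k ih =>
    rw [pow_succ', mul_assoc]
    exact F.mul_mem_form _ ih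

/-- Since `ψ s = u`, a fraction `ψ r * u ^ (p + k)` equals `ψ (s ^ k * r) * u ^ p`: depth is
absorbed into the numerator. -/
theorem antitone {T : AddSubgroup A} (hT : ∀ (k : ℕ) (a : A), a ∈ T → s ^ k * a ∈ T) :
    Antitone (pairFiltration T J ψ u) := by
  intro p q hpq x hx
  obtain ⟨r, r', h₁, h₂, h₃, rfl⟩ := mem_pairFiltration.1 hx
  obtain ⟨k, rfl⟩ := Int.le.dest hpq
  refine mem_pairFiltration.2 ⟨s ^ k * r, s ^ k * r', hT k r h₁, hT k r' h₂, ?_, ?_⟩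
  · rw [← mul_sub]
    exact F.mul_mem_left _ _ h₃
  · rw [F.map_pow, F.map_pow]

/-- Pairs congruent modulo an involution-invariant two-sided ideal form a ring with involution, the
double of `A` along `J`; the powers of the central self-adjoint unit `u` shift the levels. Working
over this ring replaces relative commutator calculus by the absolute one. -/
theorem isFormFiltration : IsFormFiltration ((ψ lam, ψ lam) : S × S) (pairFiltration ⊤ J ψ u)
    (pairFiltration Λ J ψ u) where
  unitary :=
    { comm := fun x => Prod.ext (F.unitary.comm x.1) (F.unitary.comm x.2)
      mul_star := Prod.ext F.unitary.mul_star F.unitary.mul_star }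
  antitone_ring := F.antitone fun _ _ _ => AddSubgroup.mem_top _
  antitone_form := F.antitone fun k _ ha => F.pow_mul_mem k ha
  mul_mem_ring := by
    intro p q a b ha hb
    obtain ⟨r, r', -, -, h, rfl⟩ := mem_pairFiltration.1 ha
    obtain ⟨t, t', -, -, h', rfl⟩ := mem_pairFiltration.1 hb
    refine mem_pairFiltration.2 ⟨r * t, r' * t', AddSubgroup.mem_top _, AddSubgroup.mem_top _,
      ?_, ?_⟩
    · rw [show r * t - r' * t' = (r - r') * t + r' * (t - t') by noncomm_ring]
      exact add_mem (F.mul_mem_right _ _ h) (F.mul_mem_left _ _ h')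
    · have key : ∀ x y : A, ψ x * ((u ^ p : Sˣ) : S) * (ψ y * ((u ^ q : Sˣ) : S)) =
          ψ (x * y) * ((u ^ (p + q) : Sˣ) : S) := fun x y => by
        rw [mul_assoc, ← mul_assoc _ (ψ y), F.zpow_comm, map_mul, zpow_add, Units.val_mul]
        simp only [mul_assoc]
      exact Prod.ext (key _ _) (key _ _)
  star_mem := by
    intro p a ha
    obtain ⟨r, r', -, -, h, rfl⟩ := mem_pairFiltration.1 ha
    refine mem_pairFiltration.2 ⟨star r, star r', AddSubgroup.mem_top _, AddSubgroup.mem_top _,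
      ?_, ?_⟩
    · rw [← star_sub]
      exact F.star_mem _ h
    · have key : ∀ x : A, star (ψ x * ((u ^ p : Sˣ) : S)) = ψ (star x) * ((u ^ p : Sˣ) : S) :=
        fun x => by rw [star_mul, F.star_zpow, F.zpow_comm, F.map_star]
      exact Prod.ext (key _) (key _)
  one_mem_ring := mem_pairFiltration.2 ⟨1, 1, by simp, by simp, by simp, by simp; rfl⟩
  lam_mem := mem_pairFiltration.2 ⟨lam, lam, by simp, by simp, by simp, by simp⟩
  form_le := by
    intro p a ha
    obtain ⟨r, r', -, -, h, rfl⟩ := mem_pairFiltration.1 ha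
    exact mem_pairFiltration.2 ⟨r, r', AddSubgroup.mem_top _, AddSubgroup.mem_top _, h, rfl⟩
  form_anti := by
    intro p a ha
    obtain ⟨r, r', h₁, h₂, h, rfl⟩ := mem_pairFiltration.1 ha
    have key : ∀ x ∈ Λ, ψ x * ((u ^ p : Sˣ) : S) =
        -(ψ lam * star (ψ x * ((u ^ p : Sˣ) : S))) := fun x hx => by
      rw [star_mul, F.star_zpow, F.zpow_comm, ← mul_assoc, ← F.map_star, ← map_mul, ← neg_mul,
        ← map_neg, ← F.form.le_max x hx]
    exact Prod.ext (key _ h₁) (key _ h₂)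
  conj_mem := by
    intro p q x a hx ha
    obtain ⟨r, r', -, -, h, rfl⟩ := mem_pairFiltration.1 hx
    obtain ⟨t, t', h₁, h₂, h', rfl⟩ := mem_pairFiltration.1 ha
    refine mem_pairFiltration.2 ⟨star r * t * r, star r' * t' * r', F.form.conj_mem _ _ h₁,
      F.form.conj_mem _ _ h₂, ?_, ?_⟩
    · rw [show star r * t * r - star r' * t' * r' = star (r - r') * (t * r) +
        star r' * ((t - t') * r) + star r' * t' * (r - r') by rw [star_sub]; noncomm_ring]
      exact add_mem (add_mem (F.mul_mem_right _ _ (F.star_mem _ h))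
        (F.mul_mem_left _ _ (F.mul_mem_right _ _ h'))) (F.mul_mem_left _ _ h)
    · have key : ∀ x y : A, star (ψ x * ((u ^ p : Sˣ) : S)) * (ψ y * ((u ^ q : Sˣ) : S)) *
          (ψ x * ((u ^ p : Sˣ) : S)) =
          ψ (star x * y * x) * ((u ^ (2 * p + q) : Sˣ) : S) := fun x y => by
        rw [star_mul, F.star_zpow, F.zpow_comm, ← F.map_star,
          show (2 * p + q) = p + q + p by ring, zpow_add, zpow_add, Units.val_mul, Units.val_mul,
          map_mul, map_mul]
        simp only [mul_assoc]
        rw [← mul_assoc _ (ψ y), F.zpow_comm p (ψ y), ← mul_assoc _ (ψ x), F.zpow_comm q (ψ x)]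
        simp only [mul_assoc]
        rw [← mul_assoc _ (ψ x), F.zpow_comm p (ψ x)]
        simp only [mul_assoc]
      exact Prod.ext (key _ _) (key _ _)
  sub_mem := by
    intro p a ha
    obtain ⟨r, r', -, -, h, rfl⟩ := mem_pairFiltration.1 ha
    refine mem_pairFiltration.2 ⟨r - lam * star r, r' - lam * star r', F.form.min_le _,
      F.form.min_le _, ?_, ?_⟩
    · rw [show r - lam * star r - (r' - lam * star r') = (r - r') - lam * star (r - r') by
        rw [star_sub]; noncomm_ring]
      exact sub_mem h (F.mul_mem_left _ _ (F.star_mem _ h))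
    · have key : ∀ x : A, ψ x * ((u ^ p : Sˣ) : S) - ψ lam * star (ψ x * ((u ^ p : Sˣ) : S)) =
          ψ (x - lam * star x) * ((u ^ p : Sˣ) : S) := fun x => by
        rw [star_mul, F.star_zpow, F.zpow_comm, ← mul_assoc, ← F.map_star, ← map_mul, map_sub,
          sub_mul]
      exact Prod.ext (key _) (key _)
  -- The whole numerator goes into one factor; the other is the pure power `u ^ q`. The same device
  -- gives `exists_conj`, with `u ^ p` central and self-adjoint.
  exists_mul := by
    intro p q a ha
    obtain ⟨r, r', -, -, h, rfl⟩ := mem_pairFiltration.1 ha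
    refine ⟨_, mem_pairFiltration.2 ⟨r, r', AddSubgroup.mem_top _, AddSubgroup.mem_top _, h, rfl⟩,
      _, mem_pairFiltration.2 ⟨1, 1, AddSubgroup.mem_top _, AddSubgroup.mem_top _, by simp, rfl⟩,
      ?_⟩
    simp [zpow_add, mul_assoc]
  exists_conj := by
    intro p q a ha
    obtain ⟨r, r', h₁, h₂, h, rfl⟩ := mem_pairFiltration.1 ha
    refine ⟨_, mem_pairFiltration.2 ⟨r, r', h₁, h₂, h, rfl⟩,
      _, mem_pairFiltration.2 ⟨1, 1, AddSubgroup.mem_top _, AddSubgroup.mem_top _, by simp, rfl⟩,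
      ?_⟩
    have key : ∀ x : A, ψ x * ((u ^ (2 * p + q) : Sˣ) : S) =
        star (ψ 1 * ((u ^ p : Sˣ) : S)) * (ψ x * ((u ^ q : Sˣ) : S)) *
          (ψ 1 * ((u ^ p : Sˣ) : S)) := fun x => by
      rw [map_one, one_mul, F.star_zpow, show (2 * p + q) = p + q + p by ring, zpow_add, zpow_add,
        Units.val_mul, Units.val_mul, ← mul_assoc _ (ψ x), F.zpow_comm p (ψ x)]
      simp only [mul_assoc]
    exact Prod.ext (key _) (key _)

end IsFormInverting

/-! ### Polynomials over a form ring -/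

theorem star_C {R : Type*} [Ring R] [StarRing R] (a : R) : star (C a) = C (star a) :=
  SesquilinearForm.star_monomial 0 a

theorem coeff_star {R : Type*} [Ring R] [StarRing R] (p : R[X]) (n : ℕ) :
    (star p).coeff n = star (p.coeff n) :=
  coeff_polyStar p n

theorem monomial_mem_polySubgroup {R : Type*} [Ring R] {T : AddSubgroup R} {a : R} (ha : a ∈ T)
    (i : ℕ) : monomial i a ∈ polySubgroup T := fun n => by
  rw [coeff_monomial]
  split_ifs
  · exact ha
  · exact zero_mem _

theorem sum_mem_of_mem_polySubgroup {R M : Type*} [Ring R] [AddCommGroup M] {T : AddSubgroup R}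
    {N : AddSubgroup M} (g : R[X] →+ M) (h : ∀ i, ∀ a ∈ T, g (monomial i a) ∈ N) {p : R[X]}
    (hp : p ∈ polySubgroup T) : g p ∈ N := by
  rw [p.as_sum_support, map_sum]
  exact sum_mem fun i _ => h i _ (hp i)

theorem IsFormParameter.poly {R : Type*} [Ring R] [StarRing R] {lam : R} {Λ : AddSubgroup R}
    (hΛ : IsFormParameter lam Λ) (hlam : lam ∈ Subring.center R) :
    IsFormParameter (C lam) (polySubgroup Λ) where
  min_le a n := by
    rw [coeff_sub, coeff_C_mul, coeff_star]
    exact hΛ.min_le _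
  le_max a ha := by
    ext n
    rw [coeff_neg, coeff_C_mul, coeff_star]
    exact hΛ.le_max _ (ha n)
  conj_mem x a ha := by
    have hmax : a = -(C lam * star a) := by
      ext n
      rw [coeff_neg, coeff_C_mul, coeff_star]
      exact hΛ.le_max _ (ha n)
    have hc : ∀ y : R[X], C lam * y = y * C lam := fun y => by
      ext n
      rw [coeff_C_mul, coeff_mul_C, Subring.mem_center_iff.1 hlam]
    induction x using Polynomial.induction_on' with
    | add x y hx hy =>
      -- Conjugation is quadratic in `x`, so it cannot be checked coefficientwise. The two cross
      -- terms are `w` and `-(C lam * star w)` with `w = star x * a * y`, and their sum lies in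
      -- every form parameter; this reduces the claim to monomials.
      have e : star (x + y) * a * (x + y) = star x * a * x + star y * a * y +
          (star x * a * y - C lam * star (star x * a * y)) := by
        have : C lam * star (star x * a * y) = -(star y * a * x) := by
          rw [star_mul, star_mul, star_star, ← mul_assoc, hc, mul_assoc, ← mul_assoc (C lam)]
          conv_rhs => rw [hmax]
          noncomm_ring
        rw [this, star_add]
        noncomm_ring
      rw [e]
      refine add_mem (add_mem hx hy) fun n => ?_
      rw [coeff_sub, coeff_C_mul, coeff_star]
      exact hΛ.min_le _
    | monomial i c =>
      rw [SesquilinearForm.star_monomial]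
      refine sum_mem_of_mem_polySubgroup ((AddMonoidHom.mulRight (monomial i c)).comp
        (AddMonoidHom.mulLeft (monomial i (star c)))) (fun k b hb => ?_) ha
      simp only [AddMonoidHom.comp_apply, AddMonoidHom.coe_mulLeft, AddMonoidHom.coe_mulRight,
        monomial_mul_monomial]
      exact monomial_mem_polySubgroup (hΛ.conj_mem _ _ hb) _

theorem mul_mem_polySubgroup {R : Type*} [Ring R] (J : Ideal R) [J.IsTwoSided] (r a : R[X])
    (ha : a ∈ polySubgroup J.toAddSubgroup) : r * a ∈ polySubgroup J.toAddSubgroup := fun n => by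
  rw [coeff_mul]
  exact sum_mem fun x _ => J.mul_mem_left _ (ha _)

theorem mul_mem_polySubgroup_right {R : Type*} [Ring R] (J : Ideal R) [J.IsTwoSided] (r a : R[X])
    (ha : a ∈ polySubgroup J.toAddSubgroup) : a * r ∈ polySubgroup J.toAddSubgroup := fun n => by
  rw [coeff_mul]
  exact sum_mem fun x _ => J.mul_mem_right _ (ha _)

/-! ### Localization -/

/-- The statement for all `l ≥ k` is what makes common denominators of sums, and later of
coefficients, immediate. -/
theorem exists_of_mem_locSubgroup {R Rs : Type*} [Ring R] [Ring Rs] {s : R} {φ : R →+* Rs}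
    {T : AddSubgroup R} (hT : ∀ a ∈ T, s * a ∈ T)
    (hs : s ∈ Subring.center R) {y : Rs} (hy : y ∈ locSubgroup s φ T) :
    ∃ k : ℕ, ∀ l ≥ k, ∃ a ∈ T, y * φ s ^ l = φ a := by
  have hT' : ∀ k : ℕ, ∀ a ∈ T, a * s ^ k ∈ T := by
    intro k
    induction k with
    | zero => simp
    | succ k ih =>
      intro a ha
      rw [pow_succ, ← mul_assoc, Subring.mem_center_iff.1 hs]
      exact hT _ (ih a ha)
  induction hy using AddSubgroup.closure_induction with
  | mem y hy =>
    obtain ⟨a, ha, k, h⟩ := hy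
    refine ⟨k, fun l hl => ?_⟩
    obtain ⟨d, rfl⟩ := Nat.exists_eq_add_of_le hl
    exact ⟨a * s ^ d, hT' d a ha, by rw [pow_add, ← mul_assoc, h, map_mul, map_pow]⟩
  | zero => exact ⟨0, fun l _ => ⟨0, zero_mem _, by simp⟩⟩
  | add x y _ _ hx hy =>
    obtain ⟨k, hk⟩ := hx
    obtain ⟨k', hk'⟩ := hy
    refine ⟨max k k', fun l hl => ?_⟩
    obtain ⟨a, ha, h⟩ := hk l (le_trans (le_max_left _ _) hl)
    obtain ⟨a', ha', h'⟩ := hk' l (le_trans (le_max_right _ _) hl)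
    exact ⟨a + a', add_mem ha ha', by rw [add_mul, h, h', map_add]⟩
  | neg x _ hx =>
    obtain ⟨k, hk⟩ := hx
    refine ⟨k, fun l hl => ?_⟩
    obtain ⟨a, ha, h⟩ := hk l hl
    exact ⟨-a, neg_mem ha, by rw [neg_mul, h, map_neg]⟩

/-- Common denominators of polynomials. -/
theorem exists_poly_of_mem_locSubgroup {R Rs : Type*} [Ring R] [Ring Rs] {s : R}
    {φ : R →+* Rs} {T : AddSubgroup R} (hT : ∀ a ∈ T, s * a ∈ T)
    (hs : s ∈ Subring.center R) {y : Rs[X]} (hy : y ∈ polySubgroup (locSubgroup s φ T)) :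
    ∃ k : ℕ, ∀ l ≥ k, ∃ a ∈ polySubgroup T, y * C (φ s) ^ l = a.map φ := by
  choose k hk using fun n => exists_of_mem_locSubgroup hT hs (hy n)
  refine ⟨y.support.sup k, fun l hl => ?_⟩
  have h : ∀ n, ∃ a ∈ T, y.coeff n * φ s ^ l = φ a := by
    intro n
    by_cases hn : n ∈ y.support
    · exact hk n l (le_trans (Finset.le_sup hn) hl)
    · exact ⟨0, zero_mem _, by rw [notMem_support_iff.1 hn, zero_mul, map_zero]⟩
  choose a ha ha' using h
  refine ⟨∑ n ∈ y.support, monomial n (a n), ?_, ?_⟩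
  · exact sum_mem fun n _ => monomial_mem_polySubgroup (ha n) n
  · rw [Polynomial.map_sum]
    conv_lhs => rw [y.as_sum_support, Finset.sum_mul]
    refine Finset.sum_congr rfl fun n _ => ?_
    rw [← C_pow, monomial_mul_C, map_monomial, ha']

namespace IsRingLocalization

variable {R Rs : Type*} [Ring R] [StarRing R] [Ring Rs] [StarRing Rs] {s : R} {φ : R →+* Rs}
  (hφ : IsRingLocalization s φ)
include hφ

theorem map_comm {c : R} (hc : c ∈ Subring.center R) (x : Rs) :
    φ c * x = x * φ c := by
  obtain ⟨r, k, hr⟩ := hφ.surj x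
  have h : ∀ r : R, ∀ d ∈ Subring.center R, φ d * φ r = φ r * φ d := fun r d hd => by
    rw [← map_mul, ← map_mul, Subring.mem_center_iff.1 hd]
  have hu : IsUnit (φ s ^ k) := hφ.isUnit.pow k
  refine hu.mul_left_injective ?_
  have h₁ : Commute (φ c) (φ s ^ k) := Commute.pow_right (h s c hc) k
  change φ c * x * φ s ^ k = x * φ c * φ s ^ k
  rw [mul_assoc, hr, h r c hc, ← hr, mul_assoc, mul_assoc, h₁.eq]

theorem locSubgroup_top (y : Rs) : y ∈ locSubgroup s φ (⊤ : AddSubgroup R) := by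
  obtain ⟨r, k, h⟩ := hφ.surj y
  exact AddSubgroup.subset_closure ⟨r, AddSubgroup.mem_top _, k, h⟩

theorem exists_pow_mul_eq_zero (hs : s ∈ Subring.center R) {p : R[X]} (hp : p.map φ = 0) :
    ∃ k : ℕ, C s ^ k * p = 0 := by
  have h : ∀ n, ∃ k : ℕ, p.coeff n * s ^ k = 0 := fun n =>
    hφ.exists_of_eq_zero _ (by rw [← coeff_map, hp, coeff_zero])
  choose k hk using h
  refine ⟨p.support.sup k, ?_⟩
  ext n
  rw [← C_pow, coeff_C_mul, coeff_zero, ← Subring.mem_center_iff.1 (pow_mem hs _)]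
  by_cases hn : n ∈ p.support
  · obtain ⟨d, hd⟩ := Nat.exists_eq_add_of_le (Finset.le_sup (f := k) hn)
    rw [hd, pow_add, ← mul_assoc, hk, zero_mul]
  · rw [notMem_support_iff.1 hn, zero_mul]

end IsRingLocalization

/-- The constant polynomial `φ s` as a unit. -/
def IsRingLocalization.polyUnit {R Rs : Type*} [Ring R] [StarRing R] [Ring Rs] [StarRing Rs]
    {s : R} {φ : R →+* Rs} (hφ : IsRingLocalization s φ) : Rs[X]ˣ :=
  Units.map (C : Rs →+* Rs[X]).toMonoidHom hφ.isUnit.unit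

/-! ### Levels of fractions over `Rs[X]` -/

section
variable {R Rs : Type*} [Ring R] [StarRing R] [Ring Rs] [StarRing Rs] {lam s : R}
  {Λ : AddSubgroup R} {J : Ideal R} [J.IsTwoSided] {φ : R →+* Rs}

theorem IsRingLocalization.val_polyUnit (hφ : IsRingLocalization s φ) :
    (hφ.polyUnit : Rs[X]) = C (φ s) := rfl

theorem isFormInverting_poly (hlam : lam ∈ Subring.center R) (hlam_one : lam * star lam = 1)
    (hΛ : IsFormParameter lam Λ) (hJ : ∀ a ∈ J, star a ∈ J) (hs : s ∈ formCenter Λ)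
    (hφ : IsRingLocalization s φ) :
    IsFormInverting (C lam) (polySubgroup Λ) (polySubgroup J.toAddSubgroup) (mapRingHom φ) (C s)
      hφ.polyUnit where
  form := hΛ.poly hlam
  unitary :=
    { comm := fun x => by
        ext n
        rw [coe_mapRingHom, map_C, coeff_C_mul, coeff_mul_C, hφ.map_comm hlam]
      mul_star := by
        rw [coe_mapRingHom, map_C, star_C, ← C_mul, ← hφ.map_star, ← map_mul, hlam_one, map_one,
          C_1] }
  map_star a := by
    ext n
    rw [coe_mapRingHom, coeff_map, coeff_star, coeff_star, coeff_map, hφ.map_star]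
  mul_mem_left := mul_mem_polySubgroup J
  mul_mem_right := mul_mem_polySubgroup_right J
  star_mem a ha n := by
    rw [coeff_star]
    exact hJ _ (ha n)
  mul_mem_form a ha n := by
    rw [coeff_C_mul]
    exact hs.2.2 _ (ha n)
  map_eq := by rw [coe_mapRingHom, map_C, hφ.val_polyUnit]
  comm x := by
    ext n
    rw [hφ.val_polyUnit, coeff_C_mul, coeff_mul_C, hφ.map_comm hs.1]
  star_eq := by rw [hφ.val_polyUnit, star_C, ← hφ.map_star, hs.2.1]

theorem IsRingLocalization.eq_mul_zpow (hφ : IsRingLocalization s φ) {y : Rs[X]} {a : R[X]} {k : ℕ}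
    (h : y * C (φ s) ^ k = a.map φ) :
    y = mapRingHom φ a * ((hφ.polyUnit ^ (-(k : ℤ)) : Rs[X]ˣ) : Rs[X]) := by
  rw [coe_mapRingHom, ← h, ← hφ.val_polyUnit, ← Units.val_pow_eq_pow_val, zpow_neg, zpow_natCast,
    Units.mul_inv_cancel_right]

theorem IsRingLocalization.exists_diag_mem (hφ : IsRingLocalization s φ) {T : AddSubgroup R}
    (hT : ∀ a ∈ T, s * a ∈ T) (hs : s ∈ Subring.center R) {x : Rs[X]}
    (hx : x ∈ polySubgroup (locSubgroup s φ T)) (J : AddSubgroup R[X]) :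
    ∃ p : ℤ, (x, x) ∈ pairFiltration (polySubgroup T) J (mapRingHom φ) hφ.polyUnit p := by
  obtain ⟨k, hk⟩ := exists_poly_of_mem_locSubgroup hT hs hx
  obtain ⟨a, ha, h⟩ := hk k le_rfl
  exact ⟨-k, mem_pairFiltration.2 ⟨a, a, ha, ha, by simp, by rw [← hφ.eq_mul_zpow h]⟩⟩

omit [StarRing R] in
theorem polySubgroup_top : polySubgroup (⊤ : AddSubgroup R) = ⊤ :=
  eq_top_iff.2 fun _ _ _ => AddSubgroup.mem_top _

omit [J.IsTwoSided] in
theorem IsRingLocalization.exists_zero_mem_ring (hφ : IsRingLocalization s φ)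
    (hs : s ∈ Subring.center R) {x : Rs[X]}
    (hx : x ∈ polySubgroup (locSubgroup s φ J.toAddSubgroup)) :
    ∃ p : ℤ, ((0, x) : Rs[X] × Rs[X]) ∈ pairFiltration ⊤ (polySubgroup J.toAddSubgroup)
      (mapRingHom φ) hφ.polyUnit p := by
  obtain ⟨k, hk⟩ := exists_poly_of_mem_locSubgroup (fun a ha => J.mul_mem_left s ha) hs hx
  obtain ⟨a, ha, h⟩ := hk k le_rfl
  refine ⟨-k, mem_pairFiltration.2 ⟨0, a, AddSubgroup.mem_top _, AddSubgroup.mem_top _, ?_, ?_⟩⟩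
  · rw [zero_sub]
    exact neg_mem ha
  · rw [← hφ.eq_mul_zpow h, map_zero, zero_mul]

/-- Two fraction representations are available, one with numerator in `J` and one with numerator in
`Λ`. They have to be merged into one whose numerator lies in both, which holds after multiplying by
a further power of `s`. This is the compatibility of localization with intersections. -/
theorem IsRingLocalization.exists_zero_mem_form (hφ : IsRingLocalization s φ)
    (hs : s ∈ formCenter Λ) {x : Rs[X]} (c : R[X])
    (hx : x ∈ polySubgroup (locSubgroup s φ J.toAddSubgroup))
    (hx' : mapRingHom φ c * x ∈ polySubgroup (locSubgroup s φ Λ)) :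
    ∃ p : ℤ, ((0, mapRingHom φ c * x) : Rs[X] × Rs[X]) ∈ pairFiltration (polySubgroup Λ)
      (polySubgroup J.toAddSubgroup) (mapRingHom φ) hφ.polyUnit p := by
  obtain ⟨k, hk⟩ := exists_poly_of_mem_locSubgroup (fun a ha => J.mul_mem_left s ha) hs.1 hx
  obtain ⟨k', hk'⟩ := exists_poly_of_mem_locSubgroup hs.2.2 hs.1 hx'
  obtain ⟨a, ha, h⟩ := hk (max k k') (le_max_left _ _)
  obtain ⟨b, hb, h'⟩ := hk' (max k k') (le_max_right _ _)
  -- Both numerators represent the same fraction over a common denominator, so their difference is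
  -- killed by a power of `s`, which need not be a non-zero-divisor.
  have e : (b - c * a).map φ = 0 := by
    rw [Polynomial.map_sub, Polynomial.map_mul, ← h, ← h', coe_mapRingHom, mul_assoc, sub_self]
  obtain ⟨d, hd⟩ := hφ.exists_pow_mul_eq_zero hs.1 e
  rw [mul_sub, sub_eq_zero] at hd
  have h'' : mapRingHom φ c * x * C (φ s) ^ (max k k' + d) = (C s ^ d * b).map φ := by
    rw [pow_add, ← mul_assoc, h', Polynomial.map_mul, Polynomial.map_pow, map_C]
    have : Commute (b.map φ) (C (φ s)) := by
      ext n
      rw [coeff_C_mul, coeff_mul_C, hφ.map_comm hs.1]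
    exact this.pow_right d
  refine ⟨-(max k k' + d : ℕ), mem_pairFiltration.2
    ⟨0, C s ^ d * b, zero_mem _, fun n => ?_, ?_, ?_⟩⟩
  · rw [← C_pow, coeff_C_mul]
    exact (pow_mem hs d).2.2 _ (hb n)
  · rw [zero_sub, hd]
    exact neg_mem (mul_mem_polySubgroup J _ _ (mul_mem_polySubgroup J _ _ ha))
  · rw [← hφ.eq_mul_zpow h'', map_zero, zero_mul]

end

/-- The elementary matrices are root matrices. -/
theorem EQRoot.exists_mat_eq {B : Type*} [Ring B] [StarRing B] {lam : B} {Λ : AddSubgroup B}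
    (hΛ : ∀ a ∈ Λ, a = -(lam * star a)) {m : ℕ} (η : EQRoot m) {a : B} (ha : η.Allowed Λ a) :
    ∃ i j : Fin m ⊕ Fin m, ∃ hij : i ≠ j, η.mat lam a = (rootUnit lam i j hij a).val ∧
      (j = i.swap → idxSign lam j * a ∈ Λ) := by
  cases η with
  | eps i j =>
    have hij : i ≠ j := ha
    refine ⟨Sum.inl i, Sum.inl j, by simpa using hij, ?_, by simp⟩
    simp [mat, rootUnit, rootNil, idxCoeff, idxSign, add_sub_assoc]
  | r i j =>
    refine ⟨Sum.inl i, Sum.inr j, by simp, ?_, ?_⟩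
    · by_cases hij : i = j
      · subst hij
        simp [mat, rootUnit, rootNil]
      · simp [mat, rootUnit, rootNil, idxCoeff, idxSign, add_sub_assoc, hij, Ne.symm hij]
    · intro h
      have hij : j = i := by simpa using h
      -- The generator `qr i i` is allowed when `star a ∈ Λ`. Antisymmetry gives `star a = -(lam *
      -- a)`, which is the normalization used for long root parameters.
      have h := ha hij.symm
      have e := hΛ _ h
      rw [star_star] at e
      rw [e] at h
      simpa [idxSign] using h
  | l i j =>
    refine ⟨Sum.inr i, Sum.inl j, by simp, ?_, ?_⟩
    · by_cases hij : i = j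
      · subst hij
        simp [mat, rootUnit, rootNil]
      · simp [mat, rootUnit, rootNil, idxCoeff, idxSign, add_sub_assoc, hij, Ne.symm hij]
    · intro h
      have hij : j = i := by simpa using h
      simpa [idxSign] using ha hij.symm

/-! ### From the relative elementary group to the elementary group of the double -/

section
variable {R Rs : Type*} [Ring R] [StarRing R] [Ring Rs] [StarRing Rs] {lam s : R}
  {Λ : AddSubgroup R} {J : Ideal R} [J.IsTwoSided] {φ : R →+* Rs}

theorem idxSign_pair {B : Type*} [Ring B] {m : ℕ} (lam x y : B) (i : Fin m ⊕ Fin m) :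
    idxSign (lam, lam) i * (x, y) = (idxSign lam i * x, idxSign lam i * y) := by
  cases i <;> simp [idxSign]

/-- An element `g` of the relative elementary group gives the element `(1, g)` of the elementary
group of the double. -/
theorem exists_pair_of_mem_EQRel (hΛ : IsFormParameter lam Λ) (hs : s ∈ formCenter Λ)
    (hφ : IsRingLocalization s φ) {m : ℕ}
    {M : (Matrix (Fin m ⊕ Fin m) (Fin m ⊕ Fin m) Rs[X])ˣ}
    (hM : M ∈ EQRel (C (φ lam)) (polySubgroup (locSubgroup s φ Λ))
      (polySubgroup (locSubgroup s φ J.toAddSubgroup)) m) :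
    ∃ g ∈ rootGroupTop ((mapRingHom φ (C lam), mapRingHom φ (C lam)) : Rs[X] × Rs[X])
        (pairFiltration ⊤ (polySubgroup J.toAddSubgroup) (mapRingHom φ) hφ.polyUnit)
        (pairFiltration (polySubgroup Λ) (polySubgroup J.toAddSubgroup) (mapRingHom φ)
          hφ.polyUnit) m,
      mapGL (RingHom.fst _ _) g = 1 ∧ mapGL (RingHom.snd _ _) g = M := by
  -- Antisymmetry of `Λ_s` follows from that of `Λ` after clearing a denominator, which is central,
  -- self-adjoint and invertible in `Rs`.
  have hΛs : ∀ a ∈ polySubgroup (locSubgroup s φ Λ), a = -(C (φ lam) * star a) := by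
    intro a ha
    ext n
    rw [coeff_neg, coeff_C_mul, coeff_star]
    obtain ⟨k, hk⟩ := exists_of_mem_locSubgroup hs.2.2 hs.1 (ha n)
    obtain ⟨b, hb, h⟩ := hk k le_rfl
    refine (hφ.isUnit.pow k).mul_left_injective ?_
    change _ * _ = _ * _
    have e := congrArg star h
    rw [star_mul, star_pow, ← hφ.map_star, hs.2.1, ← hφ.map_star, ← map_pow,
      hφ.map_comm (pow_mem hs.1 k), map_pow] at e
    rw [neg_mul, mul_assoc, h, e, ← map_mul, ← map_neg, ← hΛ.le_max b hb]
  induction hM using Subgroup.closure_induction with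
  | mem M hM =>
    obtain ⟨η, x, a, u, v, hx, ha, haJ, hu, hv, rfl⟩ := hM
    obtain ⟨i, j, hij, e, hl⟩ := η.exists_mat_eq hΛs hx
    obtain ⟨i', j', hij', e', hl'⟩ := η.opp.exists_mat_eq hΛs ha
    have hu' : u = rootUnit (C (φ lam)) i j hij x := Units.ext (hu.trans e)
    have hv' : v = rootUnit (C (φ lam)) i' j' hij' a := Units.ext (hv.trans e')
    have hfst : ∀ x : Rs[X] × Rs[X], RingHom.fst Rs[X] Rs[X] (star x) =
      star (RingHom.fst Rs[X] Rs[X] x) := fun _ => rfl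
    have hsnd : ∀ x : Rs[X] × Rs[X], RingHom.snd Rs[X] Rs[X] (star x) =
      star (RingHom.snd Rs[X] Rs[X] x) := fun _ => rfl
    have hC : mapRingHom φ (C lam) = C (φ lam) := by simp
    have h₁ : ∃ p, (x, x) ∈ rootParam (mapRingHom φ (C lam), mapRingHom φ (C lam))
        (pairFiltration ⊤ (polySubgroup J.toAddSubgroup) (mapRingHom φ) hφ.polyUnit)
        (pairFiltration (polySubgroup Λ) (polySubgroup J.toAddSubgroup) (mapRingHom φ)
          hφ.polyUnit) i j p := by
      simp only [rootParam, Set.mem_ofPred_eq]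
      split_ifs with h
      · rw [hC]
        simp only [idxSign_pair]
        exact hφ.exists_diag_mem hs.2.2 hs.1 (hl h) _
      · rw [← polySubgroup_top]
        exact hφ.exists_diag_mem (fun _ _ => AddSubgroup.mem_top _) hs.1
          (fun n => hφ.locSubgroup_top _) _
    have h₂ : ∃ p, (0, a) ∈ rootParam (mapRingHom φ (C lam), mapRingHom φ (C lam))
        (pairFiltration ⊤ (polySubgroup J.toAddSubgroup) (mapRingHom φ) hφ.polyUnit)
        (pairFiltration (polySubgroup Λ) (polySubgroup J.toAddSubgroup) (mapRingHom φ)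
          hφ.polyUnit) i' j' p := by
      simp only [rootParam, Set.mem_ofPred_eq]
      split_ifs with h
      · simp only [idxSign_pair, mul_zero]
        rw [← map_idxSign]
        refine hφ.exists_zero_mem_form hs _ haJ ?_
        rw [map_idxSign, hC]
        exact hl' h
      · exact hφ.exists_zero_mem_ring hs.1 haJ
    obtain ⟨p, hp⟩ := h₁
    obtain ⟨q, hq⟩ := h₂
    have g₁ := Subgroup.subset_closure (k := {g | ∃ i j, ∃ hij : i ≠ j, ∃ p, ∃ a ∈ rootParam
        ((mapRingHom φ (C lam), mapRingHom φ (C lam)) : Rs[X] × Rs[X]) _ _ i j p,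
        g = rootUnit (mapRingHom φ (C lam), mapRingHom φ (C lam)) i j hij a})
      ⟨i, j, hij, p, _, hp, rfl⟩
    have g₂ := Subgroup.subset_closure (k := {g | ∃ i j, ∃ hij : i ≠ j, ∃ p, ∃ a ∈ rootParam
        ((mapRingHom φ (C lam), mapRingHom φ (C lam)) : Rs[X] × Rs[X]) _ _ i j p,
        g = rootUnit (mapRingHom φ (C lam), mapRingHom φ (C lam)) i j hij a})
      ⟨i', j', hij', q, _, hq, rfl⟩
    -- The conjugating matrix is taken diagonally and the relative one in the second component only,
    -- so the first component collapses to `1`. The pair `(0, a)` is admissible because `a` has a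
    -- numerator in `J`.
    refine ⟨_, mul_mem (mul_mem g₁ g₂) (inv_mem g₁), ?_, ?_⟩
    · rw [map_mul, map_mul, map_inv, mapGL_rootUnit _ hfst, mapGL_rootUnit _ hfst]
      simp [rootUnit_zero]
    · rw [map_mul, map_mul, map_inv, mapGL_rootUnit _ hsnd, mapGL_rootUnit _ hsnd, hu', hv']
      simp
  | one => exact ⟨1, one_mem _, map_one _, map_one _⟩
  | mul x y _ _ hx hy =>
    obtain ⟨g, hg, h₁, h₂⟩ := hx
    obtain ⟨g', hg', h₁', h₂'⟩ := hy
    exact ⟨g * g', mul_mem hg hg', by rw [map_mul, h₁, h₁', one_mul], by rw [map_mul, h₂, h₂']⟩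
  | inv x _ hx =>
    obtain ⟨g, hg, h₁, h₂⟩ := hx
    exact ⟨g⁻¹, inv_mem hg, by rw [map_inv, h₁, inv_one], by rw [map_inv, h₂]⟩

end

/-! ### Substitution of `b X` for `X` -/

/-- The substitution `X ↦ b X`, for central `b`, as a ring homomorphism. -/
def substHom {R : Type*} [Ring R] (b : R) (hb : b ∈ Subring.center R) : R[X] →+* R[X] :=
  eval₂RingHom' C (C b * X) fun a => by
    change C a * (C b * X) = C b * X * C a
    rw [← mul_assoc, ← C_mul, Subring.mem_center_iff.1 hb, C_mul, mul_assoc, mul_assoc, X_mul]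

theorem substHom_apply {R : Type*} [Ring R] (b : R) (hb : b ∈ Subring.center R) (p : R[X]) :
    substHom b hb p = p.comp (C b * X) := rfl

theorem coeff_substHom {R : Type*} [Ring R] (b : R) (hb : b ∈ Subring.center R) (p : R[X]) (n : ℕ) :
    (substHom b hb p).coeff n = p.coeff n * b ^ n := by
  rw [substHom_apply, comp_C_mul_X_coeff]

/-- Both sides are evaluation at `X = 0`. The hypothesis `b = 0`, in place of a literal `0`, lets
the lemma apply to `φ 0`. -/
theorem substHom_comp_eq_left {R : Type*} [Ring R] {b c : R} (hb : b ∈ Subring.center R)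
    (hc : c ∈ Subring.center R) (hb₀ : b = 0) :
    (substHom b hb).comp (substHom c hc) = substHom b hb := by
  refine RingHom.ext fun p => Polynomial.ext fun n => ?_
  rw [RingHom.comp_apply, coeff_substHom, coeff_substHom, coeff_substHom, hb₀]
  rcases n with _ | n
  · rw [pow_zero, pow_zero, mul_one, mul_one]
  · rw [zero_pow n.succ_ne_zero, mul_zero, mul_zero]

theorem substHom_C {R : Type*} [Ring R] (b : R) (hb : b ∈ Subring.center R) (a : R) :
    substHom b hb (C a) = C a := by
  rw [substHom_apply, C_comp]

theorem substHom_star {R : Type*} [Ring R] [StarRing R] (b : R) (hb : b ∈ Subring.center R)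
    (hb' : star b = b) (p : R[X]) : substHom b hb (star p) = star (substHom b hb p) := by
  ext n
  rw [coeff_substHom, coeff_star, coeff_star, coeff_substHom, star_mul, star_pow, hb',
    Subring.mem_center_iff.1 (pow_mem hb n)]

theorem substHom_mapRingHom {R Rs : Type*} [Ring R] [Ring Rs] (φ : R →+* Rs) (b : R)
    (hb : b ∈ Subring.center R) (hb' : φ b ∈ Subring.center Rs) (p : R[X]) :
    substHom (φ b) hb' (mapRingHom φ p) = mapRingHom φ (substHom b hb p) := by
  ext n
  rw [coeff_substHom, coe_mapRingHom, coeff_map, coeff_map, coeff_substHom, map_mul, map_pow]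

theorem substHom_mem {R : Type*} [Ring R] {T : AddSubgroup R} {b : R} (hb : b ∈ Subring.center R)
    (hT : ∀ n : ℕ, ∀ a ∈ T, b ^ n * a ∈ T) {p : R[X]} (hp : p ∈ polySubgroup T) :
    substHom b hb p ∈ polySubgroup T := fun n => by
  rw [coeff_substHom, Subring.mem_center_iff.1 (pow_mem hb n)]
  exact hT n _ (hp n)

/-- The difference quotient `(p (d c X) - p 0) / d`. -/
def substQuotient {R : Type*} [Ring R] (b c : R) (hb : b ∈ Subring.center R) : R[X] →+ R[X] :=
  ((AddMonoidHom.mulLeft (C c * X)).comp (substHom b hb).toAddMonoidHom).comp divX_hom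

theorem substQuotient_apply {R : Type*} [Ring R] (b c : R) (hb : b ∈ Subring.center R) (p : R[X]) :
    substQuotient b c hb p = C c * X * substHom b hb p.divX := rfl

theorem substQuotient_mem {R : Type*} [Ring R] {T : AddSubgroup R} {b c : R}
    (hb : b ∈ Subring.center R) (hT : ∀ n : ℕ, ∀ a ∈ T, b ^ n * a ∈ T)
    (hT' : ∀ a ∈ T, c * a ∈ T) {p : R[X]} (hp : p ∈ polySubgroup T) :
    substQuotient b c hb p ∈ polySubgroup T := by
  rw [substQuotient_apply]
  have h : substHom b hb p.divX ∈ polySubgroup T :=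
    substHom_mem hb hT fun n => by rw [coeff_divX]; exact hp _
  intro n
  rw [mul_assoc, coeff_C_mul]
  refine hT' _ ?_
  cases n with
  | zero => simp
  | succ n => rw [coeff_X_mul]; exact h n

/-- Writing `p = X * p.divX + p(0)`, the constant term cancels and the remaining factor `b * X`
contributes `d`. This explicit divisibility is the source of the convergence of `X ↦ b X` to `X ↦
0`. -/
theorem substHom_sub_substHom_zero {R : Type*} [Ring R] {b c d : R} (hb : b ∈ Subring.center R)
    (h : b = d * c) (p : R[X]) :
    substHom b hb p - substHom 0 (zero_mem _) p = C d * substQuotient b c hb p := by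
  conv_lhs => rw [← divX_mul_X_add p]
  rw [map_add, map_add, substHom_C, substHom_C, add_sub_add_right_eq_sub, map_mul, map_mul,
    substQuotient_apply]
  have h₁ : substHom b hb X = C b * X := by rw [substHom_apply, X_comp]
  have h₂ : substHom (0 : R) (zero_mem _) X = 0 := by rw [substHom_apply, X_comp, C_0, zero_mul]
  have h₃ : ∀ y : R[X], y * C b = C b * y := fun y => by
    ext n
    rw [coeff_C_mul, coeff_mul_C, Subring.mem_center_iff.1 hb]
  rw [h₁, h₂, mul_zero, sub_zero, ← mul_assoc, h₃, ← mul_assoc, ← mul_assoc, ← C_mul, ← h,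
    mul_assoc, mul_assoc, X_mul]

section
variable {R Rs : Type*} [Ring R] [StarRing R] [Ring Rs] [StarRing Rs] {lam s : R}
  {Λ : AddSubgroup R} {J : Ideal R} [J.IsTwoSided] {φ : R →+* Rs}

theorem IsRingLocalization.map_mem_center (hφ : IsRingLocalization s φ) {c : R}
    (hc : c ∈ Subring.center R) : φ c ∈ Subring.center Rs :=
  Subring.mem_center_iff.2 fun x => (hφ.map_comm hc x).symm

theorem IsRingLocalization.substHom_zpow (hφ : IsRingLocalization s φ) (b : Rs)
    (hb : b ∈ Subring.center Rs) (p : ℤ) :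
    substHom b hb ((hφ.polyUnit ^ p : Rs[X]ˣ) : Rs[X]) = ((hφ.polyUnit ^ p : Rs[X]ˣ) : Rs[X]) := by
  have h : Units.map (substHom b hb).toMonoidHom hφ.polyUnit = hφ.polyUnit :=
    Units.ext (substHom_C b hb _)
  have h' : Units.map (substHom b hb).toMonoidHom (hφ.polyUnit ^ p) = hφ.polyUnit ^ p := by
    rw [map_zpow, h]
  exact congrArg Units.val h'

omit [J.IsTwoSided] in
theorem substHom_pair_mem (hφ : IsRingLocalization s φ) {T : AddSubgroup R} {b : R}
    (hb : b ∈ Subring.center R) (hT : ∀ n : ℕ, ∀ a ∈ T, b ^ n * a ∈ T) {p : ℤ} {x : Rs[X] × Rs[X]}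
    (hx : x ∈ pairFiltration (polySubgroup T) (polySubgroup J.toAddSubgroup) (mapRingHom φ)
      hφ.polyUnit p) :
    ((substHom (φ b) (hφ.map_mem_center hb)).prodMap (substHom (φ b) (hφ.map_mem_center hb))) x ∈
      pairFiltration (polySubgroup T) (polySubgroup J.toAddSubgroup) (mapRingHom φ)
        hφ.polyUnit p := by
  obtain ⟨r, r', h₁, h₂, h₃, rfl⟩ := mem_pairFiltration.1 hx
  refine mem_pairFiltration.2 ⟨substHom b hb r, substHom b hb r', substHom_mem hb hT h₁,
    substHom_mem hb hT h₂, ?_, ?_⟩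
  · rw [← map_sub]
    exact substHom_mem hb (fun n a ha => J.mul_mem_left _ ha) h₃
  · refine Prod.ext ?_ ?_ <;>
    · change substHom (φ b) (hφ.map_mem_center hb) (_ * _) = _
      rw [map_mul, hφ.substHom_zpow, substHom_mapRingHom _ _ hb]

/-- The factor `s ^ l` split off from `p(bX) - p(0)` raises the level from `p` to `p + l`, whatever
the numerator. The bound on `l` therefore depends only on the two levels, which is the uniformity
that `exists_dilation` asks for. -/
theorem exists_substHom_pair_sub_mem (hlam : lam ∈ Subring.center R)
    (hlam_one : lam * star lam = 1) (hΛ : IsFormParameter lam Λ) (hJ : ∀ a ∈ J, star a ∈ J)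
    (hs : s ∈ formCenter Λ) (hφ : IsRingLocalization s φ) {T : AddSubgroup R}
    (hT : ∀ b ∈ formCenter Λ, ∀ a ∈ T, b * a ∈ T) (p q : ℤ) :
    ∃ l : ℕ, ∀ (b : R) (hb : b ∈ Subring.center R), (∃ c ∈ formCenter Λ, b = s ^ l * c) →
      ∀ x ∈ pairFiltration (polySubgroup T) (polySubgroup J.toAddSubgroup) (mapRingHom φ)
        hφ.polyUnit p,
      ((substHom (φ b) (hφ.map_mem_center hb)).prodMap (substHom (φ b) (hφ.map_mem_center hb))) x -
      ((substHom 0 (zero_mem _)).prodMap (substHom 0 (zero_mem _))) x ∈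
        pairFiltration (polySubgroup T) (polySubgroup J.toAddSubgroup) (mapRingHom φ)
        hφ.polyUnit q := by
  have F := isFormInverting_poly (J := J) hlam hlam_one hΛ hJ hs hφ
  refine ⟨(q - p).toNat, ?_⟩
  rintro b hb ⟨c, hc, h⟩ x hx
  obtain ⟨r, r', h₁, h₂, h₃, rfl⟩ := mem_pairFiltration.1 hx
  have hbc : b ∈ formCenter Λ := h ▸ mul_mem (pow_mem hs _) hc
  have hTp : ∀ n : ℕ, ∀ a ∈ T, b ^ n * a ∈ T := fun n => hT _ (pow_mem hbc n)
  have hle : q ≤ p + (q - p).toNat := by omega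
  refine F.antitone ?_ hle
    (mem_pairFiltration.2 ⟨substQuotient b c hb r, substQuotient b c hb r',
      substQuotient_mem hb hTp (hT c hc) h₁, substQuotient_mem hb hTp (hT c hc) h₂, ?_, ?_⟩)
  · intro k a ha n
    rw [← C_pow, coeff_C_mul]
    exact hT _ (pow_mem hs k) _ (ha n)
  · rw [← map_sub]
    exact substQuotient_mem hb (fun n a ha => J.mul_mem_left _ ha)
      (fun a ha => J.mul_mem_left _ ha) h₃
  · have key : ∀ r : R[X], substHom (φ b) (hφ.map_mem_center hb) (mapRingHom φ r *
        ((hφ.polyUnit ^ p : Rs[X]ˣ) : Rs[X])) - substHom 0 (zero_mem _) (mapRingHom φ r *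
        ((hφ.polyUnit ^ p : Rs[X]ˣ) : Rs[X])) = mapRingHom φ (substQuotient b c hb r) *
        ((hφ.polyUnit ^ (p + (q - p).toNat) : Rs[X]ˣ) : Rs[X]) := by
      intro r
      have h₀ : substHom (0 : Rs) (zero_mem _) (mapRingHom φ r) =
          mapRingHom φ (substHom 0 (zero_mem _) r) := by
        have := substHom_mapRingHom φ 0 (zero_mem _) (by rw [map_zero]; exact zero_mem _) r
        simpa only [map_zero] using this
      rw [map_mul, map_mul, hφ.substHom_zpow, hφ.substHom_zpow, ← F.map_pow, ← C_pow,
        ← substHom_sub_substHom_zero hb h, substHom_mapRingHom φ b hb, h₀, ← sub_mul, ← map_sub]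
    exact Prod.ext (key r) (key r')

end

/-! ### Transvections -/

namespace SesquilinearForm

variable {A V : Type*} [Ring A] [StarRing A] [AddCommGroup V] [Module Aᵐᵒᵖ V] {lam : A}
  (f : SesquilinearForm A V)

theorem toFun_zero_left (y : V) : f.toFun 0 y = 0 := by
  simpa using f.add_left 0 0 y

theorem toFun_zero_right (x : V) : f.toFun x 0 = 0 := by
  simpa using f.add_right x 0 0

theorem toFun_neg_left (x y : V) : f.toFun (-x) y = -f.toFun x y := by
  rw [eq_neg_iff_add_eq_zero, ← f.add_left, neg_add_cancel, toFun_zero_left]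

theorem toFun_neg_right (x y : V) : f.toFun x (-y) = -f.toFun x y := by
  rw [eq_neg_iff_add_eq_zero, ← f.add_right, neg_add_cancel, toFun_zero_right]

theorem toFun_smul_right (x y : V) (r : A) : f.toFun x (op r • y) = f.toFun x y * r := by
  simpa using f.smul_smul x y 1 r

theorem toFun_smul_left (x y : V) (r : A) : f.toFun (op r • x) y = star r * f.toFun x y := by
  simpa using f.smul_smul x y r 1

variable (lam)

theorem herm_add_right (x y z : V) : f.herm lam x (y + z) = f.herm lam x y + f.herm lam x z := by
  simp only [herm, f.add_right, f.add_left, star_add, mul_add]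
  abel

theorem herm_add_left (x y z : V) : f.herm lam (x + y) z = f.herm lam x z + f.herm lam y z := by
  simp only [herm, f.add_right, f.add_left, star_add, mul_add]
  abel

theorem herm_neg_right (x y : V) : f.herm lam x (-y) = -f.herm lam x y := by
  simp only [herm, f.toFun_neg_left, f.toFun_neg_right, star_neg, mul_neg, neg_add]

theorem herm_neg_left (x y : V) : f.herm lam (-x) y = -f.herm lam x y := by
  simp only [herm, f.toFun_neg_left, f.toFun_neg_right, star_neg, mul_neg, neg_add]

theorem herm_sub_right (x y z : V) : f.herm lam x (y - z) = f.herm lam x y - f.herm lam x z := by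
  rw [sub_eq_add_neg, herm_add_right, herm_neg_right, ← sub_eq_add_neg]

theorem herm_zero_right (x : V) : f.herm lam x 0 = 0 := by
  simp [herm, toFun_zero_left, toFun_zero_right]

theorem herm_zero_left (x : V) : f.herm lam 0 x = 0 := by
  simp [herm, toFun_zero_left, toFun_zero_right]

theorem herm_smul_right (x y : V) (r : A) : f.herm lam x (op r • y) = f.herm lam x y * r := by
  simp only [herm, f.toFun_smul_right, f.toFun_smul_left, star_mul, star_star, add_mul, mul_assoc]

end SesquilinearForm

section
open SesquilinearForm
variable {A V : Type*} [Ring A] [StarRing A] [AddCommGroup V] [Module Aᵐᵒᵖ V] (lam : A)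
  (f : SesquilinearForm A V) {u v v' : V}

/-- Along a common isotropic vector `u` orthogonal to `v` and `v'` the transvections multiply like a
Heisenberg group: the parameters add, with the cocycle `h(v, v')`. The outer transvection sees the
same `h(u, x)` before and after the inner one. -/
theorem transvection_transvection (huu : f.herm lam u u = 0) (hvu : f.herm lam v u = 0)
    (huv' : f.herm lam u v' = 0) (a a' : A) (x : V) (hc : ∀ x, star lam * x = x * star lam) :
    transvection lam f u v a (transvection lam f u v' a' x) =
      transvection lam f u (v + v') (a + a' + f.herm lam v v') x := by
  have h₁ : f.herm lam u (transvection lam f u v' a' x) = f.herm lam u x := by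
    simp only [transvection, herm_sub_right, herm_add_right, herm_smul_right, huu, huv', zero_mul,
      sub_zero, add_zero]
  have h₂ : f.herm lam v (transvection lam f u v' a' x) = f.herm lam v x -
      star lam * f.herm lam v v' * f.herm lam u x := by
    simp only [transvection, herm_sub_right, herm_add_right, herm_smul_right, hvu, zero_mul,
      sub_zero, add_zero]
    rw [← mul_assoc, ← hc]
  rw [transvection, h₁, h₂]
  simp only [transvection, herm_add_left, op_add, op_sub, add_smul, sub_smul, smul_add, mul_add,
    add_mul]
  abel

theorem transvection_add (a : A) (x y : V) :
    transvection lam f u v a (x + y) = transvection lam f u v a x + transvection lam f u v a y := by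
  simp only [transvection, herm_add_right, mul_add, op_add, add_smul]
  abel

theorem transvection_smul (a : A) (x : V) (r : A) :
    transvection lam f u v a (op r • x) = op r • transvection lam f u v a x := by
  simp only [transvection, herm_smul_right, smul_sub, smul_add, _root_.smul_smul, ← op_mul,
    mul_assoc]

theorem transvection_zero (x : V) : transvection lam f u 0 0 x = x := by
  simp [transvection, herm_zero_left]

/-- Homomorphisms of Hermitian modules take transvections to transvections. -/
theorem map_transvection {A' V' : Type*} [Ring A'] [StarRing A'] [AddCommGroup V']
    [Module A'ᵐᵒᵖ V'] (f' : SesquilinearForm A' V') (κ : A →+* A') (ρ : V →+ V')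
    (hκ : ∀ a, κ (star a) = star (κ a)) (hρ : ∀ (a : A) (x : V), ρ (op a • x) = op (κ a) • ρ x)
    (hh : ∀ x y, f'.herm (κ lam) (ρ x) (ρ y) = κ (f.herm lam x y)) (u v : V) (a : A) (x : V) :
    ρ (transvection lam f u v a x) = transvection (κ lam) f' (ρ u) (ρ v) (κ a) (ρ x) := by
  simp only [transvection, map_sub, map_add, hρ, map_mul, hκ, hh]

end

/-! ### Transvections along the hyperbolic plane, and the relative group -/

section
open SesquilinearForm
variable {A P : Type*} [Ring A] [StarRing A] [AddCommGroup P] [Module Aᵐᵒᵖ P] {lam : A}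
  (H : IsCentralUnitary lam) (f : SesquilinearForm A P)

/-- One of the two basis vectors of the hyperbolic plane in `P ⊥ ℍ(A)`. -/
def IsPlaneVector (u : P × A × A) : Prop := u = (0, 0, 1) ∨ u = (0, 1, 0)

theorem IsPlaneVector.herm_self {u : P × A × A} (hu : IsPlaneVector u) :
    f.perpHyperbolic.herm lam u u = 0 := by
  rcases hu with rfl | rfl <;> simp [herm, perpHyperbolic, toFun_zero_left]

theorem IsPlaneVector.herm_left {u : P × A × A} (hu : IsPlaneVector u) (q : P) :
    f.perpHyperbolic.herm lam u (q, 0, 0) = 0 := by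
  rcases hu with rfl | rfl <;> simp [herm, perpHyperbolic, toFun_zero_left, toFun_zero_right]

theorem IsPlaneVector.herm_right {u : P × A × A} (hu : IsPlaneVector u) (q : P) :
    f.perpHyperbolic.herm lam (q, 0, 0) u = 0 := by
  rcases hu with rfl | rfl <;> simp [herm, perpHyperbolic, toFun_zero_left, toFun_zero_right]

theorem herm_perpHyperbolic_left (q q' : P) :
    f.perpHyperbolic.herm lam (q, 0, 0) (q', 0, 0) = f.herm lam q q' := by
  simp [herm, perpHyperbolic]

include H in
theorem planeTransvection_comp {u : P × A × A} (hu : IsPlaneVector u) (q q' : P) (a a' : A)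
    (x : P × A × A) :
    transvection lam f.perpHyperbolic u (q, 0, 0) a
        (transvection lam f.perpHyperbolic u (q', 0, 0) a' x) =
      transvection lam f.perpHyperbolic u (q + q', 0, 0) (a + a' + f.herm lam q q') x := by
  rw [transvection_transvection lam _ (hu.herm_self f) (hu.herm_right f q) (hu.herm_left f q') _ _ _
    H.star_comm, herm_perpHyperbolic_left]
  simp

/-- The transvection of `P ⊥ ℍ(A)` along a basis vector of the plane, as a linear equivalence. -/
def planeTransvection (u : P × A × A) (hu : IsPlaneVector u) (q : P) (a : A) :
    (P × A × A) ≃ₗ[Aᵐᵒᵖ] (P × A × A) where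
  toFun := transvection lam f.perpHyperbolic u (q, 0, 0) a
  map_add' := transvection_add lam _ a
  map_smul' r x := transvection_smul lam _ a x (unop r)
  invFun := transvection lam f.perpHyperbolic u (-q, 0, 0) (f.herm lam q q - a)
  left_inv x := by
    rw [planeTransvection_comp H f hu, herm_neg_left, neg_add_cancel, sub_add_cancel,
      add_neg_cancel]
    exact transvection_zero lam _ x
  right_inv x := by
    rw [planeTransvection_comp H f hu, herm_neg_right, add_neg_cancel, add_sub_cancel,
      add_neg_cancel]
    exact transvection_zero lam _ x

theorem planeTransvection_apply {u : P × A × A} (hu : IsPlaneVector u) (q : P) (a : A)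
    (x : P × A × A) : planeTransvection H f u hu q a x =
      transvection lam f.perpHyperbolic u (q, 0, 0) a x := rfl

theorem planeTransvection_mul {u : P × A × A} (hu : IsPlaneVector u) (q q' : P) (a a' : A) :
    planeTransvection H f u hu q a * planeTransvection H f u hu q' a' =
      planeTransvection H f u hu (q + q') (a + a' + f.herm lam q q') :=
  LinearEquiv.ext fun x => planeTransvection_comp H f hu q q' a a' x

theorem planeTransvection_inv_mul {u : P × A × A} (hu : IsPlaneVector u) (q q' : P) (a a' : A) :
    (planeTransvection H f u hu q a)⁻¹ * planeTransvection H f u hu q' a' =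
      planeTransvection H f u hu (q' - q) (a' - a - f.herm lam q (q' - q)) := by
  rw [inv_mul_eq_iff_eq_mul, planeTransvection_mul]
  congr 1
  · abel
  · abel

theorem isElementaryTransvection_planeTransvection {Λ : AddSubgroup A} {u : P × A × A}
    (hu : IsPlaneVector u) {q : P} {a : A} (ha : f.toFun q q - a ∈ Λ) :
    IsElementaryTransvection lam Λ f q a (planeTransvection H f u hu q a) := by
  refine ⟨ha, ?_⟩
  rcases hu with rfl | rfl
  · exact Or.inl fun x => rfl
  · exact Or.inr fun x => rfl

theorem exists_eq_planeTransvection {Λ : AddSubgroup A} {q : P} {a : A}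
    {τ : (P × A × A) ≃ₗ[Aᵐᵒᵖ] (P × A × A)} (h : IsElementaryTransvection lam Λ f q a τ) :
    ∃ u, ∃ hu : IsPlaneVector u, τ = planeTransvection H f u hu q a := by
  rcases h.2 with h | h
  · exact ⟨_, Or.inl rfl, LinearEquiv.ext h⟩
  · exact ⟨_, Or.inr rfl, LinearEquiv.ext h⟩

theorem planeTransvection_mem_ET {Λ : AddSubgroup A} {u : P × A × A}
    (hu : IsPlaneVector u) {q : P} {a : A} (ha : f.toFun q q - a ∈ Λ) :
    planeTransvection H f u hu q a ∈ ET lam Λ f :=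
  Subgroup.subset_closure ⟨q, a, isElementaryTransvection_planeTransvection H f hu ha⟩

theorem ETIdeal_le_ETRel {Λ J : AddSubgroup A} : ETIdeal lam Λ J f ≤ ETRel lam Λ J f :=
  fun t ht => Subgroup.subset_closure ⟨1, one_mem _, t, ht, by simp⟩

/-- Normality in `ET` makes congruence of two elements modulo `ETRel` compatible with products and
inverses. -/
theorem conj_mem_ETRel {Λ J : AddSubgroup A} {g t : (P × A × A) ≃ₗ[Aᵐᵒᵖ] (P × A × A)}
    (hg : g ∈ ET lam Λ f) (ht : t ∈ ETRel lam Λ J f) : g * t * g⁻¹ ∈ ETRel lam Λ J f := by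
  have : ETRel lam Λ J f ≤ (ETRel lam Λ J f).comap (MulAut.conj g).toMonoidHom := by
    refine (Subgroup.closure_le _).2 ?_
    rintro τ ⟨g', hg', t, ht, rfl⟩
    refine Subgroup.subset_closure ⟨g * g', mul_mem hg hg', t, ht, ?_⟩
    simp [mul_assoc]
  exact this ht

theorem herm_mem_of_mem_idealSMul {J : AddSubgroup A} (hJ : ∀ r, ∀ a ∈ J, r * a ∈ J)
    (hJ' : ∀ r, ∀ a ∈ J, a * r ∈ J) (p : P) {q : P} (hq : q ∈ idealSMul J P) :
    f.herm lam p q ∈ J := by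
  induction hq using Submodule.span_induction with
  | mem q hq =>
    obtain ⟨x, a, ha, rfl⟩ := hq
    rw [herm_smul_right]
    exact hJ _ _ ha
  | zero =>
    rw [herm_zero_right]
    exact zero_mem _
  | add x y _ _ hx hy =>
    rw [herm_add_right]
    exact add_mem hx hy
  | smul r x _ hx =>
    have := f.herm_smul_right lam p x (unop r)
    rw [op_unop] at this
    rw [this]
    exact hJ' _ _ hx

/-- Two transvections with parameters congruent modulo `J` differ by a relative transvection. -/
theorem planeTransvection_inv_mul_mem_ETRel {Λ J : AddSubgroup A} (hΛ : IsFormParameter lam Λ)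
    (hJ : ∀ r, ∀ a ∈ J, r * a ∈ J) (hJ' : ∀ r, ∀ a ∈ J, a * r ∈ J) {u : P × A × A}
    (hu : IsPlaneVector u) {q q' : P} {a a' : A} (ha : f.toFun q q - a ∈ Λ)
    (ha' : f.toFun q' q' - a' ∈ Λ) (hq : q' - q ∈ idealSMul J P) (haa : a' - a ∈ J) :
    (planeTransvection H f u hu q a)⁻¹ * planeTransvection H f u hu q' a' ∈ ETRel lam Λ J f := by
  rw [planeTransvection_inv_mul]
  refine ETIdeal_le_ETRel f (Subgroup.subset_closure ⟨_, hq, _,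
    sub_mem haa (herm_mem_of_mem_idealSMul f hJ hJ' q hq),
    isElementaryTransvection_planeTransvection H f hu ?_⟩)
  obtain ⟨d, rfl⟩ : ∃ d, q' = q + d := ⟨q' - q, by abel⟩
  rw [add_sub_cancel_left]
  -- Expanding `f (q + d) (q + d)` leaves `f q d + f d q`, whereas the new parameter involves `h q d
  -- = f q d + lam * star (f d q)`. The difference is the trace element of `f d q`, which lies in
  -- `Λ`.
  have h := hΛ.min_le (f.toFun d q)
  have := sub_mem (sub_mem ha' ha) h
  convert this using 1
  simp only [herm, f.add_left, f.add_right]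
  abel

end

/-! ### Substitution and localization on `Q[X]` -/

theorem PolyMod.induction {P : Type*} [AddCommGroup P] {motive : PolyMod P → Prop}
    (add : ∀ x y, motive x → motive y → motive (x + y)) (single : ∀ i p, motive (single i p))
    (x : PolyMod P) : motive x :=
  Finsupp.induction_linear (motive := motive) x
    ((map_zero (PolyMod.single (P := P) 0)) ▸ single 0 0) add single

theorem substHom_monomial {R : Type*} [Ring R] (b : R) (hb : b ∈ Subring.center R) (j : ℕ) (a : R) :
    substHom b hb (monomial j a) = monomial j (a * b ^ j) := by
  ext n
  rw [coeff_substHom, coeff_monomial, coeff_monomial]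
  split_ifs with h
  · rw [h]
  · rw [zero_mul]

section
variable {R P : Type*} [Ring R] [AddCommGroup P] [Module Rᵐᵒᵖ P] (b : R)
  (hb : b ∈ Subring.center R)

theorem PolyMod.subst_single (i : ℕ) (p : P) :
    PolyMod.subst b (PolyMod.single i p) = PolyMod.single i (op (b ^ i) • p) := by
  rw [PolyMod.subst, PolyMod.lift_single]
  rfl

theorem PolyMod.subst_smul (g : R[X]) (x : PolyMod P) :
    PolyMod.subst b (op g • x) = op (substHom b hb g) • PolyMod.subst b x := by
  induction g using Polynomial.induction_on' with
  | add g g' h h' => rw [op_add, add_smul, map_add, h, h', map_add, op_add, add_smul]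
  | monomial j a =>
    induction x using PolyMod.induction with
    | add x y hx hy => rw [smul_add, map_add, hx, hy, map_add, smul_add]
    | single i p =>
      rw [PolyMod.smul_single, PolyMod.subst_single, substHom_monomial, PolyMod.subst_single,
        PolyMod.smul_single, smul_smul, smul_smul, ← op_mul, ← op_mul, pow_add,
        ← mul_assoc, ← mul_assoc, Subring.mem_center_iff.1 (pow_mem hb i), mul_assoc]

/-- `substQ` as an additive map. -/
def substQHom : PolyMod P × R[X] × R[X] →+ PolyMod P × R[X] × R[X] where
  toFun := substQ b
  map_zero' := by simp [substQ]
  map_add' x y := by simp [substQ]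

theorem substQHom_apply (x : PolyMod P × R[X] × R[X]) : substQHom b x = substQ b x := rfl

theorem substQHom_smul (g : R[X]) (x : PolyMod P × R[X] × R[X]) :
    substQHom b (op g • x) = op (substHom b hb g) • substQHom b x := by
  refine Prod.ext (PolyMod.subst_smul b hb g x.1) (Prod.ext ?_ ?_)
  · exact map_mul (substHom b hb) x.2.1 g
  · exact map_mul (substHom b hb) x.2.2 g

theorem PolyMod.single_coeff_zero (x : PolyMod P) :
    PolyMod.single 0 (x.coeff 0) = PolyMod.subst (0 : R) x := by
  induction x using PolyMod.induction with
  | add x y hx hy =>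
    rw [map_add, ← hx, ← hy, ← map_add]
    rfl
  | single i p =>
    rw [PolyMod.subst_single]
    change PolyMod.single 0 (Finsupp.single i p 0) = _
    cases i with
    | zero => simp
    | succ i => simp

/-- Evaluation at `X = 0` is treated as the substitution of `0` for `X`, so that the whole
discussion of `σ(0)` can stay inside `Q[X]`. -/
theorem constQ_evalZeroQ (x : PolyMod P × R[X] × R[X]) :
    constQ (evalZeroQ x) = substQ (0 : R) x := by
  refine Prod.ext (PolyMod.single_coeff_zero x.1) (Prod.ext ?_ ?_) <;>
  · simp [constQ, evalZeroQ, substQ, comp_zero, coeff_zero_eq_eval_zero]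

omit [Module Rᵐᵒᵖ P] in
theorem PolyMod.coeff_single_zero (p : P) : (PolyMod.single 0 p).coeff 0 = p :=
  Finsupp.single_eq_same

omit [Module Rᵐᵒᵖ P] in
theorem evalZeroQ_constQ (x : P × R × R) : evalZeroQ (constQ x) = x := by
  refine Prod.ext (PolyMod.coeff_single_zero x.1) (Prod.ext ?_ ?_) <;> simp [constQ, evalZeroQ]

end

section
variable {R P : Type*} [Ring R] [StarRing R] [AddCommGroup P] [Module Rᵐᵒᵖ P]
  (f : SesquilinearForm R P) {b : R} (hb : b ∈ Subring.center R) (hb' : star b = b)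

include hb' in
theorem SesquilinearForm.poly_subst (x y : PolyMod P) :
    f.poly.toFun (PolyMod.subst b x) (PolyMod.subst b y) = substHom b hb (f.poly.toFun x y) := by
  induction x using PolyMod.induction with
  | add x x' hx hx' => rw [map_add, f.poly.add_left, hx, hx', f.poly.add_left, map_add]
  | single i p =>
    induction y using PolyMod.induction with
    | add y y' hy hy' => rw [map_add, f.poly.add_right, hy, hy', f.poly.add_right, map_add]
    | single j q =>
      change f.polyBihom _ _ = substHom b hb (f.polyBihom _ _)
      rw [PolyMod.subst_single, PolyMod.subst_single, SesquilinearForm.polyBihom_single,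
        SesquilinearForm.polyBihom_single, f.smul_smul, substHom_monomial, star_pow, hb',
        ← Subring.mem_center_iff.1 (pow_mem hb i), mul_assoc, pow_add]

include hb' in
theorem SesquilinearForm.herm_substQ (lam : R) (x y : PolyMod P × R[X] × R[X]) :
    f.poly.perpHyperbolic.herm (C lam) (substQHom b x) (substQHom b y) =
      substHom b hb (f.poly.perpHyperbolic.herm (C lam) x y) := by
  have h : ∀ x y : PolyMod P × R[X] × R[X], f.poly.perpHyperbolic.toFun (substQHom b x)
      (substQHom b y) = substHom b hb (f.poly.perpHyperbolic.toFun x y) := by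
    intro x y
    change f.poly.toFun (PolyMod.subst b x.1) (PolyMod.subst b y.1) +
      star (substHom b hb x.2.1) * substHom b hb y.2.2 = substHom b hb (_ + _)
    rw [f.poly_subst hb hb', map_add, map_mul, substHom_star b hb hb']
  rw [SesquilinearForm.herm, SesquilinearForm.herm, h, h, map_add, map_mul, substHom_C,
    substHom_star b hb hb']

end

/-! ### Coordinates on the localization of `Q[X]` -/

section
variable {R Rs P Ps : Type*} [Ring R] [Ring Rs] [AddCommGroup P] [Module Rᵐᵒᵖ P]
  [AddCommGroup Ps] [Module Rsᵐᵒᵖ Ps] (φ : R →+* Rs) (ι : P →+ Ps) {n : ℕ}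
  (θ : Ps ≃ₗ[Rsᵐᵒᵖ] (Fin n ⊕ Fin n → Rs))

/-- The `k`-th coordinate of the localization of an element of `P[X]`. -/
def polyCoord (k : Fin n ⊕ Fin n) : PolyMod P →+ Rs[X] :=
  (PolyMod.toPoly ((Pi.evalAddMonoidHom _ k).comp θ.toAddEquiv.toAddMonoidHom)).comp (PolyMod.map ι)

theorem polyCoord_single (k : Fin n ⊕ Fin n) (i : ℕ) (p : P) :
    polyCoord ι θ k (PolyMod.single i p) = monomial i (θ (ι p) k) := by
  rw [polyCoord, AddMonoidHom.comp_apply, PolyMod.map, PolyMod.lift_single]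
  change PolyMod.toPoly _ (PolyMod.single i (ι p)) = _
  rw [PolyMod.toPoly, PolyMod.lift_single]
  rfl

theorem polyCoord_smul (hι : ∀ (a : R) (p : P), ι (op a • p) = op (φ a) • ι p)
    (k : Fin n ⊕ Fin n) (g : R[X]) (x : PolyMod P) :
    polyCoord ι θ k (op g • x) = polyCoord ι θ k x * g.map φ := by
  induction g using Polynomial.induction_on' with
  | add g g' h h' => rw [op_add, add_smul, map_add, h, h', Polynomial.map_add, mul_add]
  | monomial j a =>
    induction x using PolyMod.induction with
    | add x y hx hy => rw [smul_add, map_add, hx, hy, map_add, add_mul]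
    | single i p =>
      rw [PolyMod.smul_single, polyCoord_single, polyCoord_single, map_monomial,
        monomial_mul_monomial, hι, map_smul]
      rfl

/-- The coordinates of the localization of an element of `Q[X]`. -/
def locCoord : PolyMod P × R[X] × R[X] →+ (Fin (n + 1) ⊕ Fin (n + 1) → Rs[X]) where
  toFun x := coordQ θ (locQ φ ι x)
  map_zero' := by
    ext1 k
    rcases k with k | k <;> refine Fin.cases ?_ (fun k => ?_) k <;> simp [coordQ, locQ]
  map_add' x y := by
    ext1 k
    rcases k with k | k <;> refine Fin.cases ?_ (fun k => ?_) k <;> simp [coordQ, locQ]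

omit [Module Rᵐᵒᵖ P] in
theorem locCoord_inl_zero (x : PolyMod P × R[X] × R[X]) :
    locCoord φ ι θ x (Sum.inl 0) = x.2.1.map φ := rfl

omit [Module Rᵐᵒᵖ P] in
theorem locCoord_inr_zero (x : PolyMod P × R[X] × R[X]) :
    locCoord φ ι θ x (Sum.inr 0) = x.2.2.map φ := rfl

omit [Module Rᵐᵒᵖ P] in
theorem locCoord_inl_succ (x : PolyMod P × R[X] × R[X]) (k : Fin n) :
    locCoord φ ι θ x (Sum.inl k.succ) = polyCoord ι θ (Sum.inl k) x.1 := rfl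

omit [Module Rᵐᵒᵖ P] in
theorem locCoord_inr_succ (x : PolyMod P × R[X] × R[X]) (k : Fin n) :
    locCoord φ ι θ x (Sum.inr k.succ) = polyCoord ι θ (Sum.inr k) x.1 := rfl

theorem locCoord_smul (hι : ∀ (a : R) (p : P), ι (op a • p) = op (φ a) • ι p) (g : R[X])
    (x : PolyMod P × R[X] × R[X]) :
    locCoord φ ι θ (op g • x) = op (mapRingHom φ g) • locCoord φ ι θ x := by
  ext1 k
  rcases k with k | k <;> refine Fin.cases ?_ (fun k => ?_) k
  · exact Polynomial.map_mul φ
  · exact polyCoord_smul φ ι θ hι _ g x.1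
  · exact Polynomial.map_mul φ
  · exact polyCoord_smul φ ι θ hι _ g x.1

theorem locCoord_substQ (hι : ∀ (a : R) (p : P), ι (op a • p) = op (φ a) • ι p) (b : R)
    (hb : φ b ∈ Subring.center Rs) (x : PolyMod P × R[X] × R[X]) (k : Fin (n + 1) ⊕ Fin (n + 1)) :
    locCoord φ ι θ (substQ b x) k = substHom (φ b) hb (locCoord φ ι θ x k) := by
  have h₁ : ∀ p : R[X], (p.comp (C b * X)).map φ = substHom (φ b) hb (p.map φ) := fun p => by
    rw [substHom_apply, Polynomial.map_comp]
    simp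
  have h₂ : ∀ (k : Fin n ⊕ Fin n) (x : PolyMod P),
      polyCoord ι θ k (PolyMod.subst b x) = substHom (φ b) hb (polyCoord ι θ k x) := by
    intro k x
    induction x using PolyMod.induction with
    | add x y hx hy => rw [map_add, map_add, hx, hy, map_add, map_add]
    | single i p =>
      rw [PolyMod.subst_single, polyCoord_single, polyCoord_single, substHom_monomial, hι,
        map_smul, map_pow]
      rfl
  rcases k with k | k <;> refine Fin.cases ?_ (fun k => ?_) k
  · exact h₁ _
  · exact h₂ _ _
  · exact h₁ _
  · exact h₂ _ _

/-- Each coefficient of the component in `P_s[X]` is recovered from its coordinates, `θ` being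
injective. Equality of localizations can therefore be tested in coordinates, where matrices act. -/
theorem coordQ_injective : Function.Injective (coordQ θ) := by
  intro x y h
  have h₁ : ∀ k : Fin n ⊕ Fin n,
      PolyMod.toPoly ((Pi.evalAddMonoidHom _ k).comp θ.toAddEquiv.toAddMonoidHom) x.1 =
      PolyMod.toPoly ((Pi.evalAddMonoidHom _ k).comp θ.toAddEquiv.toAddMonoidHom) y.1 := by
    rintro (k | k)
    · exact congrFun h (Sum.inl k.succ)
    · exact congrFun h (Sum.inr k.succ)
  have h₂ : ∀ (g : Ps →+ Rs) (x : PolyMod Ps) (i : ℕ),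
      (PolyMod.toPoly g x).coeff i = g (x.coeff i) := by
    intro g x i
    induction x using PolyMod.induction with
    | add x y hx hy =>
      rw [map_add, coeff_add, hx, hy, ← map_add]
      rfl
    | single j p =>
      rw [PolyMod.toPoly, PolyMod.lift_single]
      change (monomial j (g p)).coeff i = g (Finsupp.single j p i)
      rw [coeff_monomial, Finsupp.single_apply]
      split_ifs <;> simp
  refine Prod.ext (Finsupp.ext fun i => θ.injective (funext fun k => ?_)) (Prod.ext ?_ ?_)
  · have := congrArg (fun p : Rs[X] => p.coeff i) (h₁ k)
    simp only [h₂] at this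
    exact this
  · exact congrFun h (Sum.inl 0)
  · exact congrFun h (Sum.inr 0)

end

section
variable {R Rs P Ps : Type*} [Ring R] [StarRing R] [Ring Rs] [StarRing Rs] [AddCommGroup P]
  [Module Rᵐᵒᵖ P] [AddCommGroup Ps] [Module Rsᵐᵒᵖ Ps] {φ : R →+* Rs} {ι : P →+ Ps} {n : ℕ}
  {θ : Ps ≃ₗ[Rsᵐᵒᵖ] (Fin n ⊕ Fin n → Rs)} {f : SesquilinearForm R P} {fs : SesquilinearForm Rs Ps}
  {lam : R}

/-- Both sides are biadditive, so monomials suffice, and there the claim is that `θ` preserves the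
Hermitian form. Only this half of being an isometry is needed to carry transvections over. -/
theorem herm_polyCoord (hφ : ∀ r, φ (star r) = star (φ r))
    (hfs : ∀ p q, fs.toFun (ι p) (ι q) = φ (f.toFun p q))
    (hθ : ∀ u v, (SesquilinearForm.hyperbolic Rs n).herm (φ lam) (θ u) (θ v) =
      fs.herm (φ lam) u v) (x y : PolyMod P) :
    (SesquilinearForm.hyperbolic Rs[X] n).herm (C (φ lam)) (fun k => polyCoord ι θ k x)
      (fun k => polyCoord ι θ k y) = (f.poly.herm (C lam) x y).map φ := by
  induction x using PolyMod.induction with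
  | add x x' hx hx' =>
    rw [SesquilinearForm.herm_add_left, Polynomial.map_add, ← hx, ← hx',
      ← SesquilinearForm.herm_add_left]
    congr 1
    ext1 k
    exact map_add _ _ _
  | single i p =>
    induction y using PolyMod.induction with
    | add y y' hy hy' =>
      rw [SesquilinearForm.herm_add_right, Polynomial.map_add, ← hy, ← hy',
        ← SesquilinearForm.herm_add_right]
      congr 1
      ext1 k
      exact map_add _ _ _
    | single j q =>
      have h₁ : ∀ i j p q, (SesquilinearForm.hyperbolic Rs[X] n).toFun
          (fun k => polyCoord ι θ k (PolyMod.single i p))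
          (fun k => polyCoord ι θ k (PolyMod.single j q)) =
          monomial (i + j) ((SesquilinearForm.hyperbolic Rs n).toFun (θ (ι p)) (θ (ι q))) := by
        intro i j p q
        simp only [SesquilinearForm.hyperbolic, polyCoord_single, SesquilinearForm.star_monomial,
          monomial_mul_monomial, map_sum]
      have h₂ : ∀ i j p q, f.poly.toFun (PolyMod.single i p) (PolyMod.single j q) =
          monomial (i + j) (f.toFun p q) := fun i j p q =>
        SesquilinearForm.polyBihom_single f i j p q
      have h₃ := hθ (ι p) (ι q)
      simp only [SesquilinearForm.herm, hfs] at h₃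
      rw [SesquilinearForm.herm, SesquilinearForm.herm, h₁, h₁, h₂, h₂,
        SesquilinearForm.star_monomial, SesquilinearForm.star_monomial, C_mul_monomial,
        C_mul_monomial, add_comm j i, ← map_add, ← map_add, map_monomial, h₃, φ.map_add, φ.map_mul,
        hφ]

theorem herm_locCoord (hφ : ∀ r, φ (star r) = star (φ r))
    (hfs : ∀ p q, fs.toFun (ι p) (ι q) = φ (f.toFun p q))
    (hθ : ∀ u v, (SesquilinearForm.hyperbolic Rs n).herm (φ lam) (θ u) (θ v) =
      fs.herm (φ lam) u v) (x y : PolyMod P × R[X] × R[X]) :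
    (SesquilinearForm.hyperbolic Rs[X] (n + 1)).herm (mapRingHom φ (C lam)) (locCoord φ ι θ x)
      (locCoord φ ι θ y) = mapRingHom φ (f.poly.perpHyperbolic.herm (C lam) x y) := by
  have h := herm_polyCoord (lam := lam) hφ hfs hθ x.1 y.1
  have hst : ∀ p : R[X], (star p).map φ = star (p.map φ) := fun p => by
    ext n
    rw [coeff_map, coeff_star, coeff_star, coeff_map, hφ]
  simp only [SesquilinearForm.herm, SesquilinearForm.hyperbolic, SesquilinearForm.perpHyperbolic,
    Fin.sum_univ_succ, locCoord_inl_zero, locCoord_inr_zero, locCoord_inl_succ, locCoord_inr_succ,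
    coe_mapRingHom, Polynomial.map_add, Polynomial.map_mul, hst, map_C, star_add, mul_add] at h ⊢
  rw [add_add_add_comm, h]
  abel

end

/-! ### Root matrices as transvections -/

section
variable {S : Type*} [Ring S] [StarRing S] {lam : S} (H : IsCentralUnitary lam) {m : ℕ}

include H in
theorem herm_hyperbolic_single (i : Fin m ⊕ Fin m) (c : S) (y : Fin m ⊕ Fin m → S) :
    (SesquilinearForm.hyperbolic S m).herm lam (Pi.single i c) y =
      star c * (idxSign lam i * y i.swap) := by
  rcases i with i | i
  · simp [SesquilinearForm.herm, SesquilinearForm.hyperbolic, idxSign, Pi.single_apply, apply_ite]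
  · simp [SesquilinearForm.herm, SesquilinearForm.hyperbolic, idxSign, Pi.single_apply, apply_ite,
      ← mul_assoc, H.comm]

include H in
-- A short root matrix is a transvection along `e_i` in the direction `e_{j.swap}`, with zero
-- quadratic parameter because basis vectors are isotropic. The factor `idxSign` compensates for the
-- value of `h(e_{j.swap}, e_j)`.
theorem rootUnit_mulVec_short {i j : Fin m ⊕ Fin m} (hij : i ≠ j) (hs : j ≠ i.swap) (a : S)
    (y : Fin m ⊕ Fin m → S) :
    (rootUnit lam i j hij a).val.mulVec y = transvection lam (SesquilinearForm.hyperbolic S m)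
      (Pi.single i 1) (Pi.single j.swap (idxSign lam j.swap * star a)) 0 y := by
  have h₁ : star (idxSign lam j.swap * star a) * (idxSign lam j.swap * y j.swap.swap) =
      a * y j := by
    rw [star_mul, star_star, Sum.swap_swap, mul_assoc, ← mul_assoc (star _),
      H.star_mul_sign, one_mul]
  have h₂ : idxSign lam j.swap * star a * (star lam * (idxSign lam i * y i.swap)) =
      idxCoeff lam i j * star a * y i.swap := by
    rw [← mul_assoc, ← H.star_comm, ← mul_assoc (star lam), H.star_lam_mul_sign, Sum.swap_swap,
      idxCoeff, H.sign_comm i (star _)]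
    simp only [mul_assoc]
    rw [← mul_assoc (star a), ← H.sign_comm i (star a), mul_assoc]
  ext1 k
  simp only [rootUnit, rootNil, hs, if_false, transvection, herm_hyperbolic_single H, h₁,
    Matrix.add_mulVec, Matrix.sub_mulVec, Matrix.one_mulVec, Matrix.single_mulVec, star_one,
    one_mul, mul_zero, zero_mul, op_zero, zero_smul, sub_zero]
  simp only [Pi.add_apply, Pi.sub_apply, Pi.smul_apply, op_smul_eq_mul, Pi.single_apply,
    Function.update_apply, Pi.zero_apply, ite_mul, zero_mul, one_mul, h₂]
  abel

include H in
-- A long root matrix is a transvection with zero vector part: only the quadratic parameter is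
-- present. That parameter is, up to sign, the normalized element which `rootParam` requires to lie
-- in `L`.
theorem rootUnit_mulVec_long {i : Fin m ⊕ Fin m} (hi : i ≠ i.swap) (a : S)
    (y : Fin m ⊕ Fin m → S) :
    (rootUnit lam i i.swap hi a).val.mulVec y =
      transvection lam (SesquilinearForm.hyperbolic S m) (Pi.single i 1) 0
        (-(idxSign lam i.swap * a)) y := by
  have h₁ : star lam * -(idxSign lam i.swap * a) * (idxSign lam i * y i.swap) =
      -(a * y i.swap) := by
    rw [mul_neg, neg_mul, ← mul_assoc (star lam), H.star_lam_mul_sign, Sum.swap_swap,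
      H.sign_star_comm, mul_assoc, ← mul_assoc (star _), H.star_mul_sign, one_mul]
  ext1 k
  simp only [rootUnit, rootNil, if_true, transvection, herm_hyperbolic_single H, h₁,
    Matrix.add_mulVec, Matrix.one_mulVec, Matrix.single_mulVec, star_one, sub_zero,
    one_mul, SesquilinearForm.herm_zero_left, op_zero, zero_smul, smul_zero, add_zero]
  simp [Pi.single_apply, Function.update_apply]

end

/-! ### Lifting root matrices to transvections -/

/-- The automorphism `τ` is given by the matrix `g` in the coordinates `w`. -/
def HasMatrix {A S V : Type*} {m : ℕ} [Ring A] [Ring S] [AddCommGroup V] [Module Aᵐᵒᵖ V]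
    (w : V →+ (Fin m ⊕ Fin m → S)) (τ : V ≃ₗ[Aᵐᵒᵖ] V)
    (g : (Matrix (Fin m ⊕ Fin m) (Fin m ⊕ Fin m) S)ˣ) : Prop :=
  ∀ x, w (τ x) = g.val.mulVec (w x)

section
variable {A S V : Type*} {m : ℕ} [Ring A] [Ring S] [AddCommGroup V] [Module Aᵐᵒᵖ V]
    {w : V →+ (Fin m ⊕ Fin m → S)} {τ τ' : V ≃ₗ[Aᵐᵒᵖ] V}
    {g g' : (Matrix (Fin m ⊕ Fin m) (Fin m ⊕ Fin m) S)ˣ}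

theorem HasMatrix.one : HasMatrix w (1 : V ≃ₗ[Aᵐᵒᵖ] V) 1 := fun x => by simp

theorem HasMatrix.mul (h : HasMatrix w τ g) (h' : HasMatrix w τ' g') :
    HasMatrix w (τ * τ') (g * g') := fun x => by
  rw [LinearEquiv.mul_apply, h, h', Matrix.mulVec_mulVec, Units.val_mul]

theorem HasMatrix.inv (h : HasMatrix w τ g) : HasMatrix w τ⁻¹ g⁻¹ := fun x => by
  have e := h (τ⁻¹ x)
  rw [← LinearEquiv.mul_apply, mul_inv_cancel, LinearEquiv.coe_one, id] at e
  rw [e, Matrix.mulVec_mulVec, ← Units.val_mul, inv_mul_cancel, Units.val_one, Matrix.one_mulVec]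

end

/-- The pairs of matrices which lift to a pair of elements of `ET` that are congruent modulo
`ETRel`. -/
def liftPairs {A S P : Type*} {m : ℕ} [Ring A] [StarRing A] [Ring S] [AddCommGroup P]
    [Module Aᵐᵒᵖ P] (lam : A) (Λ J : AddSubgroup A) (f : SesquilinearForm A P)
    (w : P × A × A →+ (Fin m ⊕ Fin m → S)) :
    Subgroup (Matrix (Fin m ⊕ Fin m) (Fin m ⊕ Fin m) (S × S))ˣ where
  carrier := {g | ∃ τ ∈ ET lam Λ f, ∃ τ' ∈ ET lam Λ f, τ⁻¹ * τ' ∈ ETRel lam Λ J f ∧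
    HasMatrix w τ (mapGL (RingHom.fst S S) g) ∧ HasMatrix w τ' (mapGL (RingHom.snd S S) g)}
  mul_mem' := by
    rintro g g' ⟨τ, hτ, τ', hτ', h, hg, hg'⟩ ⟨ρ, hρ, ρ', hρ', h', k, k'⟩
    refine ⟨τ * ρ, mul_mem hτ hρ, τ' * ρ', mul_mem hτ' hρ', ?_, ?_, ?_⟩
    -- The identity is `(τ ρ)⁻¹ (τ' ρ') = ρ⁻¹ (τ⁻¹ τ') ρ * (ρ⁻¹ ρ')`.
    · have := mul_mem (conj_mem_ETRel f (inv_mem hρ) h) h'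
      convert this using 1
      group
    · rw [map_mul]
      exact hg.mul k
    · rw [map_mul]
      exact hg'.mul k'
  one_mem' := ⟨1, one_mem _, 1, one_mem _, by simp, by rw [map_one]; exact HasMatrix.one,
    by rw [map_one]; exact HasMatrix.one⟩
  inv_mem' := by
    rintro g ⟨τ, hτ, τ', hτ', h, hg, hg'⟩
    refine ⟨τ⁻¹, inv_mem hτ, τ'⁻¹, inv_mem hτ', ?_, ?_, ?_⟩
    · have := conj_mem_ETRel f hτ (inv_mem h)
      convert this using 1
      group
    · rw [map_inv]
      exact hg.inv
    · rw [map_inv]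
      exact hg'.inv

section
variable {R Rs P Ps : Type*} [Ring R] [StarRing R] [Ring Rs] [StarRing Rs] [AddCommGroup P]
  [Module Rᵐᵒᵖ P] [AddCommGroup Ps] [Module Rsᵐᵒᵖ Ps] {φ : R →+* Rs} {ι : P →+ Ps} {n : ℕ}
  {θ : Ps ≃ₗ[Rsᵐᵒᵖ] (Fin n ⊕ Fin n → Rs)} {f : SesquilinearForm R P} {fs : SesquilinearForm Rs Ps}
  {lam s : R} {Λ : AddSubgroup R} {J : Ideal R} [J.IsTwoSided]

/-- Multiples of the hyperbolic basis of `P_s` come from elements of `P` with `f p p ∈ Λ`. -/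
theorem exists_basis_lift (hΛ : IsFormParameter lam Λ) (hs : s ∈ formCenter Λ)
    (hφ : IsRingLocalization s φ) (hι : IsModuleLocalization s φ ι)
    (hfs : ∀ p q, fs.toFun (ι p) (ι q) = φ (f.toFun p q))
    (hθ : fs.IsIsometry (φ lam) (locSubgroup s φ Λ) (SesquilinearForm.hyperbolic Rs n) θ) :
    ∃ N : ℕ, ∀ k, ∃ p : P, θ (ι p) = Pi.single k (φ s ^ N) ∧ f.toFun p p ∈ Λ := by
  have hmul : ∀ (e : ℕ) (p : P) (k) (c : Rs), θ (ι p) = Pi.single k c →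
      θ (ι (op (s ^ e) • p)) = Pi.single k (c * φ s ^ e) := by
    intro e p k c h
    rw [hι.map_smul, map_smul, h, map_pow]
    ext1 k'
    by_cases hk : k' = k
    · subst hk
      simp
    · simp [hk]
  have hf : ∀ (e : ℕ) (p : P), f.toFun (op (s ^ e) • p) (op (s ^ e) • p) =
      star (s ^ e) * f.toFun p p * s ^ e := fun e p => f.smul_smul p p _ _
  have h : ∀ k, ∃ (N : ℕ) (p : P), θ (ι p) = Pi.single k (φ s ^ N) ∧ f.toFun p p ∈ Λ := by
    intro k
    obtain ⟨p, e, hp⟩ := hι.surj (θ.symm (Pi.single k 1))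
    have hp' : θ (ι p) = Pi.single k (φ s ^ e) := by
      rw [← hp, map_smul, LinearEquiv.apply_symm_apply]
      ext1 k'
      by_cases hk : k' = k
      · subst hk
        simp
      · simp [hk]
    -- The basis vector `e_k` is isotropic for the hyperbolic form, so the isometry condition says
    -- that `φ (f p p)` lies in `Λ_s`.
    have h₁ := hθ.2 (ι p)
    have h₂ : (SesquilinearForm.hyperbolic Rs n).toFun (θ (ι p)) (θ (ι p)) = 0 := by
      rw [hp']
      rcases k with k | k <;> simp [SesquilinearForm.hyperbolic]
    rw [h₂, zero_sub, hfs, neg_mem_iff] at h₁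
    obtain ⟨l, hl⟩ := exists_of_mem_locSubgroup hs.2.2 hs.1 h₁
    obtain ⟨a, ha, h₃⟩ := hl l le_rfl
    -- The power `s ^ l` clears the denominator in `Λ_s`, and `s ^ d` removes the `s`-torsion
    -- ambiguity in `R`. Replacing `p` by `p * s ^ (l + d)` then brings `f p p` into `Λ`.
    obtain ⟨d, hd⟩ := hφ.exists_of_eq_zero (f.toFun p p * s ^ l - a)
      (by rw [map_sub, map_mul, map_pow, h₃, sub_self])
    rw [sub_mul, sub_eq_zero, mul_assoc, ← pow_add] at hd
    refine ⟨e + (l + d), op (s ^ (l + d)) • p, ?_, ?_⟩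
    · rw [hmul _ _ _ _ hp', ← pow_add]
    · rw [hf, mul_assoc, hd, star_pow, hs.2.1]
      refine (pow_mem hs _).2.2 _ ?_
      rw [Subring.mem_center_iff.1 (pow_mem hs.1 d)]
      exact (pow_mem hs _).2.2 _ ha
  choose N p hp hp' using h
  -- A common exponent exists because there are finitely many indices, and multiplying `p` by a
  -- further power of `s` keeps `f p p` in `Λ`.
  refine ⟨Finset.univ.sup N, fun k => ?_⟩
  obtain ⟨d, hd⟩ := Nat.exists_eq_add_of_le (Finset.le_sup (f := N) (Finset.mem_univ k))
  refine ⟨op (s ^ d) • p k, ?_, ?_⟩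
  · rw [hmul _ _ _ _ (hp k), hd, ← pow_add]
  · rw [hf]
    exact hΛ.conj_mem _ _ (hp' k)

end

section
variable {R Rs P Ps : Type*} [Ring R] [StarRing R] [Ring Rs] [StarRing Rs] [AddCommGroup P]
  [Module Rᵐᵒᵖ P] [AddCommGroup Ps] [Module Rsᵐᵒᵖ Ps] {φ : R →+* Rs} {ι : P →+ Ps} {n : ℕ}
  {θ : Ps ≃ₗ[Rsᵐᵒᵖ] (Fin n ⊕ Fin n → Rs)} {f : SesquilinearForm R P} {fs : SesquilinearForm Rs Ps}
  {lam s : R} {Λ : AddSubgroup R} {J : Ideal R} [J.IsTwoSided]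

theorem exists_eq_succ {k : Fin (n + 1) ⊕ Fin (n + 1)} (h : k ≠ Sum.inl 0) (h' : k ≠ Sum.inr 0) :
    ∃ k' : Fin n ⊕ Fin n, k = Sum.map Fin.succ Fin.succ k' := by
  rcases k with k | k
  · obtain ⟨k', rfl⟩ := Fin.exists_succ_eq.2 (fun e => h (congrArg Sum.inl e))
    exact ⟨Sum.inl k', rfl⟩
  · obtain ⟨k', rfl⟩ := Fin.exists_succ_eq.2 (fun e => h' (congrArg Sum.inr e))
    exact ⟨Sum.inr k', rfl⟩

omit [StarRing R] [StarRing Rs] in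
theorem locCoord_basis (hι : ∀ (a : R) (p : P), ι (op a • p) = op (φ a) • ι p)
    {k : Fin n ⊕ Fin n} {p : P} {c : Rs} (hp : θ (ι p) = Pi.single k c) (g : R[X]) :
    locCoord φ ι θ ((op g • PolyMod.single 0 p, 0, 0) : PolyMod P × R[X] × R[X]) =
      Pi.single (Sum.map Fin.succ Fin.succ k) (C c * mapRingHom φ g) := by
  have h : ∀ k', polyCoord ι θ k' (op g • PolyMod.single 0 p) =
      (Pi.single k (C c * mapRingHom φ g) : Fin n ⊕ Fin n → Rs[X]) k' := by
    intro k'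
    rw [polyCoord_smul φ ι θ hι, polyCoord_single, hp, Pi.single_apply, Pi.single_apply]
    split_ifs
    · rfl
    · simp
  ext1 k'
  rcases k' with k' | k' <;> refine Fin.cases ?_ (fun k' => ?_) k'
  · rw [locCoord_inl_zero]
    rcases k with k | k <;> simp
  · rw [locCoord_inl_succ, h]
    rcases k with k | k <;> simp [Pi.single_apply]
  · rw [locCoord_inr_zero]
    rcases k with k | k <;> simp [(Fin.succ_ne_zero _).symm]
  · rw [locCoord_inr_succ, h]
    rcases k with k | k <;> simp [Pi.single_apply]

omit [StarRing R] [StarRing Rs] [Module Rᵐᵒᵖ P] in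
theorem locCoord_plane_inl :
    locCoord φ ι θ ((0, 1, 0) : PolyMod P × R[X] × R[X]) = Pi.single (Sum.inl 0) 1 := by
  ext1 k
  rcases k with k | k <;> refine Fin.cases ?_ (fun k => ?_) k <;>
    simp [locCoord_inl_zero, locCoord_inl_succ, locCoord_inr_zero, locCoord_inr_succ]

omit [StarRing R] [StarRing Rs] [Module Rᵐᵒᵖ P] in
theorem locCoord_plane_inr :
    locCoord φ ι θ ((0, 0, 1) : PolyMod P × R[X] × R[X]) = Pi.single (Sum.inr 0) 1 := by
  ext1 k
  rcases k with k | k <;> refine Fin.cases ?_ (fun k => ?_) k <;>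
    simp [locCoord_inl_zero, locCoord_inl_succ, locCoord_inr_zero, locCoord_inr_succ]

/-- Elementary matrices of a sufficiently deep level lift to transvections. -/
theorem exists_rootGroup_le_liftPairs (hlam : lam ∈ Subring.center R)
    (hlam_one : lam * star lam = 1) (hΛ : IsFormParameter lam Λ) (hJ : ∀ a ∈ J, star a ∈ J)
    (hs : s ∈ formCenter Λ) (hφ : IsRingLocalization s φ) (hι : IsModuleLocalization s φ ι)
    (hfs : ∀ p q, fs.toFun (ι p) (ι q) = φ (f.toFun p q))
    (hθ : fs.IsIsometry (φ lam) (locSubgroup s φ Λ) (SesquilinearForm.hyperbolic Rs n) θ) :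
    ∃ r : ℤ, 0 ≤ r ∧
      rootGroup ((mapRingHom φ (C lam), mapRingHom φ (C lam)) : Rs[X] × Rs[X])
        (pairFiltration ⊤ (polySubgroup J.toAddSubgroup) (mapRingHom φ) hφ.polyUnit)
        (pairFiltration (polySubgroup Λ) (polySubgroup J.toAddSubgroup) (mapRingHom φ)
          hφ.polyUnit) (n + 1) r ≤
      liftPairs (C lam) (polySubgroup Λ) (polySubgroup J.toAddSubgroup) f.poly
        (locCoord φ ι θ) := by
  have F := isFormInverting_poly (J := J) hlam hlam_one hΛ hJ hs hφ
  have H : IsCentralUnitary (C lam) :=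
    { comm := fun x => by
        ext n
        rw [coeff_C_mul, coeff_mul_C, Subring.mem_center_iff.1 hlam]
      mul_star := by rw [star_C, ← C_mul, hlam_one, C_1] }
  have Hs := F.unitary
  obtain ⟨N, hN⟩ := exists_basis_lift hΛ hs hφ hι hfs hθ
  have htr : ∀ u v a x, locCoord φ ι θ (transvection (C lam) f.poly.perpHyperbolic u v a x) =
      transvection (mapRingHom φ (C lam)) (SesquilinearForm.hyperbolic Rs[X] (n + 1))
        (locCoord φ ι θ u) (locCoord φ ι θ v) (mapRingHom φ a) (locCoord φ ι θ x) :=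
    map_transvection (C lam) _ _ (mapRingHom φ) (locCoord φ ι θ) F.map_star
      (locCoord_smul φ ι θ hι.map_smul) (herm_locCoord hφ.map_star hfs hθ.1)
  have hfst : ∀ x : Rs[X] × Rs[X], RingHom.fst Rs[X] Rs[X] (star x) =
      star (RingHom.fst Rs[X] Rs[X] x) := fun _ => rfl
  have hsnd : ∀ x : Rs[X] × Rs[X], RingHom.snd Rs[X] Rs[X] (star x) =
      star (RingHom.snd Rs[X] Rs[X] x) := fun _ => rfl
  have main : ∀ (z : Fin (n + 1) ⊕ Fin (n + 1)) (u : PolyMod P × R[X] × R[X]),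
      IsPlaneVector u → locCoord φ ι θ u = Pi.single z 1 → (z = Sum.inl 0 ∨ z = Sum.inr 0) →
      ∀ (j) (hj : z ≠ j), ∀ a ∈ rootParam
        ((mapRingHom φ (C lam), mapRingHom φ (C lam)) : Rs[X] × Rs[X])
        (pairFiltration ⊤ (polySubgroup J.toAddSubgroup) (mapRingHom φ) hφ.polyUnit)
        (pairFiltration (polySubgroup Λ) (polySubgroup J.toAddSubgroup) (mapRingHom φ)
          hφ.polyUnit) z j N,
      rootUnit (mapRingHom φ (C lam), mapRingHom φ (C lam)) z j hj a ∈
        liftPairs (C lam) (polySubgroup Λ) (polySubgroup J.toAddSubgroup) f.poly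
        (locCoord φ ι θ) := by
    intro z u hu hz hz' j hj a ha
    by_cases hs' : j = z.swap
    · subst hs'
      rw [IsFormFiltration.param_long] at ha
      -- For a long root no basis vector of `P` is involved, so level `0` is enough: the normalized
      -- parameters are themselves images of elements of `Λ[X]`.
      obtain ⟨r, r', hr, hr', hrr, e⟩ := mem_pairFiltration.1
        (F.isFormFiltration.antitone_form (Int.natCast_nonneg N) ha)
      have e₁ : idxSign (mapRingHom φ (C lam)) z.swap * a.1 = mapRingHom φ r := by
        have := congrArg Prod.fst ((idxSign_pair _ a.1 a.2 z.swap).symm.trans e)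
        simpa using this
      have e₂ : idxSign (mapRingHom φ (C lam)) z.swap * a.2 = mapRingHom φ r' := by
        have := congrArg Prod.snd ((idxSign_pair _ a.1 a.2 z.swap).symm.trans e)
        simpa using this
      have m₁ : ∀ r ∈ polySubgroup Λ, f.poly.toFun 0 0 - -r ∈ polySubgroup Λ := fun r hr => by
        rw [SesquilinearForm.toFun_zero_left, zero_sub, neg_neg]
        exact hr
      refine ⟨planeTransvection H f.poly u hu 0 (-r), planeTransvection_mem_ET H _ hu (m₁ r hr),
        planeTransvection H f.poly u hu 0 (-r'), planeTransvection_mem_ET H _ hu (m₁ r' hr'),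
        planeTransvection_inv_mul_mem_ETRel H _ F.form F.mul_mem_left F.mul_mem_right hu
          (m₁ r hr) (m₁ r' hr') (by rw [sub_zero]; exact zero_mem _)
          (by rw [neg_sub_neg]; exact hrr), fun x => ?_, fun x => ?_⟩
      · rw [planeTransvection_apply, htr, hz, mapGL_rootUnit _ hfst]
        change _ = (rootUnit (mapRingHom φ (C lam)) z z.swap hj a.1).val.mulVec _
        rw [rootUnit_mulVec_long Hs, e₁, map_neg]
        congr 1
        exact map_zero _
      · rw [planeTransvection_apply, htr, hz, mapGL_rootUnit _ hsnd]
        change _ = (rootUnit (mapRingHom φ (C lam)) z z.swap hj a.2).val.mulVec _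
        rw [rootUnit_mulVec_long Hs, e₂, map_neg]
        congr 1
        exact map_zero _
    · rw [IsFormFiltration.param_short hs'] at ha
      obtain ⟨r, r', -, -, hrr, e⟩ := mem_pairFiltration.1 ha
      obtain ⟨k, hk⟩ : ∃ k : Fin n ⊕ Fin n, j.swap = Sum.map Fin.succ Fin.succ k := by
        refine exists_eq_succ (fun h => ?_) (fun h => ?_) <;>
        · have h' := eq_swap_comm.1 h.symm
          rcases hz' with rfl | rfl <;> simp_all
      obtain ⟨p, hp, hp'⟩ := hN k
      -- Since `f p p ∈ Λ`, every multiple `q` of `p` has `f q q` in `Λ[X]`, so the quadratic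
      -- parameter `0` is admissible.
      have m₁ : ∀ g : R[X], f.poly.toFun (op g • PolyMod.single 0 p) (op g • PolyMod.single 0 p) -
          0 ∈ polySubgroup Λ := fun g => by
        rw [sub_zero, f.poly.smul_smul]
        refine F.form.conj_mem _ _ ?_
        change f.polyBihom _ _ ∈ _
        rw [SesquilinearForm.polyBihom_single]
        exact monomial_mem_polySubgroup hp' _
      -- The liftable vector is `s ^ N * e_k`; its factor `s ^ N` is exactly the one carried by a
      -- parameter of level `N`.
      have m₂ : ∀ r : R[X], locCoord φ ι θ ((op (idxSign (C lam) j.swap * star r) •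
          PolyMod.single 0 p, 0, 0) : PolyMod P × R[X] × R[X]) = Pi.single j.swap
          (idxSign (mapRingHom φ (C lam)) j.swap * star (mapRingHom φ r *
            ((hφ.polyUnit ^ (N : ℤ) : Rs[X]ˣ) : Rs[X]))) := by
        intro r
        rw [locCoord_basis hι.map_smul hp, ← hk, map_mul, F.map_star, map_idxSign, star_mul,
          F.star_zpow, zpow_natCast, Units.val_pow_eq_pow_val, hφ.val_polyUnit, ← C_pow]
        congr 1
        have hc : ∀ y : Rs[X], C (φ s ^ N) * y = y * C (φ s ^ N) := fun y => by
          ext i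
          rw [coeff_C_mul, coeff_mul_C, ← map_pow, hφ.map_comm (pow_mem hs.1 N)]
        rw [← mul_assoc, hc, mul_assoc]
      have m₃ : op (idxSign (C lam) j.swap * star r') • PolyMod.single 0 p -
          op (idxSign (C lam) j.swap * star r) • PolyMod.single 0 p ∈
          idealSMul (polySubgroup J.toAddSubgroup) (PolyMod P) := by
        rw [← sub_smul, ← op_sub, ← mul_sub, ← star_sub]
        refine Submodule.subset_span ⟨_, _, F.mul_mem_left _ _ (F.star_mem _ ?_), rfl⟩
        rw [← neg_sub]
        exact neg_mem hrr
      subst e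
      refine ⟨planeTransvection H f.poly u hu _ 0, planeTransvection_mem_ET H _ hu (m₁ _),
        planeTransvection H f.poly u hu _ 0, planeTransvection_mem_ET H _ hu (m₁ _),
        planeTransvection_inv_mul_mem_ETRel H _ F.form F.mul_mem_left F.mul_mem_right hu
          (m₁ _) (m₁ _) m₃ (by rw [sub_zero]; exact zero_mem _), fun x => ?_, fun x => ?_⟩
      · rw [planeTransvection_apply, htr, hz, mapGL_rootUnit _ hfst, m₂, map_zero]
        exact (rootUnit_mulVec_short Hs hj hs' _ _).symm
      · rw [planeTransvection_apply, htr, hz, mapGL_rootUnit _ hsnd, m₂, map_zero]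
        exact (rootUnit_mulVec_short Hs hj hs' _ _).symm
  -- The rows `0` and `ρ 0` are those of the plane `ℍ(R[X])`, where root matrices have just been
  -- lifted. All other roots are reached at three times the level.
  refine ⟨3 * N, by positivity, F.isFormFiltration.rootGroup_le_of_plane (Sum.inl 0)
    (Int.natCast_nonneg N) (main _ (0, 1, 0) (Or.inr rfl) locCoord_plane_inl (Or.inl rfl))
    (main _ (0, 0, 1) (Or.inl rfl) locCoord_plane_inr (Or.inr rfl))⟩

end

/-! ### Evaluation at `X = 0` -/

/-- The automorphisms which commute with the additive map `e` up to an element of `G`. -/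
def semiconjSubgroup {A V : Type*} [Ring A] [AddCommGroup V] [Module Aᵐᵒᵖ V] (e : V →+ V)
    (G : Subgroup (V ≃ₗ[Aᵐᵒᵖ] V)) : Subgroup (V ≃ₗ[Aᵐᵒᵖ] V) where
  carrier := {τ | ∃ τ₀ ∈ G, ∀ x, e (τ x) = τ₀ (e x)}
  mul_mem' := by
    rintro τ τ' ⟨τ₀, h₀, h⟩ ⟨τ₁, h₁, h'⟩
    exact ⟨τ₀ * τ₁, mul_mem h₀ h₁, fun x => by simp only [LinearEquiv.mul_apply, h, h']⟩
  one_mem' := ⟨1, one_mem _, fun x => rfl⟩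
  inv_mem' := by
    rintro τ ⟨τ₀, h₀, h⟩
    refine ⟨τ₀⁻¹, inv_mem h₀, fun x => ?_⟩
    have h' := h (τ⁻¹ x)
    rw [← LinearEquiv.mul_apply, mul_inv_cancel, LinearEquiv.coe_one, id] at h'
    rw [h', ← LinearEquiv.mul_apply, inv_mul_cancel, LinearEquiv.coe_one, id]

section
variable {R P : Type*} [Ring R] [StarRing R] [AddCommGroup P] [Module Rᵐᵒᵖ P]
  {f : SesquilinearForm R P} {lam : R} {Λ J : AddSubgroup R}

theorem zero_pow_mul_mem {R : Type*} [Ring R] {T : AddSubgroup R} (n : ℕ) (a : R) (ha : a ∈ T) :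
    0 ^ n * a ∈ T := by
  cases n with
  | zero => simpa using ha
  | succ n => simp

omit [StarRing R] in
theorem subst_zero_mem_idealSMul {q : PolyMod P}
    (hq : q ∈ idealSMul (polySubgroup J) (PolyMod P)) :
    PolyMod.subst (0 : R) q ∈ idealSMul (polySubgroup J) (PolyMod P) := by
  induction hq using Submodule.span_induction with
  | mem q hq =>
    obtain ⟨x, a, ha, rfl⟩ := hq
    rw [PolyMod.subst_smul 0 (zero_mem _)]
    exact Submodule.subset_span ⟨_, _, substHom_mem _ zero_pow_mul_mem ha, rfl⟩
  | zero =>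
    rw [map_zero]
    exact zero_mem _
  | add x y _ _ hx hy =>
    rw [map_add]
    exact add_mem hx hy
  | smul r x _ hx =>
    have := PolyMod.subst_smul (0 : R) (zero_mem _) (unop r) x
    rw [op_unop] at this
    rw [this]
    exact Submodule.smul_mem _ _ hx

/-- Setting `X = 0` in the parameters gives a transvection with constant parameters, because the
plane vector is fixed by the substitution and the Hermitian form is compatible with it. -/
theorem exists_isElementaryTransvection_eval_zero (H : IsCentralUnitary (C lam)) {q : PolyMod P}
    {a : R[X]} {τ : (PolyMod P × R[X] × R[X]) ≃ₗ[R[X]ᵐᵒᵖ] (PolyMod P × R[X] × R[X])}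
    (h : IsElementaryTransvection (C lam) (polySubgroup Λ) f.poly q a τ) :
    ∃ τ₀, IsElementaryTransvection (C lam) (polySubgroup Λ) f.poly (PolyMod.subst (0 : R) q)
      (substHom 0 (zero_mem _) a) τ₀ ∧ ∀ x, substQHom (0 : R) (τ x) = τ₀ (substQHom 0 x) := by
  obtain ⟨u, hu, rfl⟩ := exists_eq_planeTransvection H f.poly h
  refine ⟨planeTransvection H f.poly u hu _ _,
    isElementaryTransvection_planeTransvection H f.poly hu ?_, fun x => ?_⟩
  · rw [f.poly_subst (zero_mem _) (star_zero R), ← map_sub]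
    exact substHom_mem _ zero_pow_mul_mem h.1
  · have hu' : substQHom (0 : R) u = u := by
      rcases hu with rfl | rfl <;> simp [substQHom_apply, substQ]
    have := map_transvection (C lam) f.poly.perpHyperbolic f.poly.perpHyperbolic
      (substHom (0 : R) (zero_mem _)) (substQHom 0) (substHom_star _ _ (star_zero R))
      (substQHom_smul 0 _) (by
        rw [substHom_C]
        exact f.herm_substQ (zero_mem _) (star_zero R) lam) u (q, 0, 0) a x
    rw [planeTransvection_apply, planeTransvection_apply, this, substHom_C, hu']
    congr 1
    simp [substQHom_apply, substQ]

/-- The automorphism `τ₀` is `τ(0)`, extended to polynomials. It stays in the relative group because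
setting `X = 0` preserves the generators of `ET` and of `ETIdeal`. -/
theorem exists_eval_zero_mem_ETRel (H : IsCentralUnitary (C lam))
    {τ : (PolyMod P × R[X] × R[X]) ≃ₗ[R[X]ᵐᵒᵖ] (PolyMod P × R[X] × R[X])}
    (hτ : τ ∈ ETRel (C lam) (polySubgroup Λ) (polySubgroup J) f.poly) :
    ∃ τ₀ ∈ ETRel (C lam) (polySubgroup Λ) (polySubgroup J) f.poly,
      ∀ x, substQHom (0 : R) (τ x) = τ₀ (substQHom 0 x) := by
  have h₁ : ET (C lam) (polySubgroup Λ) f.poly ≤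
      semiconjSubgroup (substQHom (0 : R)) (ET (C lam) (polySubgroup Λ) f.poly) := by
    refine (Subgroup.closure_le _).2 ?_
    rintro τ ⟨q, a, h⟩
    obtain ⟨τ₀, h₀, h'⟩ := exists_isElementaryTransvection_eval_zero H h
    exact ⟨τ₀, Subgroup.subset_closure ⟨_, _, h₀⟩, h'⟩
  have h₂ : ETIdeal (C lam) (polySubgroup Λ) (polySubgroup J) f.poly ≤
      semiconjSubgroup (substQHom (0 : R))
        (ETIdeal (C lam) (polySubgroup Λ) (polySubgroup J) f.poly) := by
    refine (Subgroup.closure_le _).2 ?_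
    rintro τ ⟨q, hq, a, ha, h⟩
    obtain ⟨τ₀, h₀, h'⟩ := exists_isElementaryTransvection_eval_zero H h
    exact ⟨τ₀, Subgroup.subset_closure ⟨_, subst_zero_mem_idealSMul hq, _,
      substHom_mem _ zero_pow_mul_mem ha, h₀⟩, h'⟩
  have h₃ : ETRel (C lam) (polySubgroup Λ) (polySubgroup J) f.poly ≤
      semiconjSubgroup (substQHom (0 : R))
        (ETRel (C lam) (polySubgroup Λ) (polySubgroup J) f.poly) := by
    refine (Subgroup.closure_le _).2 ?_
    rintro τ ⟨g, hg, t, ht, rfl⟩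
    obtain ⟨g₀, hg₀, hg⟩ := h₁ hg
    obtain ⟨t₀, ht₀, ht⟩ := h₂ ht
    refine ⟨g₀ * t₀ * g₀⁻¹, Subgroup.subset_closure ⟨g₀, hg₀, t₀, ht₀, rfl⟩, fun x => ?_⟩
    have h' := hg (g⁻¹ x)
    rw [← LinearEquiv.mul_apply, mul_inv_cancel, LinearEquiv.coe_one, id] at h'
    rw [LinearEquiv.mul_apply, LinearEquiv.mul_apply, hg, ht, LinearEquiv.mul_apply,
      LinearEquiv.mul_apply, h', ← LinearEquiv.mul_apply g₀⁻¹, inv_mul_cancel, LinearEquiv.coe_one,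
      id]
  exact h₃ hτ

end

theorem mapGL_mulVec {B B' : Type*} [Ring B] [Ring B'] {m : ℕ} (κ : B →+* B')
    (g : (Matrix (Fin m ⊕ Fin m) (Fin m ⊕ Fin m) B)ˣ) (y : Fin m ⊕ Fin m → B) :
    (mapGL κ g).val.mulVec (fun k => κ (y k)) = fun k => κ (g.val.mulVec y k) := by
  ext1 k
  exact (RingHom.map_mulVec κ g.val y k).symm

/-- Unit multiples of the basis vectors are allowed, since only multiples of them by powers of `s`
are known to come from `Q`. -/
theorem eq_one_of_mulVec_single {B : Type*} [Ring B] {m : ℕ}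
    {g : (Matrix (Fin m ⊕ Fin m) (Fin m ⊕ Fin m) B)ˣ}
    (h : ∀ k, ∃ c : B, IsUnit c ∧ g.val.mulVec (Pi.single k c) = Pi.single k c) : g = 1 := by
  ext i k
  obtain ⟨c, hc, e⟩ := h k
  have e' := congrFun e i
  rw [Matrix.mulVec_single] at e'
  refine hc.mul_left_injective ?_
  change g.val i k * c = (1 : Matrix (Fin m ⊕ Fin m) (Fin m ⊕ Fin m) B) i k * c
  have e'' : g.val i k * c = (Pi.single k c : Fin m ⊕ Fin m → B) i := e'
  rw [e'', Matrix.one_apply, Pi.single_apply]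
  split_ifs <;> simp

theorem pair_eq_one {B : Type*} [Ring B] {m : ℕ}
    {g : (Matrix (Fin m ⊕ Fin m) (Fin m ⊕ Fin m) (B × B))ˣ}
    (h : mapGL (RingHom.fst B B) g = 1) (h' : mapGL (RingHom.snd B B) g = 1) : g = 1 := by
  ext i k
  · have e : (mapGL (RingHom.fst B B) g).val i k =
        (1 : Matrix (Fin m ⊕ Fin m) (Fin m ⊕ Fin m) B) i k := by
      rw [h]
      rfl
    refine e.trans ?_
    rw [Units.val_one, Matrix.one_apply, Matrix.one_apply]
    split_ifs <;> rfl
  · have e : (mapGL (RingHom.snd B B) g).val i k =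
        (1 : Matrix (Fin m ⊕ Fin m) (Fin m ⊕ Fin m) B) i k := by
      rw [h']
      rfl
    refine e.trans ?_
    rw [Units.val_one, Matrix.one_apply, Matrix.one_apply]
    split_ifs <;> rfl

end

/-! ### The relative dilation principle -/

theorem mainTheorem3
    {R : Type*} [Ring R] [StarRing R] [Module.Finite (Subring.center R) R]
    (lam : R) (hlam : lam ∈ Subring.center R) (hlam_one : lam * star lam = 1)
    (Λ : AddSubgroup R) (hΛ : IsFormParameter lam Λ)
    (J : Ideal R) [J.IsTwoSided] (hJ : ∀ a ∈ J, star a ∈ J)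
    -- the quadratic module `P` of rank `2 n ≥ 6`
    {P : Type*} [AddCommGroup P] [Module Rᵐᵒᵖ P] [Module.Finite Rᵐᵒᵖ P]
    [Module.Projective Rᵐᵒᵖ P] (f : SesquilinearForm R P) (hf : f.NonSingular lam)
    (n : ℕ) (hn : 3 ≤ n)
    -- the element `s`, the ring `R_s` and the quadratic module `P_s`, which is free and
    -- isometric to the standard hyperbolic module
    (s : formCenter Λ) (hs : ¬ IsNilpotent s)
    {Rs : Type*} [Ring Rs] [StarRing Rs] (φ : R →+* Rs) (hφ : IsRingLocalization (s : R) φ)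
    {Ps : Type*} [AddCommGroup Ps] [Module Rsᵐᵒᵖ Ps] (ι : P →+ Ps)
    (hι : IsModuleLocalization (s : R) φ ι)
    (fs : SesquilinearForm Rs Ps) (hfs : ∀ p q, fs.toFun (ι p) (ι q) = φ (f.toFun p q))
    (θ : Ps ≃ₗ[Rsᵐᵒᵖ] (Fin n ⊕ Fin n → Rs))
    (hθ : fs.IsIsometry (φ lam) (locSubgroup (s : R) φ Λ) (SesquilinearForm.hyperbolic Rs n) θ)
    -- the automorphism `σ(X)` of `Q[X]`
    (σ : (PolyMod P × R[X] × R[X]) ≃ₗ[R[X]ᵐᵒᵖ] (PolyMod P × R[X] × R[X]))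
    (hσ : σ ∈ GQ (C lam) (polySubgroup Λ) (polySubgroup J.toAddSubgroup) f.poly.perpHyperbolic)
    (hσ_zero : ∀ x : P × R × R, evalZeroQ (σ (constQ x)) = x)
    -- its localization `σ_s(X)`, with matrix `M` in the coordinates given by `θ`
    (σs : (PolyMod Ps × Rs[X] × Rs[X]) ≃ₗ[Rs[X]ᵐᵒᵖ] (PolyMod Ps × Rs[X] × Rs[X]))
    (hσs : ∀ x, σs (locQ φ ι x) = locQ φ ι (σ x))
    (M : (Matrix (Fin (n + 1) ⊕ Fin (n + 1)) (Fin (n + 1) ⊕ Fin (n + 1)) Rs[X])ˣ)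
    (hM : M ∈ EQRel (C (φ lam)) (polySubgroup (locSubgroup (s : R) φ Λ))
      (polySubgroup (locSubgroup (s : R) φ J.toAddSubgroup)) (n + 1))
    (hσM : ∀ y, coordQ θ (σs y) = M.val.mulVec (coordQ θ y)) :
    ∃ l : ℕ, 0 < l ∧ ∀ b : formCenter Λ, b ∈ Ideal.span {s ^ l} →
      ∃ σ' ∈ ETRel (C lam) (polySubgroup Λ) (polySubgroup J.toAddSubgroup) f.poly,
        (∀ x : P × R × R, evalZeroQ (σ' (constQ x)) = x) ∧
        -- `σ'` localizes to `σ(b X)`; a linear map on `Q[X]` is determined by its values on `Q`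
        ∀ x : P × R × R,
          locQ φ ι (σ' (constQ x)) = locQ φ ι (substQ (b : R) (σ (constQ x))) := by
  have hsR : (s : R) ∈ formCenter Λ := s.2
  have F := isFormInverting_poly (J := J) hlam hlam_one hΛ hJ hsR hφ
  have FF := F.isFormFiltration
  have H : IsCentralUnitary (C lam) :=
    { comm := fun x => by
        ext n
        rw [coeff_C_mul, coeff_mul_C, Subring.mem_center_iff.1 hlam]
      mul_star := by rw [star_C, ← C_mul, hlam_one, C_1] }
  have hw : ∀ x, locCoord φ ι θ (σ x) = M.val.mulVec (locCoord φ ι θ x) := fun x => by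
    change coordQ θ (locQ φ ι (σ x)) = _
    rw [← hσs, hσM]
    rfl
  have hconst : ∀ x : P × R × R, substQ (0 : R) (constQ x) = constQ x := fun x => by
    rw [← constQ_evalZeroQ, evalZeroQ_constQ]
  -- substitution in coordinates
  have hz : φ 0 ∈ Subring.center Rs := by
    rw [map_zero]
    exact zero_mem _
  have hsub : ∀ (b : R) (hb : φ b ∈ Subring.center Rs) x, locCoord φ ι θ (substQ b x) =
      fun k => substHom (φ b) hb (locCoord φ ι θ x k) := fun b hb x =>
    funext fun k => locCoord_substQ φ ι θ hι.map_smul b hb x k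
  have hfix : ∀ x : P × R × R, locCoord φ ι θ (constQ x) =
      fun k => substHom (φ 0) hz (locCoord φ ι θ (constQ x) k) := fun x => by
    rw [← hsub, hconst]
  have hc : ∀ b : formCenter Λ, φ b ∈ Subring.center Rs := fun b => hφ.map_mem_center b.2.1
  have h0 : (0 : Rs) ∈ Subring.center Rs := zero_mem _
  -- The condition `σ(0) = Id` is transported to the matrix: `M(0)` fixes the localizations of all
  -- constant vectors, and these include a unit multiple of every basis vector.
  have hM_zero : mapGL (substHom (φ 0) hz) M = 1 := by
    have h₁ : ∀ x : P × R × R, (mapGL (substHom (φ 0) hz) M).val.mulVec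
        (locCoord φ ι θ (constQ x)) = locCoord φ ι θ (constQ x) := by
      intro x
      have h₂ := hsub 0 hz (σ (constQ x))
      rw [← constQ_evalZeroQ, hσ_zero, hw, ← mapGL_mulVec, ← hfix] at h₂
      exact h₂.symm
    obtain ⟨N, hN⟩ := exists_basis_lift hΛ hsR hφ hι hfs hθ
    have h1 : constQ ((0, 1, 0) : P × R × R) = (0, 1, 0) := by simp [constQ]
    have h2 : constQ ((0, 0, 1) : P × R × R) = (0, 0, 1) := by simp [constQ]
    refine eq_one_of_mulVec_single fun k => ?_
    by_cases hk : k = Sum.inl 0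
    · refine ⟨1, isUnit_one, ?_⟩
      have := h₁ (0, 1, 0)
      rwa [h1, locCoord_plane_inl, ← hk] at this
    by_cases hk' : k = Sum.inr 0
    · refine ⟨1, isUnit_one, ?_⟩
      have := h₁ (0, 0, 1)
      rwa [h2, locCoord_plane_inr, ← hk'] at this
    obtain ⟨k', rfl⟩ := exists_eq_succ hk hk'
    obtain ⟨p, hp, -⟩ := hN k'
    refine ⟨C (φ s ^ N), (hφ.isUnit.pow N).map C, ?_⟩
    have h3 : locCoord φ ι θ (constQ ((p, 0, 0) : P × R × R)) =
        Pi.single (Sum.map Fin.succ Fin.succ k') (C (φ s ^ N)) := by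
      have := locCoord_basis hι.map_smul hp 1
      rw [map_one, mul_one, op_one, one_smul] at this
      rw [← this]
      simp [constQ]
    have := h₁ (p, 0, 0)
    rwa [h3] at this
  obtain ⟨g, hg, hg₁, hg₂⟩ := exists_pair_of_mem_EQRel hΛ hsR hφ hM
  obtain ⟨r, hr, hlift⟩ :=
    exists_rootGroup_le_liftPairs (J := J) hlam hlam_one hΛ hJ hsR hφ hι hfs hθ
  let D : formCenter Λ → Rs[X] × Rs[X] →+* Rs[X] × Rs[X] := fun b =>
    (substHom (φ b) (hc b)).prodMap (substHom (φ b) (hc b))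
  let e : Rs[X] × Rs[X] →+* Rs[X] × Rs[X] := (substHom 0 h0).prodMap (substHom 0 h0)
  have hpow : ∀ T : AddSubgroup R, ∀ n : ℕ, ∀ a ∈ T, (0 : R) ^ n * a ∈ T :=
    fun T => zero_pow_mul_mem
  have he : ∀ (T : AddSubgroup R) (p : ℤ), ∀ a ∈ pairFiltration (polySubgroup T)
      (polySubgroup J.toAddSubgroup) (mapRingHom φ) hφ.polyUnit p, e a ∈ pairFiltration
      (polySubgroup T) (polySubgroup J.toAddSubgroup) (mapRingHom φ) hφ.polyUnit p := by
    intro T p a ha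
    have := substHom_pair_mem hφ (zero_mem _) (hpow T) ha
    simpa only [map_zero] using this
  have hD : ∀ (T : AddSubgroup R), (∀ b ∈ formCenter Λ, ∀ a ∈ T, b * a ∈ T) → ∀ p q : ℤ, ∃ l : ℕ,
      ∀ b ∈ {b : formCenter Λ | ∃ c ∈ formCenter Λ, (b : R) = s ^ l * c},
      ∀ a ∈ pairFiltration (polySubgroup T) (polySubgroup J.toAddSubgroup) (mapRingHom φ)
        hφ.polyUnit p, D b a - e a ∈ pairFiltration (polySubgroup T)
          (polySubgroup J.toAddSubgroup) (mapRingHom φ) hφ.polyUnit q := by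
    intro T hT p q
    obtain ⟨l, hl⟩ := exists_substHom_pair_sub_mem (J := J) hlam hlam_one hΛ hJ hsR hφ hT p q
    exact ⟨l, fun b hb a ha => hl b b.2.1 hb a ha⟩
  -- The family `D b` is the substitution `X ↦ b X` in both components of the double, its limit `e`
  -- is `X ↦ 0`, and the target level `r` is the one from which pairs lift to transvections.
  obtain ⟨l, hl⟩ := FF.exists_dilation (by omega) D e
    (fun l => {b : formCenter Λ | ∃ c ∈ formCenter Λ, (b : R) = s ^ l * c})
    (by
      rintro l l' hll b ⟨c, hc, h⟩
      obtain ⟨d, rfl⟩ := Nat.exists_eq_add_of_le hll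
      exact ⟨s ^ d * c, mul_mem (pow_mem hsR d) hc, by rw [h, pow_add, mul_assoc]⟩)
    (fun b x => Prod.ext
      (substHom_star _ (hc b) (by rw [← hφ.map_star, b.2.2.1]) _)
      (substHom_star _ (hc b) (by rw [← hφ.map_star, b.2.2.1]) _))
    (fun b => by
      have : substHom (φ b) (hc b) (mapRingHom φ (C lam)) =
          mapRingHom φ (C lam) := by rw [coe_mapRingHom, map_C, substHom_C]
      exact Prod.ext this this)
    (fun x => Prod.ext (substHom_star _ h0 (star_zero _) _) (substHom_star _ h0 (star_zero _) _))
    (by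
      have : substHom 0 h0 (mapRingHom φ (C lam)) = mapRingHom φ (C lam) := by
        rw [coe_mapRingHom, map_C, substHom_C]
      exact Prod.ext this this)
    (by rw [← polySubgroup_top]; exact he ⊤) (he Λ)
    (by rw [← polySubgroup_top]; exact hD ⊤ fun _ _ _ _ => AddSubgroup.mem_top _)
    (hD Λ fun b hb => hb.2.2) hg r hr
  -- The shift by one only ensures a positive exponent; the spare `s` is absorbed into the cofactor.
  refine ⟨l + 1, Nat.succ_pos l, fun b hb => ?_⟩
  have hb' : ∃ c ∈ formCenter Λ, (b : R) = s ^ l * c := by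
    obtain ⟨c, hc⟩ := Ideal.mem_span_singleton'.1 hb
    refine ⟨c * s, mul_mem c.2 hsR, ?_⟩
    rw [← hc, Subring.mem_center_iff.1 (mul_mem c.2.1 hsR.1), Subring.coe_mul, Subring.coe_pow,
      pow_succ', mul_assoc]
  -- As `g = (1, M)` and `M(0) = 1`, the limit of `g` is trivial, so `(1, M(bX))` itself lies at
  -- level `r`.
  have heg : mapGL e g = 1 := by
    refine pair_eq_one ?_ ?_
    · change mapGL (substHom 0 h0) (mapGL (RingHom.fst _ _) g) = 1
      rw [hg₁, map_one]
    · change mapGL (substHom 0 h0) (mapGL (RingHom.snd _ _) g) = 1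
      rw [hg₂]
      simpa only [map_zero] using hM_zero
  have hlb := hl b hb'
  rw [heg, inv_one, mul_one] at hlb
  obtain ⟨τ, hτ, τ', hτ', hrel, hm, hm'⟩ := hlift hlb
  have hm₁ : HasMatrix (locCoord φ ι θ) τ 1 := by
    have : mapGL (RingHom.fst _ _) (mapGL (D b) g) = 1 := by
      change mapGL (substHom (φ b) (hc b)) (mapGL (RingHom.fst _ _) g) = 1
      rw [hg₁, map_one]
    rwa [this] at hm
  have hm₂ : HasMatrix (locCoord φ ι θ) τ'
      (mapGL (substHom (φ b) (hc b)) M) := by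
    have : mapGL (RingHom.snd _ _) (mapGL (D b) g) =
        mapGL (substHom (φ b) (hc b)) M := by
      rw [← hg₂]
      rfl
    rwa [this] at hm'
  -- Since `τ` has matrix `1`, the quotient `τ⁻¹ * τ'`, which is in the relative group, has the same
  -- matrix `M(bX)` as `τ'`.
  have hρ := hm₁.inv.mul hm₂
  rw [inv_one, one_mul] at hρ
  set ρ := τ⁻¹ * τ'
  -- The matrix determines `ρ` only up to `s`-torsion, so `ρ(0)` may differ from the identity. It is
  -- divided out within the relative group.
  obtain ⟨ρ₀, hρ₀, hρe⟩ := exists_eval_zero_mem_ETRel H hrel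
  have hinv : ∀ y, ρ (ρ⁻¹ y) = y := fun y => by
    rw [← LinearEquiv.mul_apply, mul_inv_cancel, LinearEquiv.coe_one, id]
  have hinv₀ : ∀ y, ρ₀ (ρ₀⁻¹ y) = y := fun y => by
    rw [← LinearEquiv.mul_apply, mul_inv_cancel, LinearEquiv.coe_one, id]
  -- On constants, `ρ₀⁻¹` is `ρ⁻¹` followed by `X = 0`. This makes its coordinates accessible
  -- through the matrix of `ρ⁻¹`.
  have hρ₀c : ∀ x : P × R × R, ρ₀⁻¹ (constQ x) = substQ (0 : R) (ρ⁻¹ (constQ x)) := by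
    intro x
    refine ρ₀.injective ?_
    rw [hinv₀, ← substQHom_apply, ← hρe, hinv, substQHom_apply, hconst]
  refine ⟨ρ * ρ₀⁻¹, mul_mem hrel (inv_mem hρ₀), fun x => ?_, fun x => ?_⟩
  · have h₁ : substQHom (0 : R) (ρ (ρ₀⁻¹ (constQ x))) = constQ x := by
      rw [hρe, hρ₀c, ← constQ_evalZeroQ, substQHom_apply, hconst, constQ_evalZeroQ, ← hρ₀c, hinv₀]
    rw [substQHom_apply, ← constQ_evalZeroQ] at h₁
    have h₂ := congrArg evalZeroQ h₁
    rwa [evalZeroQ_constQ, evalZeroQ_constQ] at h₂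
  · refine coordQ_injective θ ?_
    change locCoord φ ι θ (ρ (ρ₀⁻¹ (constQ x))) = locCoord φ ι θ (substQ (b : R) (σ (constQ x)))
    have hcomp : mapGL (substHom (φ 0) hz)
        (mapGL (substHom (φ b) (hc b)) M) = 1 := by
      rw [← hM_zero]
      change mapGL ((substHom (φ 0) hz).comp (substHom (φ b) (hc b))) M = _
      rw [substHom_comp_eq_left hz _ (map_zero φ)]
    -- The correction is invisible after localization: on constants `ρ₀⁻¹` acts through `M(bX)⁻¹`
    -- evaluated at `X = 0`, which is `M(0)⁻¹ = 1`.
    have h₁ : locCoord φ ι θ (ρ₀⁻¹ (constQ x)) = locCoord φ ι θ (constQ x) := by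
      rw [hρ₀c, hsub 0 hz, hρ.inv, ← mapGL_mulVec, ← hfix, map_inv, hcomp, inv_one, Units.val_one,
        Matrix.one_mulVec]
    have h₂ : substQ (b : R) (constQ x) = constQ x := by
      simp [substQ, constQ, PolyMod.subst_single]
    rw [hρ, h₁, hsub _ (hc b), hw, ← mapGL_mulVec, ← hsub, h₂]
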